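/- Let $0<\rho<1$ and let $\arg\in(-\pi,\pi]$ and $\log$ be principal branches. For integers $0<p<N$ let $M_\gamma$ be the tilted generator of TASEP with $p$ particles on the ring $\mathbb Z/N\mathbb Z$, $$(M_\gamma\phi)(\eta)=\sum_{x}\eta_{x+1}(1-\eta_x)\big(e^\gamma\phi(\eta^{x,x+1})-\phi(\eta)\big),$$ acting on functions of the configurations $\eta\in\{0,1\}^{\mathbb Z/N\mathbb Z}$ with $\sum_x\eta_x=p$, where $\eta^{x,x+1}$ is $\eta$ with $\eta_x,\eta_{x+1}$ exchanged. Let $\lambda_1(\gamma;N)$ be its eigenvalue with the largest real part and $\lambda_2(\gamma;N)$ an eigenvalue with the second largest real part (eigenvalues counted with multiplicity). For $C\in\mathbb C\setminus[0,\infty)$ and $1\le j\le N$ let $u_j(C)$ be the unique solution of $(1-u)^p(1+u)^{N-p}=C$ such that $\frac p\pi\arg(u-1)+\frac{N-p}\pi\arg(u+1)$ lies in $(-p+2(j-1),-p+2j]$ modulo $2N$; for $C>0$ let $u_j(C)=\lim_{\delta\uparrow0}u_j(Ce^{i\delta})$. A number $\lambda$ is said to be given by a set $A\subseteq\{1,\dots,N\}$,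 $|A|=p$, with parameter $C\neq0$, if $$2^Ne^{\gamma N}\prod_{j\in A}\frac{u_j(C)-1}{u_j(C)+1}+C=0\quad\text{and}\quad\lambda=\frac12\sum_{j\in A}(u_j(C)-1).$$ Put $r_{\rm cr}=2^{1/\rho}\rho(1-\rho)^{1/\rho-1}$. For $r>r_{\rm cr}$ there is a unique $u_*=u_*(r)$ with $\operatorname{Im}u_*>0$, $(1-u_*)^\rho(1+u_*)^{1-\rho}=r^\rho$ and $\rho\arg(1-u_*)+(1-\rho)\arg(1+u_*)=0$. With $\operatorname{Li}_2(z)=-\int_0^z\frac{\log(1-u)}u\,du$ on $\mathbb C\setminus[1,\infty)$, let $$\begin{aligned}G_\infty(z)&=\frac1\pi\Big\{\frac{1-\rho}\rho\log|1+z|\arg(1+z)+\log2\,\arg(1-z)-\operatorname{Im}\operatorname{Li}_2\Big(\frac12-\frac z2\Big)\Big\},\\ \Lambda_\infty(z)&=\frac1\pi\Big\{\frac{\operatorname{Im}z}2+(\rho-1)\arg(1+z)\Big\},\\ g_\infty(z)&=\frac{\pi i}{z-1+2\rho}\Big\{1-z^2-\frac{2\rho\operatorname{Im}z}{\arg(1+z)}\Big\}.\end{aligned}$$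 **Theorem.** For every $\gamma>0$ the equation $\gamma=G_\infty(u_*(r))$ has a unique solution $r=r_*(\gamma)>r_{\rm cr}$; $r_*$ is strictly increasing in $\gamma$, and $r_*(\gamma)\to r_{\rm cr}$ as $\gamma\to0+$. Let $\Lambda(\gamma,\rho)=\Lambda_\infty(u_*(r_*(\gamma)))$ and $g(\gamma,\rho)=g_\infty(u_*(r_*(\gamma)))$. Fix $\gamma>0$ and let $N\to\infty$ with $p=\rho N$ an integer. Assume that for all sufficiently large $N$ the eigenvalue $\lambda_1(\gamma;N)$ is given by $A=\{1,\dots,p\}$ with some parameter, and $\lambda_2(\gamma;N)$ is given by $A=\{1,\dots,p-1,p+1\}$ or by $A=\{2,\dots,p,N\}$ with some parameter. Then: 1. the limiting form of the consistency equations of both eigenvalues is $\gamma=G_\infty(u_*(r))$: if $C_N$ are parameters with which these sets give $\lambda_1(\gamma;N)$, respectively $\lambda_2(\gamma;N)$, then $|C_N|^{1/p}\to r_*(\gamma)$; 2. $\limsup_{N\to\infty}|\lambda_1(\gamma;N)-N\Lambda(\gamma,\rho)|<\infty$; 3. $N(\lambda_1(\gamma;N)-\lambda_2(\gamma;N))\to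 g(\gamma,\rho)$ along those $N$ for which $\lambda_2$ is given by $\{1,\dots,p-1,p+1\}$, and $N(\lambda_1(\gamma;N)-\lambda_2(\gamma;N))\to\overline{g(\gamma,\rho)}$ along those $N$ for which $\lambda_2$ is given by $\{2,\dots,p,N\}$. -/

import Mathlib

open Filter Topology

noncomputable section

namespace TASEP

/-! ### The tilted generator of TASEP on a ring -/

/-- Configurations of `p` particles on the ring with `N` sites, at most one particle per site. -/
def Config (N p : ℕ) : Type := {η : Fin N → Fin 2 // ∑ x, (η x : ℕ) = p}

instance (N p : ℕ) : Fintype (Config N p) :=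
  inferInstanceAs (Fintype {η : Fin N → Fin 2 // ∑ x, (η x : ℕ) = p})

instance (N p : ℕ) : DecidableEq (Config N p) :=
  inferInstanceAs (DecidableEq {η : Fin N → Fin 2 // ∑ x, (η x : ℕ) = p})

/-- Exchange of the occupation numbers at the sites `x` and `x + 1`; the cyclic successor
`x + 1` of `x` is `finRotate N x`. -/
def Config.exchange {N p : ℕ} (η : Config N p) (x : Fin N) : Config N p :=
  ⟨fun y => η.1 (Equiv.swap x (finRotate N x) y), by
    rw [Equiv.sum_comp (Equiv.swap x (finRotate N x)) (fun y => (η.1 y : ℕ))]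
    exact η.2⟩

/-- The matrix of the tilted generator
`(L_γ g)(η) = ∑ₓ η_{x+1} (1 - η_x) (e^γ g(η^{x,x+1}) - g(η))`. -/
def tiltedMatrix (N p : ℕ) (γ : ℝ) : Matrix (Config N p) (Config N p) ℂ :=
  Matrix.of fun η η' => ∑ x : Fin N,
    ((η.1 (finRotate N x) : ℕ) : ℂ) * (1 - ((η.1 x : ℕ) : ℂ)) *
      ((Real.exp γ : ℂ) * (if η' = η.exchange x then 1 else 0) - (if η' = η then 1 else 0))

/-- The eigenvalues of the tilted matrix, with algebraic multiplicity. -/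
def spectrumMultiset (N p : ℕ) (γ : ℝ) : Multiset ℂ := (tiltedMatrix N p γ).charpoly.roots

/-- `l₁` is an eigenvalue with the largest real part. -/
def IsLargestEigenvalue (N p : ℕ) (γ : ℝ) (l₁ : ℂ) : Prop :=
  l₁ ∈ spectrumMultiset N p γ ∧ ∀ μ ∈ spectrumMultiset N p γ, μ.re ≤ l₁.re

/-- `l₂` has the largest real part among the eigenvalues that remain once one copy of the
largest eigenvalue `l₁` is removed. -/
def IsSecondEigenvalue (N p : ℕ) (γ : ℝ) (l₁ l₂ : ℂ) : Prop :=
  l₂ ∈ (spectrumMultiset N p γ).erase l₁ ∧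
    ∀ μ ∈ (spectrumMultiset N p γ).erase l₁, μ.re ≤ l₂.re

/-! ### Bethe roots -/

/-- The labelling function `F(u) = (p/π) arg(u - 1) + ((N - p)/π) arg(u + 1) ∈ (-N, N]`. -/
def labelF (N p : ℕ) (u : ℂ) : ℝ :=
  (p : ℝ) / Real.pi * (u - 1).arg + ((N : ℝ) - p) / Real.pi * (u + 1).arg

/-- `u` solves `(1 - u)^p (1 + u)^(N - p) = C` and `F(u)` lies in the image of the interval
`(-p + 2(j - 1), -p + 2j]` modulo `2N`. -/
def IsLabelledRoot (N p j : ℕ) (C u : ℂ) : Prop :=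
  (1 - u) ^ p * (1 + u) ^ (N - p) = C ∧
    ∃ m : ℤ, labelF N p u + 2 * N * m ∈
      Set.Ioc (-(p : ℝ) + 2 * ((j : ℝ) - 1)) (-(p : ℝ) + 2 * j)

/-- `u = u_j(C)`, for `C ≠ 0` and `j ∈ {1, …, N}`: off the positive half-line it is the root
of label `j`; on the positive half-line it is the limit of `u_j(C e^{iδ})` as `δ ↑ 0`. -/
def IsBetheRoot (N p j : ℕ) (C u : ℂ) : Prop :=
  (¬ (C.im = 0 ∧ 0 ≤ C.re) ∧ IsLabelledRoot N p j C u) ∨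
  ((C.im = 0 ∧ 0 < C.re) ∧ ∃ v : ℝ → ℂ,
    (∀ᶠ δ : ℝ in 𝓝[<] 0,
      IsLabelledRoot N p j (C * Complex.exp (Complex.I * (δ : ℂ))) (v δ)) ∧
    Tendsto v (𝓝[<] 0) (𝓝 u))

/-- `C ≠ 0` solves the consistency equation
`2^N e^{γN} ∏_{j ∈ A} (u_j(C) - 1)/(u_j(C) + 1) + C = 0` for the index set `A`,
and the corresponding value `½ ∑_{j ∈ A} (u_j(C) - 1)` is `l`. -/
def Realizes (N p : ℕ) (γ : ℝ) (A : Finset ℕ) (C l : ℂ) : Prop :=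
  C ≠ 0 ∧ ∃ u : ℕ → ℂ, (∀ j ∈ A, IsBetheRoot N p j C (u j)) ∧
    (2 : ℂ) ^ N * (Real.exp (γ * N) : ℂ) * ∏ j ∈ A, (u j - 1) / (u j + 1) + C = 0 ∧
    l = 1 / 2 * ∑ j ∈ A, (u j - 1)

/-- The index set `{1, …, p}`. -/
def choiceOne (p : ℕ) : Finset ℕ := Finset.Icc 1 p

/-- The index set `{1, …, p - 1, p + 1}`. -/
def choiceTwo (p : ℕ) : Finset ℕ := insert (p + 1) (Finset.Icc 1 (p - 1))

/-- The index set `{2, …, p, N}`. -/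
def choiceTwo' (N p : ℕ) : Finset ℕ := insert N (Finset.Icc 2 p)

/-- The root-selection assumption for `γ > 0` at given `N` and `p`: `l₁` is given by
`{1, …, p}`, and `l₂` by `{1, …, p - 1, p + 1}` or by `{2, …, p, N}`. -/
def RootSelection (N p : ℕ) (γ : ℝ) (l₁ l₂ : ℂ) : Prop :=
  (∃ C, Realizes N p γ (choiceOne p) C l₁) ∧
    ((∃ C, Realizes N p γ (choiceTwo p) C l₂) ∨ ∃ C, Realizes N p γ (choiceTwo' N p) C l₂)

/-! ### The limit functions -/

/-- The critical radius `r_cr = 2^{1/ρ} ρ (1 - ρ)^{1/ρ - 1}`. -/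
def rCrit (ρ : ℝ) : ℝ := (2 : ℝ) ^ (1 / ρ) * ρ * (1 - ρ) ^ (1 / ρ - 1)

/-- The equations that determine `u_*(r)`, for `r > r_cr`. -/
def IsUStar (ρ r : ℝ) (u : ℂ) : Prop :=
  (1 - u) ^ (ρ : ℂ) * (1 + u) ^ ((1 - ρ : ℝ) : ℂ) = ((r ^ ρ : ℝ) : ℂ) ∧
    ρ * (1 - u).arg + (1 - ρ) * (1 + u).arg = 0 ∧ 0 < u.im

/-- `u_*(r)`, the solution of the above equations. -/
def uStar (ρ r : ℝ) : ℂ := Classical.epsilon (IsUStar ρ r)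

/-- The dilogarithm `-∫₀^z log(1 - u)/u du` on `ℂ \ [1, ∞)`, along the segment `u = t z`. -/
def dilog (z : ℂ) : ℂ := -∫ t in (0 : ℝ)..1, Complex.log (1 - (t : ℂ) * z) / (t : ℂ)

def GInf (ρ : ℝ) (z : ℂ) : ℝ :=
  1 / Real.pi * ((1 - ρ) / ρ * Real.log ‖1 + z‖ * (1 + z).arg
    + Real.log 2 * (1 - z).arg - (dilog (1 / 2 - z / 2)).im)

def LambdaInf (ρ : ℝ) (z : ℂ) : ℝ :=
  1 / Real.pi * (z.im / 2 + (ρ - 1) * (1 + z).arg)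

def gInf (ρ : ℝ) (z : ℂ) : ℂ :=
  (Real.pi : ℂ) * Complex.I / (z - 1 + 2 * (ρ : ℂ)) *
    (1 - z ^ 2 - ((2 * ρ * z.im / (1 + z).arg : ℝ) : ℂ))

/-- `r > r_cr` solves the limiting consistency equation `γ = G_∞(u_*(r))`. -/
def IsRStar (ρ γ r : ℝ) : Prop := rCrit ρ < r ∧ γ = GInf ρ (uStar ρ r)

/-- `r_*(γ)`, the solution of the limiting consistency equation. -/
def rStar (ρ γ : ℝ) : ℝ := Classical.epsilon (IsRStar ρ γ)

/-- `Λ(γ, ρ)`. -/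
def Lam (γ ρ : ℝ) : ℝ := LambdaInf ρ (uStar ρ (rStar ρ γ))

/-- `g(γ, ρ)`. -/
def gapConst (γ ρ : ℝ) : ℂ := gInf ρ (uStar ρ (rStar ρ γ))

end TASEP

end

/-!
Passing to the logarithmic coordinate `ζ = ρ log (w - 1) + (1 - ρ) log (w + 1)` turns the `N` roots
of `(1 - w)^p (1 + w)^(N - p) = C` into equidistant points, at distance `2π / N`, of the vertical
line `Re ζ = ρ log |C|^{1/p}`. The roots selected for the first eigenvalue fill the part of this
line in `|Im ζ| < ρ π`, whose upper end corresponds to `u_*(r)`. The logarithm of the consistency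
equation is then a Riemann sum over the segment, with limit `γ = G_∞(u_*(r))`, and the midpoint
rule makes the eigenvalue accurate to order one.

For the second eigenvalue the last point of the row moves up by one step and the whole row shifts
slightly to compensate. As the shift tends to zero, it changes the sums of any two holomorphic
functions in the ratio of the differences of their values at the two ends of the segment. Hence the
two consistency equations already determine the gap, without solving for the shifts to order `1/N`.
-/

namespace TASEP

open Set
open Complex (I arg slitPlane)
open scoped Real ComplexConjugate

/-! ### The logarithmic coordinate -/

section LogCoord

variable {ρ : ℝ} {w : ℂ}

/-- The plane cut along `(-∞, 1]`, on which the logarithmic coordinate is holomorphic. -/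
def cutPlane : Set ℂ := {w | w - 1 ∈ slitPlane}

/-- The logarithmic coordinate `ζ = ρ log (w - 1) + (1 - ρ) log (w + 1)`: up to the factor `N` and
an additive constant, the logarithm of `(1 - w)^p (1 + w)^(N - p)`. -/
noncomputable def logCoord (ρ : ℝ) (w : ℂ) : ℂ :=
  ρ * Complex.log (w - 1) + (1 - ρ) * Complex.log (w + 1)

/-- The real part of the logarithmic coordinate, which is continuous off `±1`. -/
noncomputable def logMod (ρ : ℝ) (w : ℂ) : ℝ :=
  ρ * Real.log ‖w - 1‖ + (1 - ρ) * Real.log ‖w + 1‖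

/-- The absolute value of the imaginary part of the logarithmic coordinate. Folding the two sides
of the cut onto each other in this way makes it continuous off `±1`. -/
noncomputable def absArg (ρ : ℝ) (w : ℂ) : ℝ :=
  ρ * |(w - 1).arg| + (1 - ρ) * |(w + 1).arg|

/-- The value `ρ log r_cr` of `logMod ρ` at the critical point `1 - 2ρ` of the logarithmic
coordinate. -/
noncomputable def critLogMod (ρ : ℝ) : ℝ :=
  Real.log 2 + ρ * Real.log ρ + (1 - ρ) * Real.log (1 - ρ)

/-- The derivative `(w - 1 + 2ρ) / (w² - 1)` of the logarithmic coordinate. -/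
noncomputable def logCoordDeriv (ρ : ℝ) (w : ℂ) : ℂ := (w - 1 + 2 * ρ) / ((w - 1) * (w + 1))

theorem logCoord_re (ρ : ℝ) (w : ℂ) : (logCoord ρ w).re = logMod ρ w := by
  simp [logCoord, logMod, Complex.log_re]

theorem logCoord_im (ρ : ℝ) (w : ℂ) :
    (logCoord ρ w).im = ρ * (w - 1).arg + (1 - ρ) * (w + 1).arg := by
  simp [logCoord, Complex.log_im]

theorem mem_cutPlane_iff : w ∈ cutPlane ↔ 1 < w.re ∨ w.im ≠ 0 := by
  simp [cutPlane, Complex.mem_slitPlane_iff]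

theorem mem_cutPlane_of_im_pos (hw : 0 < w.im) : w ∈ cutPlane :=
  mem_cutPlane_iff.2 (Or.inr hw.ne')

theorem isOpen_cutPlane : IsOpen cutPlane :=
  Complex.isOpen_slitPlane.preimage (by fun_prop)

theorem add_one_mem_slitPlane (hw : w ∈ cutPlane) : w + 1 ∈ slitPlane := by
  rw [mem_cutPlane_iff] at hw
  rw [Complex.mem_slitPlane_iff]
  refine hw.imp (fun h => ?_) (fun h => by simpa using h)
  rw [Complex.add_re, Complex.one_re]
  linarith

theorem ne_of_mem_cutPlane (hw : w ∈ cutPlane) : w ≠ 1 ∧ w ≠ -1 :=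
  ⟨sub_ne_zero.1 (Complex.slitPlane_ne_zero hw),
    fun h => Complex.slitPlane_ne_zero (add_one_mem_slitPlane hw) (by rw [h]; simp)⟩

theorem conj_mem_cutPlane (hw : w ∈ cutPlane) : conj w ∈ cutPlane := by
  rw [mem_cutPlane_iff] at hw ⊢
  simpa using hw

theorem logCoord_conj (hw : w ∈ cutPlane) : logCoord ρ (conj w) = conj (logCoord ρ w) := by
  rw [logCoord, show conj w - 1 = conj (w - 1) by simp, show conj w + 1 = conj (w + 1) by simp,
    Complex.log_conj _ (Complex.slitPlane_arg_ne_pi hw),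
    Complex.log_conj _ (Complex.slitPlane_arg_ne_pi (add_one_mem_slitPlane hw))]
  simp [logCoord]

theorem arg_pos_of_im_pos (hw : 0 < w.im) : 0 < w.arg :=
  (Complex.arg_nonneg_iff.2 hw.le).lt_of_ne' fun h => hw.ne' (Complex.arg_eq_zero_iff.1 h).2

theorem logCoord_im_pos (hρ0 : 0 < ρ) (hρ1 : ρ < 1) (hw : 0 < w.im) : 0 < (logCoord ρ w).im := by
  have h1 : 0 < (w - 1).arg := arg_pos_of_im_pos (by simpa using hw)
  have h2 : 0 < (w + 1).arg := arg_pos_of_im_pos (by simpa using hw)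
  rw [logCoord_im]
  exact add_pos (mul_pos hρ0 h1) (mul_pos (sub_pos.2 hρ1) h2)

theorem logCoord_im_neg (hρ0 : 0 < ρ) (hρ1 : ρ < 1) (hw : w.im < 0) : (logCoord ρ w).im < 0 := by
  have hc : 0 < (conj w).im := by simpa using hw
  have h := logCoord_im_pos hρ0 hρ1 hc
  rw [logCoord_conj (mem_cutPlane_iff.2 (Or.inr hw.ne))] at h
  simpa using h

theorem logCoord_im_eq_zero (hw : w.im = 0) (hw1 : 1 < w.re) : (logCoord ρ w).im = 0 := by
  rw [logCoord_im, Complex.arg_eq_zero_iff.2 ⟨by simpa using hw1.le, by simpa using hw⟩,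
    Complex.arg_eq_zero_iff.2 ⟨by simp; linarith, by simpa using hw⟩]
  simp

theorem sign_logCoord_im (hρ0 : 0 < ρ) (hρ1 : ρ < 1) (hw : w ∈ cutPlane) :
    SignType.sign (logCoord ρ w).im = SignType.sign w.im := by
  rcases lt_trichotomy w.im 0 with h | h | h
  · rw [sign_neg h, sign_neg (logCoord_im_neg hρ0 hρ1 h)]
  · rw [h, logCoord_im_eq_zero h ((mem_cutPlane_iff.1 hw).resolve_right (not_not.2 h))]
  · rw [sign_pos h, sign_pos (logCoord_im_pos hρ0 hρ1 h)]

theorem absArg_eq_of_im_nonneg (hw : 0 ≤ w.im) : absArg ρ w = (logCoord ρ w).im := by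
  rw [absArg, logCoord_im, abs_of_nonneg (Complex.arg_nonneg_iff.2 (by simpa using hw)),
    abs_of_nonneg (Complex.arg_nonneg_iff.2 (by simpa using hw))]

theorem absArg_eq_of_im_neg (hw : w.im < 0) : absArg ρ w = -(logCoord ρ w).im := by
  rw [absArg, logCoord_im, abs_of_neg (Complex.arg_neg_iff.2 (by simpa using hw)),
    abs_of_neg (Complex.arg_neg_iff.2 (by simpa using hw))]
  ring

theorem absArg_eq_abs_logCoord_im (hρ0 : 0 < ρ) (hρ1 : ρ < 1) (w : ℂ) :
    absArg ρ w = |(logCoord ρ w).im| := by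
  rcases le_or_gt 0 w.im with h | h
  · rw [← absArg_eq_of_im_nonneg h, absArg]
    exact (abs_of_nonneg (add_nonneg (mul_nonneg hρ0.le (abs_nonneg _))
      (mul_nonneg (sub_pos.2 hρ1).le (abs_nonneg _)))).symm
  · rw [absArg_eq_of_im_neg h, abs_of_neg (logCoord_im_neg hρ0 hρ1 h)]

theorem logCoordDeriv_eq (hw : w ≠ 1) (hw' : w ≠ -1) :
    logCoordDeriv ρ w = ρ * (1 / (w - 1)) + (1 - ρ) * (1 / (w + 1)) := by
  have h1 : w - 1 ≠ 0 := sub_ne_zero.2 hw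
  have h2 : w + 1 ≠ 0 := by rwa [ne_eq, ← eq_neg_iff_add_eq_zero]
  rw [logCoordDeriv]
  field_simp
  ring

theorem hasStrictDerivAt_logCoord (ρ : ℝ) (hw : w ∈ cutPlane) :
    HasStrictDerivAt (logCoord ρ) (logCoordDeriv ρ w) w := by
  rw [logCoordDeriv_eq (ne_of_mem_cutPlane hw).1 (ne_of_mem_cutPlane hw).2]
  exact ((HasStrictDerivAt.clog ((hasStrictDerivAt_id w).sub_const 1) hw).const_mul (ρ : ℂ)).add
    ((HasStrictDerivAt.clog ((hasStrictDerivAt_id w).add_const 1)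
      (add_one_mem_slitPlane hw)).const_mul (1 - ρ : ℂ))

theorem logCoordDeriv_ne_zero (hρ0 : 0 < ρ) (hw : w ∈ cutPlane) : logCoordDeriv ρ w ≠ 0 := by
  refine div_ne_zero (fun h => ?_) (mul_ne_zero (Complex.slitPlane_ne_zero hw)
    (Complex.slitPlane_ne_zero (add_one_mem_slitPlane hw)))
  have hcrit : w = ((1 - 2 * ρ : ℝ) : ℂ) := by
    push_cast
    linear_combination h
  rw [hcrit, mem_cutPlane_iff, Complex.ofReal_re, Complex.ofReal_im] at hw
  exact hw.elim (fun h => by linarith) (fun h => h rfl)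

theorem one_div_im_neg (hw : 0 < w.im) : (1 / w).im < 0 := by
  rw [one_div, Complex.inv_im, neg_div, neg_lt_zero]
  exact div_pos hw (Complex.normSq_pos.2 fun h => by simp [h] at hw)

theorem logCoordDeriv_im_neg (hρ0 : 0 < ρ) (hρ1 : ρ < 1) (hw : 0 < w.im) :
    (logCoordDeriv ρ w).im < 0 := by
  obtain ⟨hw1, hw2⟩ := ne_of_mem_cutPlane (mem_cutPlane_of_im_pos hw)
  have h1 : (1 / (w - 1)).im < 0 := one_div_im_neg (by simpa using hw)
  have h2 : (1 / (w + 1)).im < 0 := one_div_im_neg (by simpa using hw)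
  rw [logCoordDeriv_eq hw1 hw2, Complex.add_im, ← Complex.ofReal_one, ← Complex.ofReal_sub,
    Complex.im_ofReal_mul, Complex.im_ofReal_mul, Complex.ofReal_one]
  nlinarith [mul_pos hρ0 (neg_pos.2 h1), mul_pos (sub_pos.2 hρ1) (neg_pos.2 h2)]

theorem injOn_of_hasDerivAt_im_neg {U : Set ℂ} (hU : Convex ℝ U) {f f' : ℂ → ℂ}
    (hf : ∀ z ∈ U, HasDerivAt f (f' z) z) (hf' : ∀ z ∈ U, (f' z).im < 0) : InjOn f U := by
  intro a ha b hb hab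
  by_contra hne
  have hba : b - a ≠ 0 := sub_ne_zero.2 (Ne.symm hne)
  have hmem : ∀ t ∈ Icc (0 : ℝ) 1, a + t * (b - a) ∈ U := fun t ht => by
    simpa using hU.add_smul_sub_mem ha hb ht
  let g : ℝ → ℝ := fun t => (f (a + t * (b - a)) / (b - a)).im
  have hg : ∀ t ∈ Icc (0 : ℝ) 1, HasDerivAt g (f' (a + t * (b - a))).im t := by
    intro t ht
    have hline : HasDerivAt (fun t : ℂ => a + t * (b - a)) (b - a) (t : ℂ) := by
      simpa using ((hasDerivAt_id (t : ℂ)).mul_const (b - a)).const_add a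
    have h := (((hf _ (hmem t ht)).comp (t : ℂ) hline).div_const (b - a)).comp_ofReal
    rw [mul_div_cancel_right₀ _ hba] at h
    exact Complex.imCLM.hasFDerivAt.comp_hasDerivAt t h
  obtain ⟨t, ht, hslope⟩ := exists_hasDerivAt_eq_slope g _ zero_lt_one
    (fun t ht => (hg t ht).continuousAt.continuousWithinAt)
    (fun t ht => hg t (Ioo_subset_Icc_self ht))
  have hends : g 1 = g 0 := by simp [g, hab]
  rw [hends, sub_self, zero_div] at hslope
  exact (hf' _ (hmem t (Ioo_subset_Icc_self ht))).ne hslope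

theorem injOn_logCoord_upperHalfPlane (hρ0 : 0 < ρ) (hρ1 : ρ < 1) :
    InjOn (logCoord ρ) {w | 0 < w.im} :=
  injOn_of_hasDerivAt_im_neg (convex_halfSpace_im_gt 0)
    (fun _ hz => (hasStrictDerivAt_logCoord ρ (mem_cutPlane_of_im_pos hz)).hasDerivAt)
    (fun _ hz => logCoordDeriv_im_neg hρ0 hρ1 hz)

theorem logMod_ofReal (ρ x : ℝ) :
    logMod ρ (x : ℂ) = ρ * Real.log (x - 1) + (1 - ρ) * Real.log (x + 1) := by
  rw [logMod, ← Complex.ofReal_one, ← Complex.ofReal_sub, ← Complex.ofReal_add, Complex.norm_real,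
    Complex.norm_real, Real.norm_eq_abs, Real.norm_eq_abs, Real.log_abs, Real.log_abs]

theorem strictMonoOn_logMod_ofReal (hρ0 : 0 < ρ) (hρ1 : ρ < 1) :
    StrictMonoOn (fun x : ℝ => logMod ρ (x : ℂ)) (Ioi 1) := by
  intro x (hx : 1 < x) y _ hxy
  have h1 := Real.log_lt_log (by linarith) (by linarith : x - 1 < y - 1)
  have h2 := Real.log_lt_log (by linarith) (by linarith : x + 1 < y + 1)
  simp only [logMod_ofReal]
  nlinarith [mul_pos hρ0 (sub_pos.2 h1), mul_pos (sub_pos.2 hρ1) (sub_pos.2 h2)]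

theorem ofReal_re_of_im_eq_zero (hw : w.im = 0) : (w.re : ℂ) = w :=
  Complex.ext (by simp) (by simp [hw])

theorem injOn_logCoord (hρ0 : 0 < ρ) (hρ1 : ρ < 1) : InjOn (logCoord ρ) cutPlane := by
  intro a ha b hb h
  have hsign : SignType.sign a.im = SignType.sign b.im := by
    rw [← sign_logCoord_im hρ0 hρ1 ha, ← sign_logCoord_im hρ0 hρ1 hb, h]
  rcases lt_trichotomy a.im 0 with ha' | ha' | ha'
  · have hb' : b.im < 0 := by rwa [sign_neg ha', eq_comm, sign_eq_neg_one_iff] at hsign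
    refine (starRingEnd ℂ).injective (injOn_logCoord_upperHalfPlane hρ0 hρ1 ?_ ?_ ?_)
    · simpa using ha'
    · simpa using hb'
    · rw [logCoord_conj ha, logCoord_conj hb, h]
  · have hb' : b.im = 0 := by rwa [ha', sign_zero, eq_comm, sign_eq_zero_iff] at hsign
    have ha1 : 1 < a.re := (mem_cutPlane_iff.1 ha).resolve_right (not_not.2 ha')
    have hb1 : 1 < b.re := (mem_cutPlane_iff.1 hb).resolve_right (not_not.2 hb')
    have hre : a.re = b.re := (strictMonoOn_logMod_ofReal hρ0 hρ1).injOn ha1 hb1 (by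
      simp only [ofReal_re_of_im_eq_zero ha', ofReal_re_of_im_eq_zero hb', ← logCoord_re, h])
    exact Complex.ext hre (ha'.trans hb'.symm)
  · have hb' : 0 < b.im := by rwa [sign_pos ha', eq_comm, sign_eq_one_iff] at hsign
    exact injOn_logCoord_upperHalfPlane hρ0 hρ1 ha' hb' h

end LogCoord

/-! ### The critical value -/

section CriticalValue

variable {ρ : ℝ} {w : ℂ}

theorem logMod_ofReal_le_critLogMod (hρ0 : 0 < ρ) (hρ1 : ρ < 1) {y : ℝ} (hy : -1 < y)
    (hy' : y < 1) : logMod ρ (y : ℂ) ≤ critLogMod ρ := by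
  have hρ : 0 < 1 - ρ := sub_pos.2 hρ1
  have h1 : 0 < 1 - y := sub_pos.2 hy'
  have h2 : 0 < y + 1 := by linarith
  have hjensen := strictConcaveOn_log_Ioi.concaveOn.2 (mem_Ioi.2 (div_pos h1 hρ0))
    (mem_Ioi.2 (div_pos h2 hρ)) hρ0.le hρ.le (by ring)
  simp only [smul_eq_mul] at hjensen
  rw [mul_div_cancel₀ _ hρ0.ne', mul_div_cancel₀ _ hρ.ne', Real.log_div h1.ne' hρ0.ne',
    Real.log_div h2.ne' hρ.ne', show 1 - y + (y + 1) = 2 by ring] at hjensen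
  rw [logMod_ofReal, ← neg_sub 1 y, Real.log_neg_eq_log, critLogMod]
  linarith

theorem norm_sub_one_mul_sin (w : ℂ) :
    ‖w - 1‖ * Real.sin ((w - 1).arg - (w + 1).arg) = 2 * Real.sin (w + 1).arg := by
  have hc1 : ‖w - 1‖ * Real.cos (w - 1).arg = w.re - 1 := by simp [Complex.norm_mul_cos_arg]
  have hs1 : ‖w - 1‖ * Real.sin (w - 1).arg = w.im := by simp [Complex.norm_mul_sin_arg]
  have hc2 : ‖w + 1‖ * Real.cos (w + 1).arg = w.re + 1 := by simp [Complex.norm_mul_cos_arg]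
  have hs2 : ‖w + 1‖ * Real.sin (w + 1).arg = w.im := by simp [Complex.norm_mul_sin_arg]
  have hline : w.im * Real.cos (w + 1).arg = (w.re + 1) * Real.sin (w + 1).arg := by
    rw [← hs2, ← hc2]
    ring
  rw [Real.sin_sub]
  linear_combination Real.cos (w + 1).arg * hs1 - Real.sin (w + 1).arg * hc1 + hline

theorem norm_add_one_mul_sin (w : ℂ) :
    ‖w + 1‖ * Real.sin ((w - 1).arg - (w + 1).arg) = 2 * Real.sin (w - 1).arg := by
  have hc1 : ‖w - 1‖ * Real.cos (w - 1).arg = w.re - 1 := by simp [Complex.norm_mul_cos_arg]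
  have hs1 : ‖w - 1‖ * Real.sin (w - 1).arg = w.im := by simp [Complex.norm_mul_sin_arg]
  have hc2 : ‖w + 1‖ * Real.cos (w + 1).arg = w.re + 1 := by simp [Complex.norm_mul_cos_arg]
  have hs2 : ‖w + 1‖ * Real.sin (w + 1).arg = w.im := by simp [Complex.norm_mul_sin_arg]
  have hline : w.im * Real.cos (w - 1).arg = (w.re - 1) * Real.sin (w - 1).arg := by
    rw [← hs1, ← hc1]
    ring
  rw [Real.sin_sub]
  linear_combination Real.sin (w - 1).arg * hc2 - Real.cos (w - 1).arg * hs2 - hline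

theorem sin_arg_pos (hw : 0 < w.im) : 0 < Real.sin w.arg :=
  Real.sin_pos_of_pos_of_lt_pi (arg_pos_of_im_pos hw) (Complex.arg_lt_pi_iff.2 (Or.inr hw.ne'))

theorem arg_add_one_lt_arg_sub_one (hw : 0 < w.im) : (w + 1).arg < (w - 1).arg := by
  have hpos : 0 < (w - 1).arg := arg_pos_of_im_pos (by simpa using hw)
  have hlt : (w + 1).arg < π := Complex.arg_lt_pi_iff.2 (Or.inr (by simpa using hw.ne'))
  have hsin : 0 < Real.sin (w + 1).arg := sin_arg_pos (by simpa using hw)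
  have h := norm_sub_one_mul_sin w
  by_contra! hle
  have := Real.sin_nonpos_of_nonpos_of_neg_pi_le (x := (w - 1).arg - (w + 1).arg)
    (by linarith) (by linarith)
  nlinarith [norm_nonneg (w - 1)]

theorem mul_sin_lt_sin_mul {c t : ℝ} (hc0 : 0 < c) (hc1 : c < 1) (ht : t ∈ Ioo 0 π) :
    c * Real.sin t < Real.sin (c * t) := by
  have h := strictConcaveOn_sin_Icc.2 (Ioo_subset_Icc_self ht) (left_mem_Icc.2 Real.pi_pos.le)
    ht.1.ne' hc0 (sub_pos.2 hc1) (by ring)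
  simpa using h

/-- With `t = π - (arg (w - 1) - arg (w + 1))`, the level curve `Im ζ = ρ π` is
`‖w - 1‖ = 2 sin (ρ t) / sin t`, `‖w + 1‖ = 2 sin ((1 - ρ) t) / sin t` for `0 < t < π`. -/
theorem two_mul_lt_norm_of_logCoord_im_eq (hρ0 : 0 < ρ) (hρ1 : ρ < 1) (hw : 0 < w.im)
    (h : (logCoord ρ w).im = ρ * π) : 2 * ρ < ‖w - 1‖ ∧ 2 * (1 - ρ) < ‖w + 1‖ := by
  obtain ⟨t, ht⟩ : ∃ t, t = π - ((w - 1).arg - (w + 1).arg) := ⟨_, rfl⟩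
  have hlt := arg_add_one_lt_arg_sub_one hw
  have hlt' : (w - 1).arg < π := Complex.arg_lt_pi_iff.2 (Or.inr (by simpa using hw.ne'))
  have hpos : 0 < (w + 1).arg := arg_pos_of_im_pos (by simpa using hw)
  have htmem : t ∈ Ioo 0 π := ⟨by linarith, by linarith⟩
  have hsin : 0 < Real.sin t := Real.sin_pos_of_mem_Ioo htmem
  rw [logCoord_im] at h
  have harg1 : (w - 1).arg = π - (1 - ρ) * t := by rw [ht]; linarith
  have harg2 : (w + 1).arg = ρ * t := by rw [ht]; linarith
  have hsub : (w - 1).arg - (w + 1).arg = π - t := by linarith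
  have h1 := norm_sub_one_mul_sin w
  have h2 := norm_add_one_mul_sin w
  rw [hsub, Real.sin_pi_sub, harg2] at h1
  rw [hsub, Real.sin_pi_sub, harg1, Real.sin_pi_sub] at h2
  have hs1 := mul_sin_lt_sin_mul hρ0 hρ1 htmem
  have hs2 := mul_sin_lt_sin_mul (sub_pos.2 hρ1) (sub_lt_self 1 hρ0) htmem
  constructor <;> exact lt_of_mul_lt_mul_right (by linarith) hsin.le

theorem critLogMod_lt_of_logCoord_im_eq (hρ0 : 0 < ρ) (hρ1 : ρ < 1) (hw : 0 < w.im)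
    (h : (logCoord ρ w).im = ρ * π) : critLogMod ρ < logMod ρ w := by
  have hρ : 0 < 1 - ρ := sub_pos.2 hρ1
  obtain ⟨h1, h2⟩ := two_mul_lt_norm_of_logCoord_im_eq hρ0 hρ1 hw h
  replace h1 := mul_lt_mul_of_pos_left (Real.log_lt_log (by positivity) h1) hρ0
  replace h2 := mul_lt_mul_of_pos_left (Real.log_lt_log (by positivity) h2) hρ
  rw [Real.log_mul two_ne_zero hρ0.ne'] at h1
  rw [Real.log_mul two_ne_zero hρ.ne'] at h2
  rw [critLogMod, logMod]
  linarith

end CriticalValue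

/-! ### A priori bounds and compactness -/

section Compactness

variable {ρ : ℝ} {w : ℂ}

theorem norm_sub_one_le (w : ℂ) : ‖w - 1‖ ≤ ‖w + 1‖ + 2 := by
  calc ‖w - 1‖ = ‖w + 1 - 2‖ := by ring_nf
    _ ≤ ‖w + 1‖ + ‖(2 : ℂ)‖ := norm_sub_le _ _
    _ = ‖w + 1‖ + 2 := by simp

theorem norm_add_one_le (w : ℂ) : ‖w + 1‖ ≤ ‖w - 1‖ + 2 := by
  calc ‖w + 1‖ = ‖w - 1 + 2‖ := by ring_nf
    _ ≤ ‖w - 1‖ + ‖(2 : ℂ)‖ := norm_add_le _ _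
    _ = ‖w - 1‖ + 2 := by simp

theorem norm_sub_one_pos (hw : w ≠ 1) : 0 < ‖w - 1‖ := norm_pos_iff.2 (sub_ne_zero.2 hw)

theorem norm_add_one_pos (hw : w ≠ -1) : 0 < ‖w + 1‖ :=
  norm_pos_iff.2 fun h => hw (eq_neg_of_add_eq_zero_left h)

theorem exp_logMod (ρ : ℝ) (hw : w ≠ 1) (hw' : w ≠ -1) :
    Real.exp (logMod ρ w) = ‖w - 1‖ ^ ρ * ‖w + 1‖ ^ (1 - ρ) := by
  rw [Real.rpow_def_of_pos (norm_sub_one_pos hw), Real.rpow_def_of_pos (norm_add_one_pos hw'),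
    ← Real.exp_add, logMod, mul_comm ρ, mul_comm (1 - ρ)]

theorem exp_logMod_le (hρ0 : 0 < ρ) (hρ1 : ρ < 1) (hw : w ≠ 1) (hw' : w ≠ -1) :
    Real.exp (logMod ρ w) ≤ ‖w + 1‖ + 2 := by
  have hb : 0 < ‖w + 1‖ + 2 := by positivity
  calc Real.exp (logMod ρ w) = ‖w - 1‖ ^ ρ * ‖w + 1‖ ^ (1 - ρ) := exp_logMod ρ hw hw'
    _ ≤ (‖w + 1‖ + 2) ^ ρ * (‖w + 1‖ + 2) ^ (1 - ρ) := by
        gcongr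
        · exact norm_sub_one_le w
        · linarith
    _ = ‖w + 1‖ + 2 := by rw [← Real.rpow_add hb, add_sub_cancel, Real.rpow_one]

theorem norm_sub_one_le_rpow_mul_rpow_add_two (hρ0 : 0 < ρ) (hρ1 : ρ < 1) (w : ℂ) :
    ‖w - 1‖ ≤ ‖w - 1‖ ^ ρ * ‖w + 1‖ ^ (1 - ρ) + 2 := by
  obtain ⟨m, hm⟩ : ∃ m, m = min ‖w - 1‖ ‖w + 1‖ := ⟨_, rfl⟩
  have hm0 : 0 ≤ m := hm ▸ le_min (norm_nonneg _) (norm_nonneg _)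
  have hmul : m ≤ ‖w - 1‖ ^ ρ * ‖w + 1‖ ^ (1 - ρ) := by
    calc m = m ^ ρ * m ^ (1 - ρ) := by
          rw [← Real.rpow_add' hm0 (by norm_num), add_sub_cancel, Real.rpow_one]
      _ ≤ ‖w - 1‖ ^ ρ * ‖w + 1‖ ^ (1 - ρ) := by
          gcongr
          · exact hm ▸ min_le_left _ _
          · exact hm ▸ min_le_right _ _
  have := norm_sub_one_le w
  rcases min_choice ‖w - 1‖ ‖w + 1‖ with h | h <;> linarith

/-- The closed band between two level curves of `logMod ρ`. The points `±1`, where `logMod ρ`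
takes a junk value, are excluded. -/
def levelBand (ρ a b : ℝ) : Set ℂ := {w | w ≠ 1 ∧ w ≠ -1 ∧ logMod ρ w ∈ Icc a b}

theorem levelBand_eq (hρ0 : 0 < ρ) (hρ1 : ρ < 1) (a b : ℝ) :
    levelBand ρ a b = (fun w : ℂ => ‖w - 1‖ ^ ρ * ‖w + 1‖ ^ (1 - ρ)) ⁻¹'
      Icc (Real.exp a) (Real.exp b) := by
  ext w
  by_cases hw : w = 1 ∨ w = -1
  · have hzero : ‖w - 1‖ ^ ρ * ‖w + 1‖ ^ (1 - ρ) = 0 := by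
      rcases hw with rfl | rfl
      · simp [Real.zero_rpow hρ0.ne']
      · simp [Real.zero_rpow (sub_pos.2 hρ1).ne']
    refine iff_of_false (fun h => hw.elim h.1 h.2.1) fun h => ?_
    rw [mem_preimage, hzero] at h
    exact (Real.exp_pos a).not_ge h.1
  · obtain ⟨h1, h2⟩ := not_or.1 hw
    simp [levelBand, h1, h2, ← exp_logMod ρ h1 h2]

theorem isCompact_levelBand (hρ0 : 0 < ρ) (hρ1 : ρ < 1) (a b : ℝ) :
    IsCompact (levelBand ρ a b) := by
  rw [levelBand_eq hρ0 hρ1]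
  refine (isCompact_closedBall (1 : ℂ) (Real.exp b + 2)).of_isClosed_subset
    (isClosed_Icc.preimage ?_) fun w hw => ?_
  · exact ((by fun_prop : Continuous fun w : ℂ => ‖w - 1‖).rpow_const fun _ => Or.inr hρ0.le).mul
      ((by fun_prop : Continuous fun w : ℂ => ‖w + 1‖).rpow_const
        fun _ => Or.inr (sub_pos.2 hρ1).le)
  · rw [Metric.mem_closedBall, dist_eq_norm]
    exact (norm_sub_one_le_rpow_mul_rpow_add_two hρ0 hρ1 w).trans (add_le_add_left hw.2 2)

theorem continuousAt_abs_arg {z : ℂ} (hz : z ≠ 0) : ContinuousAt (fun z : ℂ => |z.arg|) z := by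
  have habs : ∀ y : ℂ, y ≠ 0 → |y.arg| = Real.arccos (y.re / ‖y‖) := fun y hy => by
    rw [← Complex.cos_arg hy, ← Real.cos_abs,
      Real.arccos_cos (abs_nonneg _) (Complex.abs_arg_le_pi y)]
  have harccos : ContinuousAt (fun y : ℂ => Real.arccos (y.re / ‖y‖)) z :=
    Real.continuous_arccos.continuousAt.comp
      (Complex.continuous_re.continuousAt.div continuous_norm.continuousAt (norm_ne_zero_iff.2 hz))
  refine harccos.congr ?_
  filter_upwards [isOpen_ne.mem_nhds hz] with y hy using (habs y hy).symm

theorem continuousAt_absArg (hw : w ≠ 1) (hw' : w ≠ -1) : ContinuousAt (absArg ρ) w := by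
  have h1 : ContinuousAt (fun w : ℂ => |(w - 1).arg|) w :=
    ContinuousAt.comp (f := fun w : ℂ => w - 1) (continuousAt_abs_arg (sub_ne_zero.2 hw))
      (by fun_prop)
  have h2 : ContinuousAt (fun w : ℂ => |(w + 1).arg|) w :=
    ContinuousAt.comp (f := fun w : ℂ => w + 1)
      (continuousAt_abs_arg fun h => hw' (eq_neg_of_add_eq_zero_left h)) (by fun_prop)
  exact (continuousAt_const.mul h1).add (continuousAt_const.mul h2)

theorem continuousAt_logMod (hw : w ≠ 1) (hw' : w ≠ -1) : ContinuousAt (logMod ρ) w := by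
  have h1 : ContinuousAt (fun w : ℂ => Real.log ‖w - 1‖) w :=
    ContinuousAt.log (by fun_prop) (norm_sub_one_pos hw).ne'
  have h2 : ContinuousAt (fun w : ℂ => Real.log ‖w + 1‖) w :=
    ContinuousAt.log (by fun_prop) (norm_add_one_pos hw').ne'
  exact (continuousAt_const.mul h1).add (continuousAt_const.mul h2)

theorem exists_tendsto_of_tendsto_logMod (hρ0 : 0 < ρ) (hρ1 : ρ < 1) {ι : Type*}
    {U : Ultrafilter ι} {w : ι → ℂ} (hw : ∀ᶠ i in U, w i ≠ 1 ∧ w i ≠ -1) {x ψ : ℝ}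
    (hx : Tendsto (fun i => logMod ρ (w i)) U (𝓝 x))
    (hψ : Tendsto (fun i => absArg ρ (w i)) U (𝓝 ψ)) :
    ∃ v, v ≠ 1 ∧ v ≠ -1 ∧ logMod ρ v = x ∧ absArg ρ v = ψ ∧ Tendsto w U (𝓝 v) := by
  have hband : ∀ᶠ i in U, w i ∈ levelBand ρ (x - 1) (x + 1) := by
    filter_upwards [hw, hx.eventually (Icc_mem_nhds (sub_one_lt x) (lt_add_one x))]
      with i hi hix using ⟨hi.1, hi.2, hix⟩
  obtain ⟨v, hv, hlim⟩ := (isCompact_levelBand hρ0 hρ1 (x - 1) (x + 1)).ultrafilter_le_nhds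
    (U.map w) (le_principal_iff.2 hband)
  obtain ⟨hv1, hv2, -⟩ := hv
  have hlim : Tendsto w U (𝓝 v) := hlim
  exact ⟨v, hv1, hv2, tendsto_nhds_unique ((continuousAt_logMod hv1 hv2).tendsto.comp hlim) hx,
    tendsto_nhds_unique ((continuousAt_absArg hv1 hv2).tendsto.comp hlim) hψ, hlim⟩

end Compactness

/-! ### The inverse of the logarithmic coordinate -/

section Inverse

variable {ρ : ℝ} {w ζ : ℂ}

/-- The image of the cut plane under the logarithmic coordinate. -/
def logCoordImage (ρ : ℝ) : Set ℂ := logCoord ρ '' cutPlane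

/-- The strip `|Im ζ| < π` with the two notches `Re ζ ≤ critLogMod ρ`, `ρ π ≤ |Im ζ|` cut out: a
region covered by the logarithmic coordinate. -/
def notchedStrip (ρ : ℝ) : Set ℂ :=
  {ζ | |ζ.im| < ρ * π ∨ critLogMod ρ < ζ.re ∧ |ζ.im| < π}

theorem isOpen_logCoordImage (hρ0 : 0 < ρ) : IsOpen (logCoordImage ρ) := by
  rw [isOpen_iff_mem_nhds]
  rintro _ ⟨w, hw, rfl⟩
  rw [← (hasStrictDerivAt_logCoord ρ hw).map_nhds_eq (logCoordDeriv_ne_zero hρ0 hw)]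
  exact image_mem_map (isOpen_cutPlane.mem_nhds hw)

theorem absArg_of_re_mem_Ioo (hw : w.im = 0) (hre : w.re ∈ Ioo (-1) 1) :
    absArg ρ w = ρ * π := by
  rw [absArg, Complex.arg_eq_pi_iff.2 ⟨by simpa using hre.2, by simpa using hw⟩,
    Complex.arg_eq_zero_iff.2 ⟨by rw [Complex.add_re, Complex.one_re]; linarith [hre.1],
      by simpa using hw⟩]
  simp [abs_of_pos Real.pi_pos]

theorem absArg_of_re_lt_neg_one (hw : w.im = 0) (hre : w.re < -1) : absArg ρ w = π := by
  rw [absArg, Complex.arg_eq_pi_iff.2 ⟨by rw [Complex.sub_re, Complex.one_re]; linarith,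
      by simpa using hw⟩,
    Complex.arg_eq_pi_iff.2 ⟨by rw [Complex.add_re, Complex.one_re]; linarith, by simpa using hw⟩,
    abs_of_pos Real.pi_pos]
  ring

theorem mem_cutPlane_of_logCoord_mem (hρ0 : 0 < ρ) (hρ1 : ρ < 1) (hw : w ≠ 1) (hw' : w ≠ -1)
    (h : logCoord ρ w ∈ notchedStrip ρ) : w ∈ cutPlane := by
  have hπ : ρ * π < π := mul_lt_of_lt_one_left Real.pi_pos hρ1
  rw [notchedStrip, mem_ofPred_eq, ← absArg_eq_abs_logCoord_im hρ0 hρ1, logCoord_re] at h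
  by_contra hcut
  obtain ⟨hre, him⟩ : w.re ≤ 1 ∧ w.im = 0 := by simpa [mem_cutPlane_iff] using hcut
  have hne1 : w.re ≠ 1 := fun h => hw (Complex.ext (by simpa using h) (by simpa using him))
  have hne2 : w.re ≠ -1 := fun h => hw' (Complex.ext (by simpa using h) (by simpa using him))
  rcases hne2.lt_or_gt with hlt | hgt
  · rw [absArg_of_re_lt_neg_one him hlt] at h
    exact h.elim hπ.not_gt fun h => h.2.false
  · have hlt := hre.lt_of_ne hne1
    rw [absArg_of_re_mem_Ioo him ⟨hgt, hlt⟩, ← ofReal_re_of_im_eq_zero him] at h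
    exact h.elim (lt_irrefl _) fun h =>
      (logMod_ofReal_le_critLogMod hρ0 hρ1 hgt hlt).not_gt h.1

theorem mem_logCoordImage_of_mem_closure (hρ0 : 0 < ρ) (hρ1 : ρ < 1)
    (hζ : ζ ∈ closure (logCoordImage ρ)) (h : ζ ∈ notchedStrip ρ) : ζ ∈ logCoordImage ρ := by
  obtain ⟨V, hV, hVζ⟩ := mem_closure_iff_ultrafilter.1 hζ
  choose! w hw hwζ using fun z (hz : z ∈ logCoordImage ρ) => hz
  have hlim : Tendsto (fun z => logCoord ρ (w z)) V (𝓝 ζ) :=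
    (tendsto_id'.2 hVζ).congr' (mem_of_superset hV fun z hz => (hwζ z hz).symm)
  have hx : Tendsto (fun z => logMod ρ (w z)) V (𝓝 ζ.re) := by
    simp only [← logCoord_re]
    exact (Complex.continuous_re.tendsto ζ).comp hlim
  have hψ : Tendsto (fun z => absArg ρ (w z)) V (𝓝 |ζ.im|) := by
    simp only [absArg_eq_abs_logCoord_im hρ0 hρ1]
    exact ((Complex.continuous_im.tendsto ζ).comp hlim).abs
  obtain ⟨v, hv1, hv2, hvx, hvψ, hv⟩ := exists_tendsto_of_tendsto_logMod hρ0 hρ1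
    (mem_of_superset hV fun z hz => ne_of_mem_cutPlane (hw z hz)) hx hψ
  have hcut : v ∈ cutPlane := by
    refine mem_cutPlane_of_logCoord_mem hρ0 hρ1 hv1 hv2 ?_
    rwa [notchedStrip, mem_ofPred_eq, ← absArg_eq_abs_logCoord_im hρ0 hρ1, logCoord_re, hvx, hvψ]
  exact ⟨v, hcut, tendsto_nhds_unique
    ((hasStrictDerivAt_logCoord ρ hcut).hasDerivAt.continuousAt.tendsto.comp hv) hlim⟩

theorem exists_logCoord_mem_notchedStrip (hρ0 : 0 < ρ) (hρ1 : ρ < 1) :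
    ∃ w ∈ cutPlane, (logCoord ρ w).im = 0 ∧ critLogMod ρ < (logCoord ρ w).re := by
  have h3 : (3 : ℂ) ∈ cutPlane := mem_cutPlane_iff.2 (by norm_num)
  refine ⟨3, h3, logCoord_im_eq_zero (by norm_num) (by norm_num), ?_⟩
  have hnorm1 : ‖(3 : ℂ) - 1‖ = 2 := by norm_num
  have hnorm2 : ‖(3 : ℂ) + 1‖ = 4 := by norm_num
  rw [logCoord_re, logMod, critLogMod, hnorm1, hnorm2]
  have h24 := Real.log_lt_log two_pos (by norm_num : (2 : ℝ) < 4)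
  have hlog1 := Real.log_neg hρ0 hρ1
  have hlog2 := Real.log_neg (sub_pos.2 hρ1) (by linarith)
  nlinarith [mul_pos hρ0 (neg_pos.2 hlog1), mul_pos (sub_pos.2 hρ1) (neg_pos.2 hlog2),
    mul_pos (sub_pos.2 hρ1) (sub_pos.2 h24)]

theorem convex_abs_im_lt (a : ℝ) : Convex ℝ {ζ : ℂ | |ζ.im| < a} := by
  have h : {ζ : ℂ | |ζ.im| < a} = {ζ | -a < ζ.im} ∩ {ζ | ζ.im < a} := by
    ext ζ
    exact abs_lt (a := ζ.im)
  rw [h]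
  exact (convex_halfSpace_im_gt _).inter (convex_halfSpace_im_lt _)

theorem isPreconnected_notchedStrip (hρ0 : 0 < ρ) : IsPreconnected (notchedStrip ρ) := by
  refine IsPreconnected.union ((critLogMod ρ + 1 : ℝ) : ℂ) ?_ ?_
    (convex_abs_im_lt (ρ * π)).isPreconnected
    ((convex_halfSpace_re_gt (critLogMod ρ)).inter (convex_abs_im_lt π)).isPreconnected
  · change |((critLogMod ρ + 1 : ℝ) : ℂ).im| < ρ * π
    rw [Complex.ofReal_im, abs_zero]
    exact mul_pos hρ0 Real.pi_pos
  · exact ⟨by simp, by simp [Real.pi_pos]⟩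

/-- The image is open, and relatively closed in the connected region `notchedStrip ρ`. -/
theorem notchedStrip_subset_logCoordImage (hρ0 : 0 < ρ) (hρ1 : ρ < 1) :
    notchedStrip ρ ⊆ logCoordImage ρ := by
  obtain ⟨w, hw, him, hre⟩ := exists_logCoord_mem_notchedStrip hρ0 hρ1
  refine (isPreconnected_notchedStrip hρ0).subset_of_closure_inter_subset
    (isOpen_logCoordImage hρ0) ⟨logCoord ρ w, Or.inr ⟨hre, ?_⟩, w, hw, rfl⟩
    fun z hz => mem_logCoordImage_of_mem_closure hρ0 hρ1 hz.1 hz.2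
  rw [him, abs_zero]
  exact Real.pi_pos

/-- The inverse of the logarithmic coordinate, with values in the cut plane. -/
noncomputable def logCoordInv (ρ : ℝ) : ℂ → ℂ := Function.invFunOn (logCoord ρ) cutPlane

theorem logCoordInv_mem (h : ζ ∈ logCoordImage ρ) : logCoordInv ρ ζ ∈ cutPlane :=
  Function.invFunOn_mem h

theorem logCoord_logCoordInv (h : ζ ∈ logCoordImage ρ) : logCoord ρ (logCoordInv ρ ζ) = ζ :=
  Function.invFunOn_eq h

theorem logCoordInv_logCoord (hρ0 : 0 < ρ) (hρ1 : ρ < 1) (h : w ∈ cutPlane) :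
    logCoordInv ρ (logCoord ρ w) = w :=
  (injOn_logCoord hρ0 hρ1).leftInvOn_invFunOn h

theorem hasDerivAt_logCoordInv (hρ0 : 0 < ρ) (hρ1 : ρ < 1) (h : ζ ∈ logCoordImage ρ) :
    HasDerivAt (logCoordInv ρ) (logCoordDeriv ρ (logCoordInv ρ ζ))⁻¹ ζ := by
  obtain ⟨w, hw, rfl⟩ := h
  rw [logCoordInv_logCoord hρ0 hρ1 hw]
  refine ((hasStrictDerivAt_logCoord ρ hw).to_local_left_inverse (logCoordDeriv_ne_zero hρ0 hw)
    ?_).hasDerivAt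
  filter_upwards [isOpen_cutPlane.mem_nhds hw] with z hz using logCoordInv_logCoord hρ0 hρ1 hz

theorem conj_mem_logCoordImage (h : ζ ∈ logCoordImage ρ) : conj ζ ∈ logCoordImage ρ := by
  obtain ⟨w, hw, rfl⟩ := h
  exact ⟨_, conj_mem_cutPlane hw, logCoord_conj hw⟩

theorem logCoordInv_conj (hρ0 : 0 < ρ) (hρ1 : ρ < 1) (h : ζ ∈ logCoordImage ρ) :
    logCoordInv ρ (conj ζ) = conj (logCoordInv ρ ζ) := by
  obtain ⟨w, hw, rfl⟩ := h
  rw [← logCoord_conj hw, logCoordInv_logCoord hρ0 hρ1 hw,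
    logCoordInv_logCoord hρ0 hρ1 (conj_mem_cutPlane hw)]

theorem logCoordInv_im_pos (hρ0 : 0 < ρ) (hρ1 : ρ < 1) (h : ζ ∈ logCoordImage ρ)
    (hζ : 0 < ζ.im) : 0 < (logCoordInv ρ ζ).im := by
  have hsign := sign_logCoord_im hρ0 hρ1 (logCoordInv_mem h)
  rwa [logCoord_logCoordInv h, sign_pos hζ, eq_comm, sign_eq_one_iff] at hsign

end Inverse
/-! ### The dilogarithm -/

section Dilogarithm

variable {z : ℂ}

theorem one_sub_mul_mem_slitPlane (hz : 1 - z ∈ slitPlane) {t : ℝ} (ht : t ∈ Icc (0 : ℝ) 1) :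
    1 - (t : ℂ) * z ∈ slitPlane := by
  have h := Complex.starConvex_one_slitPlane.add_smul_mem (y := -z)
    (by simpa [sub_eq_add_neg] using hz) ht.1 ht.2
  simpa [sub_eq_add_neg] using h

theorem intervalIntegrable_dilog (hz : 1 - z ∈ slitPlane) :
    IntervalIntegrable (fun t : ℝ => Complex.log (1 - (t : ℂ) * z) / (t : ℂ))
      MeasureTheory.volume 0 1 := by
  let g : ℝ → ℂ := fun t => Complex.log (1 - (t : ℂ) * z)
  have hg : ∀ t ∈ Icc (0 : ℝ) 1, DifferentiableAt ℝ g t := by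
    intro t ht
    have hlin : HasDerivAt (fun t : ℂ => 1 - t * z) (-(1 * z)) (t : ℂ) :=
      ((hasDerivAt_id (t : ℂ)).mul_const z).const_sub 1
    exact (hlin.clog (one_sub_mul_mem_slitPlane hz ht)).comp_ofReal.differentiableAt
  have hcont : ContinuousOn (dslope g 0) (uIcc 0 1) := by
    rw [uIcc_of_le zero_le_one]
    intro t ht
    refine ContinuousAt.continuousWithinAt ?_
    rcases eq_or_ne t 0 with rfl | h
    · exact continuousAt_dslope_same.2 (hg 0 ht)
    · exact (continuousAt_dslope_of_ne h).2 (hg t ht).continuousAt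
  refine hcont.intervalIntegrable.congr fun t ht => ?_
  rw [uIoc_of_le zero_le_one] at ht
  rw [dslope_of_ne _ ht.1.ne', slope_def_module]
  simp only [g, Complex.ofReal_zero, zero_mul, sub_zero, Complex.log_one]
  rw [Complex.real_smul, Complex.ofReal_inv, div_eq_inv_mul]

theorem exists_bound_inv_one_sub_mul (hz : 1 - z ∈ slitPlane) :
    ∃ s ∈ 𝓝 z, (∀ y ∈ s, 1 - y ∈ slitPlane) ∧
      ∃ B, ∀ t ∈ Icc (0 : ℝ) 1, ∀ y ∈ s, ‖(1 - (t : ℂ) * y)⁻¹‖ ≤ B := by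
  have hopen : IsOpen {z : ℂ | 1 - z ∈ slitPlane} :=
    Complex.isOpen_slitPlane.preimage (by fun_prop)
  obtain ⟨ε, hε, hball⟩ := Metric.nhds_basis_closedBall.mem_iff.1 (hopen.mem_nhds hz)
  have hcont : ContinuousOn (fun q : ℝ × ℂ => (1 - (q.1 : ℂ) * q.2)⁻¹)
      (Icc (0 : ℝ) 1 ×ˢ Metric.closedBall z ε) := by
    refine ContinuousOn.inv₀ (by fun_prop) ?_
    rintro ⟨t, y⟩ ⟨ht, hy⟩
    exact Complex.slitPlane_ne_zero (one_sub_mul_mem_slitPlane (hball hy) ht)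
  obtain ⟨B, hB⟩ := (isCompact_Icc.prod (isCompact_closedBall z ε)).exists_bound_of_continuousOn
    hcont
  exact ⟨_, Metric.closedBall_mem_nhds z hε, hball, B, fun t ht y hy => hB (t, y) ⟨ht, hy⟩⟩

theorem hasDerivAt_neg_log_one_sub_mul_div {t : ℝ} (ht : t ≠ 0)
    (hz : 1 - (t : ℂ) * z ∈ slitPlane) :
    HasDerivAt (fun y : ℂ => -(Complex.log (1 - (t : ℂ) * y) / (t : ℂ)))
      (1 - (t : ℂ) * z)⁻¹ z := by
  have hlin : HasDerivAt (fun y : ℂ => 1 - (t : ℂ) * y) (-((t : ℂ) * 1)) z :=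
    ((hasDerivAt_id z).const_mul (t : ℂ)).const_sub 1
  have ht' : (t : ℂ) ≠ 0 := Complex.ofReal_ne_zero.2 ht
  have hz' := Complex.slitPlane_ne_zero hz
  convert! ((hlin.clog hz).div_const (t : ℂ)).neg using 1
  field_simp

theorem hasDerivAt_dilog (hz : 1 - z ∈ slitPlane) :
    HasDerivAt dilog (∫ t in (0 : ℝ)..1, (1 - (t : ℂ) * z)⁻¹) z := by
  obtain ⟨s, hs, hslit, B, hB⟩ := exists_bound_inv_one_sub_mul hz
  have h := intervalIntegral.hasDerivAt_integral_of_dominated_loc_of_deriv_le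
    (μ := MeasureTheory.volume) (a := (0 : ℝ)) (b := 1)
    (F := fun (y : ℂ) (t : ℝ) => -(Complex.log (1 - (t : ℂ) * y) / (t : ℂ)))
    (F' := fun y t => (1 - (t : ℂ) * y)⁻¹) (x₀ := z) (bound := fun _ => B) hs
    (mem_of_superset hs fun y hy =>
      (intervalIntegrable_dilog (hslit y hy)).neg.def'.aestronglyMeasurable)
    (intervalIntegrable_dilog hz).neg ?_ ?_ intervalIntegrable_const ?_
  · have hderiv := h.2
    simp only [intervalIntegral.integral_neg] at hderiv
    exact hderiv
  all_goals rw [uIoc_of_le zero_le_one]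
  · refine ContinuousOn.aestronglyMeasurable (ContinuousOn.inv₀ (by fun_prop) fun t ht => ?_)
      measurableSet_Ioc
    exact Complex.slitPlane_ne_zero (one_sub_mul_mem_slitPlane hz (Ioc_subset_Icc_self ht))
  · exact Eventually.of_forall fun t ht y hy => hB t (Ioc_subset_Icc_self ht) y hy
  · exact Eventually.of_forall fun t ht y hy => hasDerivAt_neg_log_one_sub_mul_div ht.1.ne'
      (one_sub_mul_mem_slitPlane (hslit y hy) (Ioc_subset_Icc_self ht))

theorem dilog_conj (hz : 1 - z ∈ slitPlane) : dilog (conj z) = conj (dilog z) := by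
  rw [dilog, dilog, map_neg, intervalIntegral.integral_of_le zero_le_one,
    intervalIntegral.integral_of_le zero_le_one, ← integral_conj]
  congr 1
  refine MeasureTheory.setIntegral_congr_fun measurableSet_Ioc fun t ht => ?_
  have hlog := Complex.log_conj _ (Complex.slitPlane_arg_ne_pi
    (one_sub_mul_mem_slitPlane hz (Ioc_subset_Icc_self ht)))
  simp only [map_sub, map_one, map_mul, Complex.conj_ofReal] at hlog
  simp only [hlog, map_div₀, Complex.conj_ofReal]

end Dilogarithm

/-! ### The primitive of the consistency integrand -/

section LogHalfPrim

variable {ρ : ℝ} {w ζ : ℂ}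

/-- The logarithm of `(1 + w) / 2`, whose real part is the integrand of the limiting consistency
equation. -/
noncomputable def logHalf (w : ℂ) : ℂ := Complex.log (w + 1) - (Real.log 2 : ℝ)

theorem logHalf_re (w : ℂ) : (logHalf w).re = Real.log ‖w + 1‖ - Real.log 2 := by
  simp [logHalf, Complex.log_re]

theorem logHalf_im (w : ℂ) : (logHalf w).im = (w + 1).arg := by
  simp only [logHalf, Complex.sub_im, Complex.log_im, Complex.ofReal_im, sub_zero]

/-- A primitive of `logHalf` with respect to the logarithmic coordinate; it is the source of the
dilogarithm in `GInf`. -/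
noncomputable def logHalfPrim (ρ : ℝ) (w : ℂ) : ℂ :=
  (1 - ρ) * (Complex.log (w + 1) ^ 2 / 2 - (Real.log 2 : ℝ) * Complex.log (w + 1))
    - ρ * dilog (1 / 2 - w / 2)

theorem one_sub_half_sub_half_mem_slitPlane (hw : w + 1 ∈ slitPlane) :
    1 - (1 / 2 - w / 2) ∈ slitPlane := by
  have h : 1 - (1 / 2 - w / 2) = ((1 / 2 : ℝ) : ℂ) * (w + 1) := by
    push_cast
    ring
  rw [h, Complex.mem_slitPlane_iff, Complex.re_ofReal_mul, Complex.im_ofReal_mul]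
  exact (Complex.mem_slitPlane_iff.1 hw).imp (fun h => by positivity) (fun h => by positivity)

theorem log_one_sub_half_sub_half (hw : w ≠ -1) :
    Complex.log (1 + -(1 / 2 - w / 2)) = logHalf w := by
  have h : 1 + -(1 / 2 - w / 2) = ((1 / 2 : ℝ) : ℂ) * (w + 1) := by
    push_cast
    ring
  rw [h, Complex.log_ofReal_mul one_half_pos fun h => hw (eq_neg_of_add_eq_zero_left h), logHalf,
    one_div, Real.log_inv]
  push_cast
  ring

theorem hasDerivAt_logHalf (hw : w ∈ cutPlane) : HasDerivAt logHalf (1 / (w + 1)) w :=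
  (((hasDerivAt_id w).add_const 1).clog (add_one_mem_slitPlane hw)).sub_const _

theorem differentiableAt_logHalfPrim (ρ : ℝ) (hw : w + 1 ∈ slitPlane) :
    DifferentiableAt ℂ (logHalfPrim ρ) w := by
  have h1 : DifferentiableAt ℂ (fun w : ℂ => Complex.log (w + 1)) w :=
    DifferentiableAt.clog (by fun_prop) hw
  have h2 : DifferentiableAt ℂ (fun w : ℂ => dilog (1 / 2 - w / 2)) w :=
    DifferentiableAt.comp (f := fun w : ℂ => 1 / 2 - w / 2) w
      (hasDerivAt_dilog (one_sub_half_sub_half_mem_slitPlane hw)).differentiableAt (by fun_prop)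
  exact ((((h1.pow 2).div_const 2).sub (h1.const_mul _)).const_mul _).sub (h2.const_mul _)

theorem logHalfPrim_conj (ρ : ℝ) (hw : w + 1 ∈ slitPlane) :
    logHalfPrim ρ (conj w) = conj (logHalfPrim ρ w) := by
  have h1 := Complex.log_conj _ (Complex.slitPlane_arg_ne_pi hw)
  have h2 := dilog_conj (one_sub_half_sub_half_mem_slitPlane hw)
  simp only [map_sub, map_add, map_div₀, map_one, map_ofNat] at h1 h2
  simp only [logHalfPrim, h1, h2, map_sub, map_mul, map_div₀, map_pow, map_one, map_ofNat,
    Complex.conj_ofReal]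

theorem hasDerivAt_dilog_half_sub_half (hw : w ∈ cutPlane) :
    HasDerivAt (fun w : ℂ => dilog (1 / 2 - w / 2)) (-(logHalf w / (w - 1))) w := by
  have hslit := one_sub_half_sub_half_mem_slitPlane (add_one_mem_slitPlane hw)
  have hw1 := Complex.slitPlane_ne_zero hw
  have hlin : HasDerivAt (fun w : ℂ => 1 / 2 - w / 2) (-(1 / 2)) w :=
    ((hasDerivAt_id w).div_const 2).const_sub (1 / 2)
  have hlog := Complex.log_eq_integral (z := -(1 / 2 - w / 2))
    (by simpa [sub_eq_add_neg] using hslit)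
  have hsmul : ∀ t : ℝ, (1 : ℂ) + t • -(1 / 2 - w / 2) = 1 - (t : ℂ) * (1 / 2 - w / 2) := by
    intro t
    rw [Complex.real_smul]
    ring
  simp only [log_one_sub_half_sub_half (ne_of_mem_cutPlane hw).2, hsmul] at hlog
  convert! (hasDerivAt_dilog hslit).comp w hlin using 1
  rw [hlog]
  field_simp
  ring

theorem hasDerivAt_logHalfPrim (ρ : ℝ) (hw : w ∈ cutPlane) :
    HasDerivAt (logHalfPrim ρ) (logHalf w * logCoordDeriv ρ w) w := by
  have hlog : HasDerivAt (fun w : ℂ => Complex.log (w + 1)) (1 / (w + 1)) w :=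
    ((hasDerivAt_id w).add_const 1).clog (add_one_mem_slitPlane hw)
  convert! ((((hlog.pow 2).div_const 2).sub (hlog.const_mul ((Real.log 2 : ℝ) : ℂ))).const_mul
    (1 - ρ : ℂ)).sub ((hasDerivAt_dilog_half_sub_half hw).const_mul (ρ : ℂ)) using 1
  rw [logCoordDeriv_eq (ne_of_mem_cutPlane hw).1 (ne_of_mem_cutPlane hw).2, logHalf]
  ring

theorem hasDerivAt_logHalfPrim_logCoordInv (hρ0 : 0 < ρ) (hρ1 : ρ < 1)
    (h : ζ ∈ logCoordImage ρ) :
    HasDerivAt (fun ζ => logHalfPrim ρ (logCoordInv ρ ζ)) (logHalf (logCoordInv ρ ζ)) ζ := by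
  have hm := logCoordInv_mem h
  have hcomp := (hasDerivAt_logHalfPrim ρ hm).comp ζ (hasDerivAt_logCoordInv hρ0 hρ1 h)
  rwa [mul_assoc, mul_inv_cancel₀ (logCoordDeriv_ne_zero hρ0 hm), mul_one] at hcomp

end LogHalfPrim
/-! ### The limiting consistency function -/

section CriticalRadius

variable {ρ r : ℝ}

theorem rCrit_pos (hρ0 : 0 < ρ) (hρ1 : ρ < 1) : 0 < rCrit ρ := by
  have hρ' : 0 < 1 - ρ := sub_pos.2 hρ1
  exact mul_pos (mul_pos (Real.rpow_pos_of_pos two_pos _) hρ0) (Real.rpow_pos_of_pos hρ' _)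

theorem mul_log_rCrit (hρ0 : 0 < ρ) (hρ1 : ρ < 1) : ρ * Real.log (rCrit ρ) = critLogMod ρ := by
  have hρ' : 0 < 1 - ρ := sub_pos.2 hρ1
  have h2 : (0 : ℝ) < 2 ^ (1 / ρ) := Real.rpow_pos_of_pos two_pos _
  rw [rCrit, Real.log_mul (mul_pos h2 hρ0).ne' (Real.rpow_pos_of_pos hρ' _).ne',
    Real.log_mul h2.ne' hρ0.ne', Real.log_rpow two_pos, Real.log_rpow hρ', critLogMod]
  field_simp

theorem critLogMod_lt_mul_log (hρ0 : 0 < ρ) (hρ1 : ρ < 1) (hr : rCrit ρ < r) :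
    critLogMod ρ < ρ * Real.log r := by
  rw [← mul_log_rCrit hρ0 hρ1]
  exact mul_lt_mul_of_pos_left (Real.log_lt_log (rCrit_pos hρ0 hρ1) hr) hρ0

end CriticalRadius

section UStar

variable {ρ r x : ℝ} {u w : ℂ}

/-- The upper end of the vertical segment `Re ζ = x`, `|Im ζ| < ρ π` of the logarithmic
coordinate; for `x = ρ log r` it is the image of `u_*(r)`. -/
noncomputable def levelPoint (ρ x : ℝ) : ℂ := x + (ρ * π : ℝ) * I

@[simp]
theorem levelPoint_re (ρ x : ℝ) : (levelPoint ρ x).re = x := by simp [levelPoint]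

@[simp]
theorem levelPoint_im (ρ x : ℝ) : (levelPoint ρ x).im = ρ * π := by simp [levelPoint]

theorem levelPoint_im_pos (hρ0 : 0 < ρ) (x : ℝ) : 0 < (levelPoint ρ x).im := by
  rw [levelPoint_im]
  exact mul_pos hρ0 Real.pi_pos

theorem continuous_levelPoint (ρ : ℝ) : Continuous (levelPoint ρ) := by
  unfold levelPoint
  fun_prop

theorem levelPoint_mem (hρ0 : 0 < ρ) (hρ1 : ρ < 1) (hx : critLogMod ρ < x) :
    levelPoint ρ x ∈ logCoordImage ρ := by
  refine notchedStrip_subset_logCoordImage hρ0 hρ1 (Or.inr ⟨by rwa [levelPoint_re], ?_⟩)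
  rw [abs_of_pos (levelPoint_im_pos hρ0 x), levelPoint_im]
  exact mul_lt_of_lt_one_left Real.pi_pos hρ1

theorem logCoordInv_levelPoint_im_pos (hρ0 : 0 < ρ) (hρ1 : ρ < 1) (hx : critLogMod ρ < x) :
    0 < (logCoordInv ρ (levelPoint ρ x)).im :=
  logCoordInv_im_pos hρ0 hρ1 (levelPoint_mem hρ0 hρ1 hx) (levelPoint_im_pos hρ0 x)

theorem arg_one_sub_of_im_pos (hu : 0 < u.im) : (1 - u).arg = (u - 1).arg - π := by
  rw [← neg_sub, Complex.arg_neg_eq_arg_sub_pi_of_im_pos (by simpa using hu)]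

theorem log_one_sub_of_im_pos (hu : 0 < u.im) :
    Complex.log (1 - u) = Complex.log (u - 1) - π * I := by
  rw [Complex.log, Complex.log, arg_one_sub_of_im_pos hu, norm_sub_rev]
  push_cast
  ring

theorem cpow_mul_cpow_of_im_pos (ρ : ℝ) (hu : 0 < u.im) :
    (1 - u) ^ (ρ : ℂ) * (1 + u) ^ ((1 - ρ : ℝ) : ℂ)
      = Complex.exp (logCoord ρ u - (ρ * π : ℝ) * I) := by
  obtain ⟨hu1, hu2⟩ := ne_of_mem_cutPlane (mem_cutPlane_of_im_pos hu)
  rw [Complex.cpow_def_of_ne_zero (sub_ne_zero.2 hu1.symm),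
    Complex.cpow_def_of_ne_zero fun h => hu2 (eq_neg_of_add_eq_zero_right h), ← Complex.exp_add,
    log_one_sub_of_im_pos hu, logCoord, add_comm 1 u]
  congr 1
  push_cast
  ring

theorem mul_arg_add_mul_arg_of_im_pos (ρ : ℝ) (hu : 0 < u.im) :
    ρ * (1 - u).arg + (1 - ρ) * (1 + u).arg = (logCoord ρ u).im - ρ * π := by
  rw [arg_one_sub_of_im_pos hu, logCoord_im, add_comm 1 u]
  ring

theorem isUStar_iff (hr : 0 < r) :
    IsUStar ρ r u ↔ 0 < u.im ∧ logCoord ρ u = levelPoint ρ (ρ * Real.log r) := by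
  rw [IsUStar, ← and_assoc, and_comm]
  refine and_congr_right fun hu => ?_
  rw [cpow_mul_cpow_of_im_pos ρ hu, mul_arg_add_mul_arg_of_im_pos ρ hu, sub_eq_zero]
  constructor
  · rintro ⟨hexp, him⟩
    have hnorm := congrArg norm hexp
    rw [Complex.norm_exp, Complex.norm_of_nonneg (Real.rpow_pos_of_pos hr ρ).le,
      Real.rpow_def_of_pos hr, Real.exp_eq_exp, Complex.sub_re, Complex.re_ofReal_mul,
      Complex.I_re, mul_zero, sub_zero, mul_comm] at hnorm
    exact Complex.ext (by rw [hnorm, levelPoint_re]) (by rw [him, levelPoint_im])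
  · intro h
    rw [h, levelPoint, add_sub_cancel_right, ← Complex.ofReal_exp, Real.rpow_def_of_pos hr,
      mul_comm ρ]
    exact ⟨rfl, by simp⟩

theorem isUStar_iff_eq (hρ0 : 0 < ρ) (hρ1 : ρ < 1) (hr : rCrit ρ < r) :
    IsUStar ρ r u ↔ u = logCoordInv ρ (levelPoint ρ (ρ * Real.log r)) := by
  have hx := critLogMod_lt_mul_log hρ0 hρ1 hr
  rw [isUStar_iff ((rCrit_pos hρ0 hρ1).trans hr)]
  constructor
  · rintro ⟨hu, h⟩
    rw [← h, logCoordInv_logCoord hρ0 hρ1 (mem_cutPlane_of_im_pos hu)]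
  · rintro rfl
    exact ⟨logCoordInv_levelPoint_im_pos hρ0 hρ1 hx,
      logCoord_logCoordInv (levelPoint_mem hρ0 hρ1 hx)⟩

theorem existsUnique_isUStar (hρ0 : 0 < ρ) (hρ1 : ρ < 1) (hr : rCrit ρ < r) :
    ∃! u, IsUStar ρ r u := by
  simp only [isUStar_iff_eq hρ0 hρ1 hr, existsUnique_eq]

theorem uStar_eq (hρ0 : 0 < ρ) (hρ1 : ρ < 1) (hr : rCrit ρ < r) :
    uStar ρ r = logCoordInv ρ (levelPoint ρ (ρ * Real.log r)) := by
  rw [← isUStar_iff_eq hρ0 hρ1 hr]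
  exact Classical.epsilon_spec (existsUnique_isUStar hρ0 hρ1 hr).exists

theorem logHalfPrim_im (ρ : ℝ) (w : ℂ) :
    (logHalfPrim ρ w).im = (1 - ρ) * (Real.log ‖w + 1‖ * (w + 1).arg
      - Real.log 2 * (w + 1).arg) - ρ * (dilog (1 / 2 - w / 2)).im := by
  have hcast : (1 - ρ : ℂ) = ((1 - ρ : ℝ) : ℂ) := by push_cast; rfl
  have hsq : (Complex.log (w + 1) ^ 2 / 2).im = Real.log ‖w + 1‖ * (w + 1).arg := by
    rw [Complex.div_ofNat_im, sq, Complex.mul_im, Complex.log_re, Complex.log_im]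
    ring
  rw [logHalfPrim, hcast, Complex.sub_im, Complex.im_ofReal_mul, Complex.im_ofReal_mul,
    Complex.sub_im, Complex.im_ofReal_mul, hsq, Complex.log_im]

theorem GInf_eq (hρ0 : 0 < ρ) (hw : 0 < w.im) (h : (logCoord ρ w).im = ρ * π) :
    GInf ρ w = (logHalfPrim ρ w).im / (ρ * π) := by
  have hπ := Real.pi_pos
  rw [logCoord_im] at h
  rw [GInf, logHalfPrim_im, arg_one_sub_of_im_pos hw, add_comm 1 w,
    eq_div_iff (mul_pos hρ0 hπ).ne']
  field_simp
  linear_combination Real.log 2 * h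

/-- The limiting consistency function `G_∞(u_*(r))` in terms of `x = ρ log r`. -/
noncomputable def consistency (ρ x : ℝ) : ℝ :=
  (logHalfPrim ρ (logCoordInv ρ (levelPoint ρ x))).im / (ρ * π)

theorem GInf_uStar (hρ0 : 0 < ρ) (hρ1 : ρ < 1) (hr : rCrit ρ < r) :
    GInf ρ (uStar ρ r) = consistency ρ (ρ * Real.log r) := by
  have hx := critLogMod_lt_mul_log hρ0 hρ1 hr
  rw [uStar_eq hρ0 hρ1 hr, consistency, GInf_eq hρ0 (logCoordInv_levelPoint_im_pos hρ0 hρ1 hx)]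
  rw [logCoord_logCoordInv (levelPoint_mem hρ0 hρ1 hx), levelPoint_im]

theorem hasDerivAt_consistency (hρ0 : 0 < ρ) (hρ1 : ρ < 1) (hx : critLogMod ρ < x) :
    HasDerivAt (consistency ρ) ((logCoordInv ρ (levelPoint ρ x) + 1).arg / (ρ * π)) x := by
  have hline : HasDerivAt (fun z : ℂ => z + (ρ * π : ℝ) * I) 1 (x : ℂ) :=
    (hasDerivAt_id (x : ℂ)).add_const _
  have hprim := ((hasDerivAt_logHalfPrim_logCoordInv hρ0 hρ1
    (levelPoint_mem hρ0 hρ1 hx)).comp (x : ℂ) hline).comp_ofReal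
  have him := (Complex.imCLM.hasFDerivAt.comp_hasDerivAt x hprim).div_const (ρ * π)
  rw [mul_one] at him
  rw [← logHalf_im]
  exact him

theorem strictMonoOn_consistency (hρ0 : 0 < ρ) (hρ1 : ρ < 1) :
    StrictMonoOn (consistency ρ) (Ioi (critLogMod ρ)) := by
  refine strictMonoOn_of_deriv_pos (convex_Ioi _)
    (fun x hx => (hasDerivAt_consistency hρ0 hρ1 hx).continuousAt.continuousWithinAt) ?_
  intro x hx
  rw [interior_Ioi] at hx
  rw [(hasDerivAt_consistency hρ0 hρ1 hx).deriv]
  refine div_pos (arg_pos_of_im_pos ?_) (mul_pos hρ0 Real.pi_pos)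
  simpa using logCoordInv_levelPoint_im_pos hρ0 hρ1 hx

end UStar

section Boundary

variable {ρ x : ℝ} {v : ℂ}

theorem im_eq_zero_of_absArg_eq (hρ0 : 0 < ρ) (hρ1 : ρ < 1) (hv : 0 ≤ v.im)
    (hψ : absArg ρ v = ρ * π) (hx : logMod ρ v ≤ critLogMod ρ) : v.im = 0 := by
  refine (hv.eq_or_lt.resolve_right fun him => hx.not_gt ?_).symm
  exact critLogMod_lt_of_logCoord_im_eq hρ0 hρ1 him (by rwa [← absArg_eq_of_im_nonneg hv])

theorem logHalfPrim_im_eq_zero (hρ1 : ρ < 1) (hv : v ≠ -1) (him : v.im = 0)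
    (hψ : absArg ρ v = ρ * π) : v + 1 ∈ slitPlane ∧ (logHalfPrim ρ v).im = 0 := by
  have hre : -1 < v.re := by
    refine lt_of_le_of_ne (le_of_not_gt fun hlt => ?_) fun h =>
      hv (Complex.ext (by simpa using h.symm) (by simpa using him))
    rw [absArg_of_re_lt_neg_one him hlt] at hψ
    exact (mul_lt_of_lt_one_left Real.pi_pos hρ1).ne' hψ
  have hslit : v + 1 ∈ slitPlane := by
    rw [Complex.mem_slitPlane_iff, Complex.add_re, Complex.one_re]
    exact Or.inl (by linarith)
  refine ⟨hslit, Complex.conj_eq_iff_im.1 ?_⟩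
  rw [← logHalfPrim_conj ρ hslit, Complex.conj_eq_iff_im.2 him]

theorem tendsto_logHalfPrim_im (hρ0 : 0 < ρ) (hρ1 : ρ < 1) (hx : x ≤ critLogMod ρ) :
    Tendsto (fun ζ => (logHalfPrim ρ (logCoordInv ρ ζ)).im)
      (𝓝[logCoordImage ρ] levelPoint ρ x) (𝓝 0) := by
  rw [tendsto_iff_ultrafilter]
  intro U hU
  have hmem : ∀ᶠ ζ in U, ζ ∈ logCoordImage ρ := hU self_mem_nhdsWithin
  have hid : Tendsto (fun ζ => logCoord ρ (logCoordInv ρ ζ)) U (𝓝 (levelPoint ρ x)) :=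
    (tendsto_id'.2 (le_trans hU nhdsWithin_le_nhds)).congr'
      (hmem.mono fun ζ hζ => (logCoord_logCoordInv hζ).symm)
  have him := (Complex.continuous_im.tendsto _).comp hid
  have hlogMod : Tendsto (fun ζ => logMod ρ (logCoordInv ρ ζ)) U (𝓝 x) := by
    simpa only [Function.comp_def, logCoord_re, levelPoint_re] using
      (Complex.continuous_re.tendsto _).comp hid
  have habsArg : Tendsto (fun ζ => absArg ρ (logCoordInv ρ ζ)) U (𝓝 (ρ * π)) := by
    have habs := him.abs
    rw [abs_of_pos (levelPoint_im_pos hρ0 x), levelPoint_im] at habs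
    simpa only [Function.comp_def, ← absArg_eq_abs_logCoord_im hρ0 hρ1] using habs
  obtain ⟨v, -, hv, hvx, hvψ, hlim⟩ := exists_tendsto_of_tendsto_logMod hρ0 hρ1
    (hmem.mono fun ζ hζ => ne_of_mem_cutPlane (logCoordInv_mem hζ)) hlogMod habsArg
  have hv0 : 0 ≤ v.im := by
    refine ge_of_tendsto ((Complex.continuous_im.tendsto _).comp hlim) ?_
    filter_upwards [hmem, him.eventually (lt_mem_nhds (levelPoint_im_pos hρ0 x))] with ζ hζ hpos
    rw [Function.comp_apply, logCoord_logCoordInv hζ] at hpos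
    exact (logCoordInv_im_pos hρ0 hρ1 hζ hpos).le
  obtain ⟨hslit, hzero⟩ := logHalfPrim_im_eq_zero hρ1 hv
    (im_eq_zero_of_absArg_eq hρ0 hρ1 hv0 hvψ (hvx.trans_le hx)) hvψ
  rw [← hzero]
  exact (Complex.continuous_im.tendsto _).comp
    ((differentiableAt_logHalfPrim ρ hslit).continuousAt.tendsto.comp hlim)

theorem tendsto_consistency_critLogMod (hρ0 : 0 < ρ) (hρ1 : ρ < 1) :
    Tendsto (consistency ρ) (𝓝[>] critLogMod ρ) (𝓝 0) := by
  have hlevel : Tendsto (levelPoint ρ) (𝓝[>] critLogMod ρ)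
      (𝓝[logCoordImage ρ] levelPoint ρ (critLogMod ρ)) := by
    refine tendsto_nhdsWithin_iff.2
      ⟨((continuous_levelPoint ρ).tendsto _).mono_left nhdsWithin_le_nhds, ?_⟩
    filter_upwards [self_mem_nhdsWithin] with x hx using levelPoint_mem hρ0 hρ1 hx
  rw [← zero_div (ρ * π)]
  exact ((tendsto_logHalfPrim_im hρ0 hρ1 le_rfl).comp hlevel).div_const (ρ * π)

end Boundary

section Arc

variable {ρ x y : ℝ} {ζ : ℂ}

theorem exists_abs_logHalf_re_le (hρ0 : 0 < ρ) (hρ1 : ρ < 1) (a b : ℝ) :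
    ∃ M, ∀ w ∈ levelBand ρ a b, |(logHalf w).re| ≤ M := by
  have hcont : ContinuousOn (fun w => (logHalf w).re) (levelBand ρ a b) := fun w hw => by
    simp only [logHalf_re]
    have hlog : ContinuousAt (fun w : ℂ => Real.log ‖w + 1‖) w :=
      ContinuousAt.log (by fun_prop) (norm_add_one_pos hw.2.1).ne'
    exact (hlog.sub continuousAt_const).continuousWithinAt
  exact (isCompact_levelBand hρ0 hρ1 a b).exists_bound_of_continuousOn hcont

theorem logCoordInv_mem_levelBand (h : ζ ∈ logCoordImage ρ) {a b : ℝ} (hζ : ζ.re ∈ Icc a b) :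
    logCoordInv ρ ζ ∈ levelBand ρ a b := by
  obtain ⟨h1, h2⟩ := ne_of_mem_cutPlane (logCoordInv_mem h)
  exact ⟨h1, h2, by rwa [← logCoord_re, logCoord_logCoordInv h]⟩

/-- The vertical segment `Re ζ = x`, `|Im ζ| < ρ π` of the logarithmic coordinate, parametrized
by `y ∈ (0, 1)`; it corresponds to the arc of the level curve `logMod ρ = x` filled by the Bethe
roots. -/
noncomputable def arcPoint (ρ x y : ℝ) : ℂ := x + (ρ * π * (2 * y - 1) : ℝ) * I

@[simp]
theorem arcPoint_re (ρ x y : ℝ) : (arcPoint ρ x y).re = x := by simp [arcPoint]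

@[simp]
theorem arcPoint_im (ρ x y : ℝ) : (arcPoint ρ x y).im = ρ * π * (2 * y - 1) := by
  simp [arcPoint]

theorem arcPoint_one (ρ x : ℝ) : arcPoint ρ x 1 = levelPoint ρ x := by
  rw [arcPoint, levelPoint]
  norm_num

theorem arcPoint_one_sub (ρ x y : ℝ) : arcPoint ρ x (1 - y) = conj (arcPoint ρ x y) := by
  refine Complex.ext (by simp) ?_
  rw [Complex.conj_im, arcPoint_im, arcPoint_im]
  ring

theorem continuous_arcPoint (ρ x : ℝ) : Continuous (arcPoint ρ x) := by
  unfold arcPoint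
  fun_prop

theorem hasDerivAt_arcPoint (ρ x y : ℝ) :
    HasDerivAt (arcPoint ρ x) ((2 * (ρ * π) : ℝ) * I) y := by
  have him : HasDerivAt (fun y : ℝ => ρ * π * (2 * y - 1)) (2 * (ρ * π)) y := by
    convert! (((hasDerivAt_id y).const_mul 2).sub_const 1).const_mul (ρ * π) using 1
    ring
  exact (him.ofReal_comp.mul_const I).const_add (x : ℂ)

theorem abs_arcPoint_im_lt (hρ0 : 0 < ρ) (x : ℝ) (hy : y ∈ Ioo (0 : ℝ) 1) :
    |(arcPoint ρ x y).im| < ρ * π := by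
  have hπ := mul_pos hρ0 Real.pi_pos
  rw [arcPoint_im, abs_mul, abs_of_pos hπ]
  refine mul_lt_of_lt_one_right hπ ?_
  rw [abs_lt]
  constructor <;> linarith [hy.1, hy.2]

theorem arcPoint_mem (hρ0 : 0 < ρ) (hρ1 : ρ < 1) (x : ℝ) (hy : y ∈ Ioo (0 : ℝ) 1) :
    arcPoint ρ x y ∈ logCoordImage ρ :=
  notchedStrip_subset_logCoordImage hρ0 hρ1 (Or.inl (abs_arcPoint_im_lt hρ0 x hy))

theorem continuousAt_logHalf_logCoordInv (hρ0 : 0 < ρ) (hρ1 : ρ < 1) (h : ζ ∈ logCoordImage ρ) :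
    ContinuousAt (fun ζ => logHalf (logCoordInv ρ ζ)) ζ :=
  (hasDerivAt_logHalf (logCoordInv_mem h)).continuousAt.comp
    (hasDerivAt_logCoordInv hρ0 hρ1 h).continuousAt

theorem intervalIntegrable_logHalf_arcPoint (hρ0 : 0 < ρ) (hρ1 : ρ < 1) (x : ℝ) :
    IntervalIntegrable (fun y => (logHalf (logCoordInv ρ (arcPoint ρ x y))).re)
      MeasureTheory.volume 0 1 := by
  obtain ⟨M, hM⟩ := exists_abs_logHalf_re_le hρ0 hρ1 x x
  rw [intervalIntegrable_iff_integrableOn_Ioo_of_le zero_le_one]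
  refine MeasureTheory.IntegrableOn.of_bound (by simp) ?_ M
    (MeasureTheory.ae_restrict_of_forall_mem measurableSet_Ioo fun y hy => ?_)
  · refine ContinuousOn.aestronglyMeasurable (fun y hy => ?_) measurableSet_Ioo
    have hre : ContinuousAt (fun ζ => (logHalf (logCoordInv ρ ζ)).re) (arcPoint ρ x y) :=
      Complex.continuous_re.continuousAt.comp
        (continuousAt_logHalf_logCoordInv hρ0 hρ1 (arcPoint_mem hρ0 hρ1 x hy))
    exact (hre.comp (continuous_arcPoint ρ x).continuousAt).continuousWithinAt
  · exact hM _ (logCoordInv_mem_levelBand (arcPoint_mem hρ0 hρ1 x hy) (by simp))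

theorem hasDerivAt_logHalfPrim_arcPoint (hρ0 : 0 < ρ) (hρ1 : ρ < 1) (x : ℝ)
    (hy : y ∈ Ioo (0 : ℝ) 1) :
    HasDerivAt (fun y => (logHalfPrim ρ (logCoordInv ρ (arcPoint ρ x y))).im)
      (2 * (ρ * π) * (logHalf (logCoordInv ρ (arcPoint ρ x y))).re) y := by
  have hprim := (hasDerivAt_logHalfPrim_logCoordInv hρ0 hρ1
    (arcPoint_mem hρ0 hρ1 x hy)).comp y (hasDerivAt_arcPoint ρ x y)
  have him := Complex.imCLM.hasFDerivAt.comp_hasDerivAt y hprim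
  rw [Complex.imCLM_apply, mul_left_comm, Complex.im_ofReal_mul, Complex.mul_I_im] at him
  exact him

theorem logHalfPrim_arcPoint_one_sub_im (hρ0 : 0 < ρ) (hρ1 : ρ < 1) (x : ℝ)
    (hy : y ∈ Ioo (0 : ℝ) 1) :
    (logHalfPrim ρ (logCoordInv ρ (arcPoint ρ x (1 - y)))).im
      = -(logHalfPrim ρ (logCoordInv ρ (arcPoint ρ x y))).im := by
  have hm := arcPoint_mem hρ0 hρ1 x hy
  rw [arcPoint_one_sub, logCoordInv_conj hρ0 hρ1 hm,
    logHalfPrim_conj ρ (add_one_mem_slitPlane (logCoordInv_mem hm)), Complex.conj_im]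

theorem integral_logHalf_arcPoint (hρ0 : 0 < ρ) (hρ1 : ρ < 1) {c : ℝ}
    (h : Tendsto (fun y => (logHalfPrim ρ (logCoordInv ρ (arcPoint ρ x y))).im) (𝓝[<] 1) (𝓝 c)) :
    ∫ y in (0 : ℝ)..1, (logHalf (logCoordInv ρ (arcPoint ρ x y))).re = c / (ρ * π) := by
  have hreflect : Tendsto (fun y : ℝ => 1 - y) (𝓝[>] 0) (𝓝[<] 1) := by
    refine tendsto_nhdsWithin_iff.2
      ⟨?_, eventually_mem_nhdsWithin.mono fun y hy => sub_lt_self (1 : ℝ) hy⟩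
    simpa using ((continuous_sub_left (1 : ℝ)).tendsto 0).mono_left nhdsWithin_le_nhds
  have hzero : Tendsto (fun y => (logHalfPrim ρ (logCoordInv ρ (arcPoint ρ x y))).im)
      (𝓝[>] 0) (𝓝 (-c)) := by
    refine (h.comp hreflect).neg.congr' ?_
    filter_upwards [Ioo_mem_nhdsGT zero_lt_one] with y hy
    rw [Function.comp_apply, logHalfPrim_arcPoint_one_sub_im hρ0 hρ1 x hy, neg_neg]
  have hFTC := intervalIntegral.integral_eq_sub_of_hasDerivAt_of_tendsto zero_lt_one
    (fun y hy => hasDerivAt_logHalfPrim_arcPoint hρ0 hρ1 x hy)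
    ((intervalIntegrable_logHalf_arcPoint hρ0 hρ1 x).const_mul _) hzero h
  rw [intervalIntegral.integral_const_mul] at hFTC
  rw [eq_div_iff (mul_pos hρ0 Real.pi_pos).ne']
  linarith

theorem integral_logHalf_arcPoint_of_le (hρ0 : 0 < ρ) (hρ1 : ρ < 1) (hx : x ≤ critLogMod ρ) :
    ∫ y in (0 : ℝ)..1, (logHalf (logCoordInv ρ (arcPoint ρ x y))).re = 0 := by
  refine (integral_logHalf_arcPoint hρ0 hρ1 ((tendsto_logHalfPrim_im hρ0 hρ1 hx).comp
    (tendsto_nhdsWithin_iff.2 ⟨?_, ?_⟩))).trans (zero_div _)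
  · rw [← arcPoint_one]
    exact ((continuous_arcPoint ρ x).tendsto 1).mono_left nhdsWithin_le_nhds
  · filter_upwards [Ioo_mem_nhdsLT zero_lt_one] with y hy using arcPoint_mem hρ0 hρ1 x hy

theorem integral_logHalf_arcPoint_of_gt (hρ0 : 0 < ρ) (hρ1 : ρ < 1) (hx : critLogMod ρ < x) :
    ∫ y in (0 : ℝ)..1, (logHalf (logCoordInv ρ (arcPoint ρ x y))).re = consistency ρ x := by
  refine integral_logHalf_arcPoint hρ0 hρ1 ?_
  have hprim : ContinuousAt (fun ζ => (logHalfPrim ρ (logCoordInv ρ ζ)).im) (levelPoint ρ x) :=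
    Complex.continuous_im.continuousAt.comp (hasDerivAt_logHalfPrim_logCoordInv hρ0 hρ1
      (levelPoint_mem hρ0 hρ1 hx)).continuousAt
  refine hprim.tendsto.comp ?_
  rw [← arcPoint_one]
  exact ((continuous_arcPoint ρ x).tendsto 1).mono_left nhdsWithin_le_nhds

end Arc

section RStar

variable {ρ γ r x : ℝ}

theorem le_consistency (hρ0 : 0 < ρ) (hρ1 : ρ < 1) (hx : critLogMod ρ < x)
    (hx2 : 2 < Real.exp x) : Real.log (Real.exp x - 2) - Real.log 2 ≤ consistency ρ x := by
  have hconst : ∫ _ in (0 : ℝ)..1, (Real.log (Real.exp x - 2) - Real.log 2)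
      = Real.log (Real.exp x - 2) - Real.log 2 := by simp
  rw [← integral_logHalf_arcPoint_of_gt hρ0 hρ1 hx, ← hconst]
  refine intervalIntegral.integral_mono_on_of_le_Ioo zero_le_one intervalIntegrable_const
    (intervalIntegrable_logHalf_arcPoint hρ0 hρ1 x) fun y hy => ?_
  have hm := arcPoint_mem hρ0 hρ1 x hy
  obtain ⟨h1, h2⟩ := ne_of_mem_cutPlane (logCoordInv_mem hm)
  have hle := exp_logMod_le hρ0 hρ1 h1 h2
  rw [← logCoord_re, logCoord_logCoordInv hm, arcPoint_re] at hle
  rw [logHalf_re]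
  exact sub_le_sub_right (Real.log_le_log (sub_pos.2 hx2) (sub_le_iff_le_add.2 hle)) _

theorem tendsto_consistency_atTop (hρ0 : 0 < ρ) (hρ1 : ρ < 1) :
    Tendsto (consistency ρ) atTop atTop := by
  have hlog : Tendsto (fun x => Real.log (Real.exp x - 2) - Real.log 2) atTop atTop :=
    tendsto_atTop_add_const_right _ _ (Real.tendsto_log_atTop.comp
      (tendsto_atTop_add_const_right _ _ Real.tendsto_exp_atTop))
  refine tendsto_atTop_mono' _ ?_ hlog
  filter_upwards [eventually_gt_atTop (critLogMod ρ),
    Real.tendsto_exp_atTop.eventually (eventually_gt_atTop 2)] with x hx hx2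
    using le_consistency hρ0 hρ1 hx hx2

theorem consistency_pos (hρ0 : 0 < ρ) (hρ1 : ρ < 1) (hx : critLogMod ρ < x) :
    0 < consistency ρ x := by
  obtain ⟨m, hm, hmx⟩ := exists_between hx
  have hmono := strictMonoOn_consistency hρ0 hρ1
  refine (le_of_tendsto (tendsto_consistency_critLogMod hρ0 hρ1) ?_).trans_lt (hmono hm hx hmx)
  filter_upwards [Ioo_mem_nhdsGT hm] with y hy using (hmono hy.1 hm hy.2).le

theorem exists_consistency_eq (hρ0 : 0 < ρ) (hρ1 : ρ < 1) (hγ : 0 < γ) :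
    ∃ x, critLogMod ρ < x ∧ consistency ρ x = γ := by
  obtain ⟨a, haγ, ha⟩ := (((tendsto_consistency_critLogMod hρ0 hρ1).eventually
    (gt_mem_nhds hγ)).and self_mem_nhdsWithin).exists
  obtain ⟨b, hbγ, hab⟩ := (((tendsto_consistency_atTop hρ0 hρ1).eventually
    (eventually_ge_atTop γ)).and (eventually_ge_atTop a)).exists
  have ha : critLogMod ρ < a := ha
  obtain ⟨x, hx, hxγ⟩ := intermediate_value_Icc hab (fun x hx =>
    (hasDerivAt_consistency hρ0 hρ1 (ha.trans_le hx.1)).continuousAt.continuousWithinAt)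
    ⟨haγ.le, hbγ⟩
  exact ⟨x, ha.trans_le hx.1, hxγ⟩

theorem isRStar_iff (hρ0 : 0 < ρ) (hρ1 : ρ < 1) :
    IsRStar ρ γ r ↔ rCrit ρ < r ∧ consistency ρ (ρ * Real.log r) = γ :=
  and_congr_right fun hr => by rw [GInf_uStar hρ0 hρ1 hr, eq_comm]

theorem existsUnique_isRStar (hρ0 : 0 < ρ) (hρ1 : ρ < 1) (hγ : 0 < γ) :
    ∃! r, IsRStar ρ γ r := by
  simp only [isRStar_iff hρ0 hρ1]
  obtain ⟨x, hx, hxγ⟩ := exists_consistency_eq hρ0 hρ1 hγ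
  refine ⟨Real.exp (x / ρ), ⟨?_, ?_⟩, ?_⟩
  · rwa [← Real.log_lt_iff_lt_exp (rCrit_pos hρ0 hρ1), lt_div_iff₀' hρ0,
      mul_log_rCrit hρ0 hρ1]
  · rw [Real.log_exp, mul_div_cancel₀ _ hρ0.ne', hxγ]
  · rintro r ⟨hr, hrγ⟩
    rw [← (strictMonoOn_consistency hρ0 hρ1).injOn (critLogMod_lt_mul_log hρ0 hρ1 hr) hx
      (hrγ.trans hxγ.symm), mul_div_cancel_left₀ _ hρ0.ne',
      Real.exp_log ((rCrit_pos hρ0 hρ1).trans hr)]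

theorem rStar_spec (hρ0 : 0 < ρ) (hρ1 : ρ < 1) (hγ : 0 < γ) :
    rCrit ρ < rStar ρ γ ∧ consistency ρ (ρ * Real.log (rStar ρ γ)) = γ :=
  (isRStar_iff hρ0 hρ1).1 (Classical.epsilon_spec (existsUnique_isRStar hρ0 hρ1 hγ).exists)

theorem rStar_lt_iff (hρ0 : 0 < ρ) (hρ1 : ρ < 1) (hγ : 0 < γ) (hr : rCrit ρ < r) :
    rStar ρ γ < r ↔ γ < consistency ρ (ρ * Real.log r) := by
  obtain ⟨hlt, heq⟩ := rStar_spec hρ0 hρ1 hγ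
  have hpos := rCrit_pos hρ0 hρ1
  conv_rhs => lhs; rw [← heq]
  rw [(strictMonoOn_consistency hρ0 hρ1).lt_iff_lt (critLogMod_lt_mul_log hρ0 hρ1 hlt)
    (critLogMod_lt_mul_log hρ0 hρ1 hr), mul_lt_mul_iff_right₀ hρ0,
    Real.log_lt_log_iff (hpos.trans hlt) (hpos.trans hr)]

theorem strictMonoOn_rStar (hρ0 : 0 < ρ) (hρ1 : ρ < 1) : StrictMonoOn (rStar ρ) (Ioi 0) := by
  intro γ₁ h₁ γ₂ h₂ hlt
  obtain ⟨hr, heq⟩ := rStar_spec hρ0 hρ1 h₂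
  rwa [rStar_lt_iff hρ0 hρ1 h₁ hr, heq]

theorem tendsto_rStar (hρ0 : 0 < ρ) (hρ1 : ρ < 1) :
    Tendsto (rStar ρ) (𝓝[>] 0) (𝓝 (rCrit ρ)) := by
  refine tendsto_order.2 ⟨fun a ha => ?_, fun a ha => ?_⟩
  · filter_upwards [self_mem_nhdsWithin] with γ hγ using ha.trans (rStar_spec hρ0 hρ1 hγ).1
  · filter_upwards [self_mem_nhdsWithin, nhdsWithin_le_nhds (gt_mem_nhds
      (consistency_pos hρ0 hρ1 (critLogMod_lt_mul_log hρ0 hρ1 ha)))] with γ hγ hlt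
      using (rStar_lt_iff hρ0 hρ1 hγ ha).2 hlt

end RStar

/-! ### Bethe roots in the logarithmic coordinate -/

section BetheRoots

variable {ρ x ψ : ℝ} {u : ℂ}

/-- `u` has logarithmic coordinate `x + i ψ`, where on the cut `[-1, 1]`, which carries the limits
of the logarithmic coordinate from both sides, both signs of `ψ` are admitted. -/
structure RootAt (ρ x ψ : ℝ) (u : ℂ) : Prop where
  ne_one : u ≠ 1
  ne_neg_one : u ≠ -1
  logMod_eq : logMod ρ u = x
  absArg_eq : absArg ρ u = |ψ|
  sign_nonneg : 0 ≤ ψ * u.im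

theorem abs_arg_conj (z : ℂ) : |(conj z).arg| = |z.arg| := by
  rw [Complex.arg_conj]
  split_ifs with h
  · rw [h]
  · rw [abs_neg]

theorem RootAt.conj (h : RootAt ρ x ψ u) : RootAt ρ x (-ψ) (conj u) := by
  have hsub : conj u - 1 = conj (u - 1) := by simp
  have hadd : conj u + 1 = conj (u + 1) := by simp
  refine ⟨fun h' => h.ne_one ?_, fun h' => h.ne_neg_one ?_, ?_, ?_, ?_⟩
  · simpa using congrArg conj h'
  · simpa using congrArg conj h'
  · rw [← h.logMod_eq, logMod, hsub, hadd, Complex.norm_conj, Complex.norm_conj, logMod]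
  · rw [abs_neg, ← h.absArg_eq, absArg, hsub, hadd, abs_arg_conj, abs_arg_conj, absArg]
  · simpa using h.sign_nonneg

theorem logCoord_im_mul_im_nonneg (hρ0 : 0 < ρ) (hρ1 : ρ < 1) (w : ℂ) :
    0 ≤ (logCoord ρ w).im * w.im := by
  rcases le_or_gt 0 w.im with h | h
  · refine mul_nonneg ?_ h
    rw [← absArg_eq_of_im_nonneg h, absArg_eq_abs_logCoord_im hρ0 hρ1]
    exact abs_nonneg _
  · exact (mul_pos_of_neg_of_neg (logCoord_im_neg hρ0 hρ1 h) h).le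

theorem rootAt_logCoord (hρ0 : 0 < ρ) (hρ1 : ρ < 1) (hu : u ≠ 1) (hu' : u ≠ -1) :
    RootAt ρ (logCoord ρ u).re (logCoord ρ u).im u :=
  ⟨hu, hu', (logCoord_re ρ u).symm, absArg_eq_abs_logCoord_im hρ0 hρ1 u,
    logCoord_im_mul_im_nonneg hρ0 hρ1 u⟩

theorem eq_of_abs_eq_of_mul_nonneg {a b c : ℝ} (habs : |a| = |b|) (hb : 0 ≤ b * c)
    (hac : SignType.sign a = SignType.sign c) : a = b := by
  rcases lt_trichotomy c 0 with hc | rfl | hc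
  · have ha : a < 0 := sign_eq_neg_one_iff.1 (hac.trans (sign_neg hc))
    rwa [abs_of_neg ha, abs_of_nonpos (nonpos_of_mul_nonneg_left hb hc), neg_inj] at habs
  · have ha : a = 0 := sign_eq_zero_iff.1 (hac.trans sign_zero)
    rw [ha, abs_zero] at habs
    rw [ha, abs_eq_zero.1 habs.symm]
  · have ha : 0 < a := sign_eq_one_iff.1 (hac.trans (sign_pos hc))
    rwa [abs_of_pos ha, abs_of_nonneg (nonneg_of_mul_nonneg_left hb hc)] at habs

theorem RootAt.eq_logCoordInv (hρ0 : 0 < ρ) (hρ1 : ρ < 1) (h : RootAt ρ x ψ u)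
    (hmem : (x + ψ * I : ℂ) ∈ notchedStrip ρ) : u = logCoordInv ρ (x + ψ * I) := by
  have habs : |(logCoord ρ u).im| = |ψ| := by
    rw [← absArg_eq_abs_logCoord_im hρ0 hρ1, h.absArg_eq]
  have hu : u ∈ cutPlane := by
    refine mem_cutPlane_of_logCoord_mem hρ0 hρ1 h.ne_one h.ne_neg_one ?_
    simpa [notchedStrip, logCoord_re, habs, h.logMod_eq] using hmem
  have hcoord : logCoord ρ u = x + ψ * I := by
    apply Complex.ext
    · simp [logCoord_re, h.logMod_eq]
    · simpa using eq_of_abs_eq_of_mul_nonneg habs h.sign_nonneg (sign_logCoord_im hρ0 hρ1 hu)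
  rw [← hcoord, logCoordInv_logCoord hρ0 hρ1 hu]

theorem rootAt_of_tendsto {ι : Type*} {L : Filter ι} [L.NeBot] {v : ι → ℂ} {φ : ι → ℝ}
    (hu : u ≠ 1) (hu' : u ≠ -1) (hv : Tendsto v L (𝓝 u)) (hφ : Tendsto φ L (𝓝 ψ))
    (h : ∀ᶠ i in L, RootAt ρ x (φ i) (v i)) : RootAt ρ x ψ u := by
  refine ⟨hu, hu', ?_, ?_, ?_⟩
  · refine tendsto_nhds_unique ((continuousAt_logMod hu hu').tendsto.comp hv)
      (tendsto_const_nhds.congr' ?_)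
    filter_upwards [h] with i hi using hi.logMod_eq.symm
  · refine tendsto_nhds_unique ((continuousAt_absArg hu hu').tendsto.comp hv) (hφ.abs.congr' ?_)
    filter_upwards [h] with i hi using hi.absArg_eq.symm
  · refine ge_of_tendsto (hφ.mul ((Complex.continuous_im.tendsto _).comp hv)) ?_
    filter_upwards [h] with i hi using hi.sign_nonneg

end BetheRoots

section Labels

variable {ρ x s : ℝ} {N p j : ℕ} {C u : ℂ}

theorem exists_eq_exp_phase (hN : N ≠ 0) (hC : C ≠ 0) :
    ∃ s ∈ Ioc (0 : ℝ) 1,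
      C = Complex.exp (N * (Real.log ‖C‖ / N : ℝ) + 2 * π * s * I) := by
  refine ⟨toIocMod one_pos 0 (C.arg / (2 * π)), ?_, ?_⟩
  · simpa using toIocMod_mem_Ioc one_pos (0 : ℝ) (C.arg / (2 * π))
  have hN' : (N : ℂ) ≠ 0 := mod_cast hN
  have hπ : (π : ℂ) ≠ 0 := mod_cast Real.pi_ne_zero
  conv_lhs => rw [← Complex.exp_log hC]
  rw [Complex.exp_eq_exp_iff_exists_int]
  refine ⟨toIocDiv one_pos 0 (C.arg / (2 * π)), ?_⟩
  rw [toIocMod, Complex.log, zsmul_one]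
  push_cast
  field_simp
  ring

/-- The imaginary part of the logarithmic coordinate of a root of
`(1 - u) ^ p (1 + u) ^ (N - p) = C` at position `t`; a root with label `j` has position
`t = j - 1 + s`, where `2π s ∈ (0, 2π]` is the argument of `C`. -/
noncomputable def betheAngle (N p : ℕ) (t : ℝ) : ℝ := π / N * (2 * t - p)

theorem labelF_eq (hN : N ≠ 0) (hp : (p : ℝ) = ρ * N) (u : ℂ) :
    labelF N p u = N / π * (logCoord ρ u).im := by
  rw [labelF, logCoord_im, hp]; field_simp

theorem abs_logCoord_im_le_pi (hρ0 : 0 < ρ) (hρ1 : ρ < 1) (w : ℂ) :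
    |(logCoord ρ w).im| ≤ π := by
  rw [← absArg_eq_abs_logCoord_im hρ0 hρ1, absArg]
  nlinarith [Complex.abs_arg_le_pi (w - 1), Complex.abs_arg_le_pi (w + 1)]

theorem pow_mul_pow_eq_exp (hpN : p ≤ N) (hp : (p : ℝ) = ρ * N) (hu : u ≠ 1) (hu' : u ≠ -1) :
    (1 - u) ^ p * (1 + u) ^ (N - p) = Complex.exp (N * logCoord ρ u + π * p * I) := by
  have hpc : (p : ℂ) = ρ * N := mod_cast hp
  have hsub : (1 - u) ^ p = Complex.exp (p * Complex.log (u - 1) + p * (π * I)) := by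
    rw [Complex.exp_add, Complex.exp_nat_mul, Complex.exp_nat_mul,
      Complex.exp_log (sub_ne_zero.2 hu), Complex.exp_pi_mul_I, ← mul_pow]
    congr 1; ring
  have hadd : (1 + u) ^ (N - p) = Complex.exp ((N - p : ℂ) * Complex.log (u + 1)) := by
    rw [← Nat.cast_sub hpN, Complex.exp_nat_mul,
      Complex.exp_log fun h => hu' (eq_neg_of_add_eq_zero_left h), add_comm]
  rw [hsub, hadd, ← Complex.exp_add, logCoord, hpc]
  congr 1; ring

theorem ne_of_pow_mul_pow_ne_zero (h : (1 - u) ^ p * (1 + u) ^ (N - p) ≠ 0) (hp : p ≠ 0)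
    (hpN : p < N) : u ≠ 1 ∧ u ≠ -1 := by
  refine ⟨?_, ?_⟩ <;> rintro rfl <;> refine h ?_
  · rw [sub_self, zero_pow hp, zero_mul]
  · rw [add_neg_cancel, zero_pow (Nat.sub_ne_zero_of_lt hpN), mul_zero]

theorem exists_logCoord_eq (hpN : p ≤ N) (hN : N ≠ 0) (hp : (p : ℝ) = ρ * N) (hu : u ≠ 1)
    (hu' : u ≠ -1)
    (h : (1 - u) ^ p * (1 + u) ^ (N - p) = Complex.exp (N * x + 2 * π * s * I)) :
    ∃ k : ℤ, logCoord ρ u = x + betheAngle N p (k + s) * I := by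
  rw [pow_mul_pow_eq_exp hpN hp hu hu', Complex.exp_eq_exp_iff_exists_int] at h
  obtain ⟨k, hk⟩ := h
  have hN' : (N : ℂ) ≠ 0 := mod_cast hN
  refine ⟨k, mul_left_cancel₀ hN' ?_⟩
  rw [betheAngle]
  push_cast
  field_simp
  linear_combination hk

theorem eq_of_modEq_of_bounds {k J : ℤ} (hpN : p + 2 < N) (hJ : J ∈ Icc (0 : ℤ) (p + 1))
    (hkJ : k ≡ J [ZMOD N]) (hk : -(N : ℤ) ≤ 2 * k - p) (hk' : 2 * k - p < N + 2) : k = J := by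
  have hlt : |J - k| < N := by
    obtain ⟨hJ0, hJp⟩ := hJ
    rw [abs_lt]
    omega
  have hzero := Int.eq_zero_of_abs_lt_dvd hkJ.dvd hlt
  omega

theorem IsLabelledRoot.rootAt (hρ0 : 0 < ρ) (hρ1 : ρ < 1) (hpN : p + 2 < N)
    (hp : (p : ℝ) = ρ * N) {J : ℤ} (hJ : J ∈ Icc (0 : ℤ) (p + 1)) (hjJ : (j : ℤ) ≡ J [ZMOD N])
    (hs : s ∈ Ioc (0 : ℝ) 1) (hC : C = Complex.exp (N * x + 2 * π * s * I))
    (h : IsLabelledRoot N p j C u) :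
    RootAt ρ x (betheAngle N p (J - 1 + s)) u := by
  have hN : (0 : ℝ) < N := mod_cast (by omega : 0 < N)
  have hp0 : p ≠ 0 := by
    have : (p : ℝ) ≠ 0 := by rw [hp]; positivity
    exact mod_cast this
  obtain ⟨heq, m, hm⟩ := h
  obtain ⟨hu, hu'⟩ := ne_of_pow_mul_pow_ne_zero
    (heq ▸ hC ▸ Complex.exp_ne_zero _) hp0 (by omega)
  obtain ⟨k, hk⟩ := exists_logCoord_eq (by omega) (by omega) hp hu hu' (heq.trans hC)
  have him : (logCoord ρ u).im = betheAngle N p (k + s) := by simp [hk]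
  have hlabel : labelF N p u = 2 * (k + s) - p := by
    rw [labelF_eq (by omega) hp, him, betheAngle]
    field_simp
  rw [hlabel] at hm
  obtain ⟨hm, hm'⟩ := hm
  have hkm : k + N * m = j - 1 := by
    have hlt : (k + N * m : ℝ) < j := by linarith [hs.1]
    have hgt : (j - 2 : ℝ) < k + N * m := by linarith [hs.2]
    have hlt' : k + N * m < j := mod_cast hlt
    have hgt' : (j : ℤ) - 2 < k + N * m := mod_cast hgt
    omega
  have hrange : |2 * (k + s) - p| ≤ N := by
    rw [← hlabel, labelF_eq (by omega) hp, abs_mul, abs_of_nonneg (by positivity),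
      div_mul_eq_mul_div, div_le_iff₀ Real.pi_pos]
    gcongr
    exact abs_logCoord_im_le_pi hρ0 hρ1 u
  have hkJ : k + 1 = J := by
    refine eq_of_modEq_of_bounds hpN hJ (Int.ModEq.trans ?_ hjJ) ?_ ?_
    · exact Int.modEq_iff_dvd.2 ⟨m, by linarith⟩
    · have : (-N : ℝ) ≤ 2 * (k + 1) - p := by linarith [(abs_le.1 hrange).1, hs.2]
      exact mod_cast this
    · have : (2 * (k + 1) - p : ℝ) < N + 2 := by linarith [(abs_le.1 hrange).2, hs.1]
      exact mod_cast this
  have hroot := rootAt_logCoord hρ0 hρ1 hu hu'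
  rw [him] at hroot
  simpa [hk, ← hkJ] using hroot

theorem phase_eq_one (hs : s ∈ Ioc (0 : ℝ) 1) (y : ℝ)
    (him : (Complex.exp (y + 2 * π * s * I)).im = 0)
    (hre : 0 < (Complex.exp (y + 2 * π * s * I)).re) : s = 1 := by
  have hexp : Complex.exp (y + 2 * π * s * I)
      = (Real.exp y : ℂ) * Complex.exp ((2 * π * s : ℝ) * I) := by
    rw [Complex.exp_add, Complex.ofReal_exp]; push_cast; rfl
  rw [hexp, Complex.im_ofReal_mul, Complex.exp_ofReal_mul_I_im] at him
  rw [hexp, Complex.re_ofReal_mul, Complex.exp_ofReal_mul_I_re] at hre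
  have hcos : 0 < Real.cos (2 * π * s) := pos_of_mul_pos_right hre (Real.exp_pos y).le
  have hsin : Real.sin (2 * π * s) = 0 := (mul_eq_zero.1 him).resolve_left (Real.exp_ne_zero y)
  have hcos_one : Real.cos (2 * π * s) = 1 := by
    rcases Real.sin_eq_zero_iff_cos_eq.1 hsin with h | h <;> linarith
  obtain ⟨n, hn⟩ := (Real.cos_eq_one_iff _).1 hcos_one
  have hsn : s = n := mul_left_cancel₀ Real.two_pi_pos.ne' (by linarith)
  obtain ⟨hs0, hs1⟩ := hs
  rw [hsn] at hs0 hs1 ⊢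
  norm_cast at hs0 hs1 ⊢
  omega

theorem pow_mul_pow_eq_of_tendsto {v : ℝ → ℂ} (hvu : Tendsto v (𝓝[<] 0) (𝓝 u))
    (hv : ∀ᶠ δ in 𝓝[<] 0, (1 - v δ) ^ p * (1 + v δ) ^ (N - p) = C * Complex.exp (I * (δ : ℂ))) :
    (1 - u) ^ p * (1 + u) ^ (N - p) = C := by
  have hlhs : Continuous fun u : ℂ => (1 - u) ^ p * (1 + u) ^ (N - p) := by fun_prop
  have hrhs : Continuous fun δ : ℝ => C * Complex.exp (I * (δ : ℂ)) := by fun_prop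
  have hlim := (hrhs.tendsto 0).mono_left (nhdsWithin_le_nhds (s := Iio 0))
  simp only [Complex.ofReal_zero, mul_zero, Complex.exp_zero, mul_one] at hlim
  exact tendsto_nhds_unique ((hlhs.tendsto u).comp hvu)
    (hlim.congr' (hv.mono fun δ hδ => hδ.symm))

theorem IsBetheRoot.rootAt (hρ0 : 0 < ρ) (hρ1 : ρ < 1) (hpN : p + 2 < N)
    (hp : (p : ℝ) = ρ * N) {J : ℤ} (hJ : J ∈ Icc (0 : ℤ) (p + 1)) (hjJ : (j : ℤ) ≡ J [ZMOD N])
    (hs : s ∈ Ioc (0 : ℝ) 1) (hC : C = Complex.exp (N * x + 2 * π * s * I))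
    (h : IsBetheRoot N p j C u) :
    RootAt ρ x (betheAngle N p (J - 1 + s)) u := by
  rcases h with ⟨-, h⟩ | ⟨⟨him, hre⟩, v, hv, hvu⟩
  · exact h.rootAt hρ0 hρ1 hpN hp hJ hjJ hs hC
  obtain rfl : s = 1 :=
    phase_eq_one hs (N * x) (by simpa [hC] using him) (by simpa [hC] using hre)
  have heq := pow_mul_pow_eq_of_tendsto hvu (hv.mono fun δ hδ => hδ.1)
  have hp0 : p ≠ 0 := by
    have : (p : ℝ) ≠ 0 := by rw [hp]; have : (0 : ℝ) < N := mod_cast (by omega); positivity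
    exact mod_cast this
  obtain ⟨hu, hu'⟩ := ne_of_pow_mul_pow_ne_zero
    (heq ▸ hC ▸ Complex.exp_ne_zero _) hp0 (by omega)
  have hφ : Tendsto (fun δ : ℝ => betheAngle N p (J - 1 + (1 + δ / (2 * π)))) (𝓝[<] 0)
      (𝓝 (betheAngle N p (J - 1 + 1))) := by
    have hcont : Continuous fun δ : ℝ => betheAngle N p (J - 1 + (1 + δ / (2 * π))) := by
      unfold betheAngle; fun_prop
    simpa using (hcont.tendsto 0).mono_left nhdsWithin_le_nhds
  refine rootAt_of_tendsto hu hu' hvu hφ ?_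
  have hIoo : Ioo (-(2 * π)) 0 ∈ 𝓝[<] (0 : ℝ) := Ioo_mem_nhdsLT (by linarith [Real.pi_pos])
  filter_upwards [hv, hIoo] with δ hδ ⟨hδ1, hδ0⟩
  refine hδ.rootAt hρ0 hρ1 hpN hp hJ hjJ ⟨?_, ?_⟩ ?_
  · have : -1 < δ / (2 * π) := by rw [lt_div_iff₀ Real.two_pi_pos]; linarith
    linarith
  · have := div_neg_of_neg_of_pos hδ0 Real.two_pi_pos
    linarith
  · rw [hC, ← Complex.exp_add]
    congr 1
    have : (π : ℂ) ≠ 0 := mod_cast Real.pi_ne_zero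
    push_cast
    field_simp
    ring

end Labels

section BetheSolutions

variable {ρ γ x s : ℝ} {N p : ℕ} {t : ℕ → ℤ} {u : ℕ → ℂ} {C l : ℂ}

/-- A solution `u₀, …, u_{p-1}` of the consistency equation in the logarithmic coordinate: the
parameter is `C = exp (N x + 2π s i)`, the root `u i` has position `t i + s`, and the solution
gives the value `l`. -/
structure BetheSol (ρ γ : ℝ) (N p : ℕ) (t : ℕ → ℤ) (x s : ℝ) (u : ℕ → ℂ) (l : ℂ) : Prop where
  phase_mem : s ∈ Icc (0 : ℝ) 1
  root : ∀ i < p, RootAt ρ x (betheAngle N p (t i + s)) (u i)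
  prod_eq : (2 : ℂ) ^ N * (Real.exp (γ * N) : ℂ) * ∏ i ∈ Finset.range p, (u i - 1) / (u i + 1)
    + Complex.exp (N * x + 2 * π * s * I) = 0
  val_eq : l = 1 / 2 * ∑ i ∈ Finset.range p, (u i - 1)

theorem Realizes.exists_betheSol (hρ0 : 0 < ρ) (hρ1 : ρ < 1) (hpN : p + 2 < N)
    (hp : (p : ℝ) = ρ * N) {A : Finset ℕ} (h : Realizes N p γ A C l) {σ : ℕ → ℕ}
    (hσ : InjOn σ (Finset.range p)) (hA : (Finset.range p).image σ = A)
    (ht : ∀ i < p, t i + 1 ∈ Icc (0 : ℤ) (p + 1))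
    (hσt : ∀ i < p, (σ i : ℤ) ≡ t i + 1 [ZMOD N]) :
    ∃ s u, BetheSol ρ γ N p t (Real.log ‖C‖ / N) s u l := by
  obtain ⟨hC0, u, hu, hprod, hl⟩ := h
  obtain ⟨s, hs, hC⟩ := exists_eq_exp_phase (N := N) (by omega) hC0
  refine ⟨s, fun i => u (σ i), ⟨hs.1.le, hs.2⟩, fun i hi => ?_, ?_, ?_⟩
  · have hroot := (hu (σ i) (hA ▸ Finset.mem_image_of_mem σ (Finset.mem_range.2 hi))).rootAt
      hρ0 hρ1 hpN hp (ht i hi) (hσt i hi) hs hC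
    simpa using hroot
  · rw [← hC, ← hprod, ← hA, Finset.prod_image hσ]
  · rw [hl, ← hA, Finset.sum_image hσ]

theorem BetheSol.conj (h : BetheSol ρ γ N p t x s u l) :
    BetheSol ρ γ N p (fun i => p - 1 - t i) x (1 - s) (fun i => conj (u i)) (conj l) := by
  obtain ⟨⟨hs0, hs1⟩, hroot, hprod, hl⟩ := h
  refine ⟨⟨by linarith, by linarith⟩, fun i hi => ?_, ?_, ?_⟩
  · convert (hroot i hi).conj using 1
    rw [betheAngle, betheAngle]
    push_cast
    ring
  · have hexp : Complex.exp (N * x + 2 * π * (1 - s : ℝ) * I)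
        = conj (Complex.exp (N * x + 2 * π * s * I)) := by
      rw [← Complex.exp_conj, Complex.exp_eq_exp_iff_exists_int]
      refine ⟨1, ?_⟩
      simp only [map_add, map_mul, map_ofNat, Complex.conj_ofReal, Complex.conj_I, map_natCast]
      push_cast
      ring
    rw [hexp]
    have h := congrArg conj hprod
    simp only [map_add, map_mul, map_pow, map_ofNat, map_prod, map_div₀, map_sub, map_one,
      Complex.conj_ofReal, map_zero] at h
    exact h
  · simp only [hl, map_mul, map_div₀, map_one, map_ofNat, map_sum, map_sub]

/-- The positions `0, …, p - 1`, with the last of them moved up by `e`. -/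
def lastMoved (p e i : ℕ) : ℤ := if i + 1 = p then i + e else i

theorem lastMoved_of_lt {e i : ℕ} (hi : i + 1 < p) : lastMoved p e i = i := if_neg hi.ne

theorem Realizes.exists_betheSol_choiceOne (hρ0 : 0 < ρ) (hρ1 : ρ < 1) (hpN : p + 2 < N)
    (hp : (p : ℝ) = ρ * N) (h : Realizes N p γ (choiceOne p) C l) :
    ∃ s u, BetheSol ρ γ N p (lastMoved p 0) (Real.log ‖C‖ / N) s u l := by
  refine h.exists_betheSol hρ0 hρ1 hpN hp (σ := fun i => i + 1) ?_ ?_ ?_ ?_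
  · exact (add_left_injective 1).injOn
  · ext j
    simp only [choiceOne, Finset.mem_image, Finset.mem_range, Finset.mem_Icc]
    exact ⟨by rintro ⟨i, hi, rfl⟩; omega, fun hj => ⟨j - 1, by omega, by omega⟩⟩
  · intro i hi
    simp only [lastMoved, mem_Icc]
    split_ifs <;> omega
  · intro i _
    simp [lastMoved]

theorem Realizes.exists_betheSol_choiceTwo (hρ0 : 0 < ρ) (hρ1 : ρ < 1) (hpN : p + 2 < N)
    (hp0 : 0 < p) (hp : (p : ℝ) = ρ * N) (h : Realizes N p γ (choiceTwo p) C l) :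
    ∃ s u, BetheSol ρ γ N p (lastMoved p 1) (Real.log ‖C‖ / N) s u l := by
  refine h.exists_betheSol hρ0 hρ1 hpN hp (σ := fun i => if i + 1 = p then p + 1 else i + 1)
    ?_ ?_ ?_ ?_
  · intro i hi j hj hij
    simp only [Finset.coe_range, mem_Iio] at hi hj
    grind
  · ext j
    simp only [choiceTwo, Finset.mem_image, Finset.mem_range, Finset.mem_insert, Finset.mem_Icc]
    refine ⟨by grind, fun hj => ⟨if j = p + 1 then p - 1 else j - 1, by grind, by grind⟩⟩
  · intro i hi
    simp only [lastMoved, mem_Icc]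
    split_ifs <;> omega
  · intro i _
    simp only [lastMoved]
    split_ifs with hip
    · rw [← hip]; rfl
    · rfl

theorem Realizes.exists_betheSol_conj (hρ0 : 0 < ρ) (hρ1 : ρ < 1) (hpN : p + 2 < N)
    (hp : (p : ℝ) = ρ * N) {A : Finset ℕ} (h : Realizes N p γ A C l) {σ : ℕ → ℕ}
    (hσ : InjOn σ (Finset.range p)) (hA : (Finset.range p).image σ = A)
    (ht : ∀ i < p, p - t i ∈ Icc (0 : ℤ) (p + 1))
    (hσt : ∀ i < p, (σ i : ℤ) ≡ p - t i [ZMOD N]) :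
    ∃ s u, BetheSol ρ γ N p t (Real.log ‖C‖ / N) s u (conj l) := by
  obtain ⟨s, u, hsol⟩ := h.exists_betheSol (t := fun i => p - 1 - t i) hρ0 hρ1 hpN hp hσ hA
    (fun i hi => by convert ht i hi using 1; ring) fun i hi => by convert hσt i hi using 1; ring
  exact ⟨1 - s, fun i => conj (u i), by simpa using hsol.conj⟩

theorem Realizes.exists_betheSol_conj_choiceOne (hρ0 : 0 < ρ) (hρ1 : ρ < 1) (hpN : p + 2 < N)
    (hp : (p : ℝ) = ρ * N) (h : Realizes N p γ (choiceOne p) C l) :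
    ∃ s u, BetheSol ρ γ N p (lastMoved p 0) (Real.log ‖C‖ / N) s u (conj l) := by
  refine h.exists_betheSol_conj hρ0 hρ1 hpN hp (σ := fun i => p - i) ?_ ?_ ?_ ?_
  · intro i hi j hj hij
    simp only [Finset.coe_range, mem_Iio] at hi hj
    grind
  · ext j
    simp only [choiceOne, Finset.mem_image, Finset.mem_range, Finset.mem_Icc]
    exact ⟨by rintro ⟨i, hi, rfl⟩; omega, fun hj => ⟨p - j, by omega, by omega⟩⟩
  · intro i hi
    simp only [lastMoved, mem_Icc]
    split_ifs <;> omega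
  · intro i hi
    simp [lastMoved, Nat.cast_sub hi.le]

theorem Realizes.exists_betheSol_conj_choiceTwo' (hρ0 : 0 < ρ) (hρ1 : ρ < 1) (hpN : p + 2 < N)
    (hp0 : 0 < p) (hp : (p : ℝ) = ρ * N) (h : Realizes N p γ (choiceTwo' N p) C l) :
    ∃ s u, BetheSol ρ γ N p (lastMoved p 1) (Real.log ‖C‖ / N) s u (conj l) := by
  refine h.exists_betheSol_conj hρ0 hρ1 hpN hp (σ := fun i => if i + 1 = p then N else p - i)
    ?_ ?_ ?_ ?_
  · intro i hi j hj hij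
    simp only [Finset.coe_range, mem_Iio] at hi hj
    grind
  · ext j
    simp only [choiceTwo', Finset.mem_image, Finset.mem_range, Finset.mem_insert, Finset.mem_Icc]
    refine ⟨by grind, fun hj => ⟨if j = N then p - 1 else p - j, by grind, by grind⟩⟩
  · intro i hi
    simp only [lastMoved, mem_Icc]
    split_ifs <;> omega
  · intro i hi
    simp only [lastMoved]
    split_ifs with hip
    · exact Int.modEq_iff_dvd.2 ⟨-1, by omega⟩
    · rw [Nat.cast_sub hi.le]

theorem sub_one_div_add_one_eq_exp (hρ0 : 0 < ρ) {w : ℂ} (hw : w ≠ 1) (hw' : w ≠ -1) :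
    (w - 1) / (w + 1) = Complex.exp ((logCoord ρ w - (Real.log 2 : ℝ) - logHalf w) / ρ) := by
  have hsub : w - 1 ≠ 0 := sub_ne_zero.2 hw
  have hadd : w + 1 ≠ 0 := by rwa [← sub_neg_eq_add, sub_ne_zero]
  have hρ : (ρ : ℂ) ≠ 0 := mod_cast hρ0.ne'
  have hexp : (logCoord ρ w - (Real.log 2 : ℝ) - logHalf w) / ρ
      = Complex.log (w - 1) - Complex.log (w + 1) := by
    rw [logCoord, logHalf]
    field_simp
    ring
  rw [hexp, Complex.exp_sub, Complex.exp_log hsub, Complex.exp_log hadd]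

theorem log_norm_sub_one_div_add_one (hρ0 : 0 < ρ) {w : ℂ} (hw : w ≠ 1) (hw' : w ≠ -1) :
    Real.log ‖(w - 1) / (w + 1)‖ = (logMod ρ w - Real.log 2 - (logHalf w).re) / ρ := by
  rw [sub_one_div_add_one_eq_exp hρ0 hw hw', Complex.norm_exp, Real.log_exp, Complex.div_ofReal_re,
    Complex.sub_re, Complex.sub_re, Complex.ofReal_re, logCoord_re]

theorem BetheSol.sum_logHalf_re (hρ0 : 0 < ρ) (hp : (p : ℝ) = ρ * N)
    (h : BetheSol ρ γ N p t x s u l) :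
    ∑ i ∈ Finset.range p, (logHalf (u i)).re = p * γ := by
  have hne : ∀ i ∈ Finset.range p, ‖(u i - 1) / (u i + 1)‖ ≠ 0 := fun i hi => by
    have hroot := h.root i (Finset.mem_range.1 hi)
    rw [norm_div]
    exact (div_pos (norm_sub_one_pos hroot.ne_one) (norm_add_one_pos hroot.ne_neg_one)).ne'
  have hfactor : ∀ i ∈ Finset.range p, Real.log ‖(u i - 1) / (u i + 1)‖
      = (x - Real.log 2 - (logHalf (u i)).re) / ρ := fun i hi => by
    have hroot := h.root i (Finset.mem_range.1 hi)
    rw [log_norm_sub_one_div_add_one hρ0 hroot.ne_one hroot.ne_neg_one, hroot.logMod_eq]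
  have hlog := congrArg (fun z => Real.log ‖z‖) (eq_neg_of_add_eq_zero_left h.prod_eq)
  simp only [norm_neg, norm_mul, norm_pow, norm_prod, Complex.norm_real, Complex.norm_exp,
    Complex.norm_two, Real.norm_eq_abs, Real.abs_exp] at hlog
  rw [Real.log_exp, Real.log_mul (by positivity) (Finset.prod_ne_zero_iff.2 hne),
    Real.log_mul (by positivity) (Real.exp_ne_zero _), Real.log_exp, Real.log_pow,
    Real.log_prod hne, Finset.sum_congr rfl hfactor, ← Finset.sum_div, Finset.sum_sub_distrib,
    Finset.sum_const, Finset.card_range, nsmul_eq_mul, hp] at hlog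
  have hre : (N * x + 2 * π * s * I : ℂ).re = N * x := by simp
  rw [hre] at hlog
  rw [hp]
  field_simp at hlog
  linarith

theorem BetheSol.exp_le (hρ0 : 0 < ρ) (hρ1 : ρ < 1) (hp0 : 0 < p) (hp : (p : ℝ) = ρ * N)
    (h : BetheSol ρ γ N p t x s u l) : Real.exp x ≤ 2 * Real.exp γ + 2 := by
  obtain ⟨i, hi, hle⟩ : ∃ i ∈ Finset.range p, (logHalf (u i)).re ≤ γ := by
    refine Finset.exists_le_of_sum_le (Finset.nonempty_range_iff.2 hp0.ne') ?_
    simp [h.sum_logHalf_re hρ0 hp]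
  have hroot := h.root i (Finset.mem_range.1 hi)
  have hpos := norm_add_one_pos hroot.ne_neg_one
  rw [logHalf_re, ← Real.log_div hpos.ne' two_ne_zero, Real.log_le_iff_le_exp (by positivity)]
    at hle
  have hexp := exp_logMod_le hρ0 hρ1 hroot.ne_one hroot.ne_neg_one
  rw [hroot.logMod_eq] at hexp
  linarith

theorem norm_sub_one_le_exp_logMod_div (hρ0 : 0 < ρ) (hρ1 : ρ < 1) {w : ℂ} (hw : w ≠ 1)
    (h2 : 2 ≤ ‖w + 1‖) : ‖w - 1‖ ≤ Real.exp (logMod ρ w / ρ) := by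
  have hlog : 0 ≤ Real.log ‖w + 1‖ := Real.log_nonneg (by linarith)
  rw [← Real.log_le_iff_le_exp (norm_sub_one_pos hw), le_div_iff₀ hρ0, logMod]
  nlinarith [mul_nonneg (sub_pos.2 hρ1).le hlog]

theorem BetheSol.exp_ge (hρ0 : 0 < ρ) (hρ1 : ρ < 1) (hp0 : 0 < p) (hp : (p : ℝ) = ρ * N)
    (h : BetheSol ρ γ N p t x s u l) : Real.exp γ ≤ 1 + Real.exp (x / ρ) / 2 := by
  obtain ⟨i, hi, hle⟩ : ∃ i ∈ Finset.range p, γ ≤ (logHalf (u i)).re := by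
    refine Finset.exists_le_of_sum_le (Finset.nonempty_range_iff.2 hp0.ne') ?_
    simp [h.sum_logHalf_re hρ0 hp]
  have hroot := h.root i (Finset.mem_range.1 hi)
  have hpos := norm_add_one_pos hroot.ne_neg_one
  rw [logHalf_re, ← Real.log_div hpos.ne' two_ne_zero, Real.le_log_iff_exp_le (by positivity)]
    at hle
  refine hle.trans ?_
  rcases le_or_gt ‖u i + 1‖ 2 with h2 | h2
  · linarith [Real.exp_pos (x / ρ)]
  · have hsub := norm_sub_one_le_exp_logMod_div hρ0 hρ1 hroot.ne_one h2.le
    rw [hroot.logMod_eq] at hsub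
    linarith [norm_add_one_le (u i)]

end BetheSolutions

/-! ### Convergence of the modulus -/

section StepFunctions

theorem integral_comp_natFloor {E : Type*} [NormedAddCommGroup E] [NormedSpace ℝ E]
    [CompleteSpace E] (g : ℕ → E) (n : ℕ) :
    ∫ y in (0 : ℝ)..n, g ⌊y⌋₊ = ∑ i ∈ Finset.range n, g i := by
  have hfloor : ∀ k : ℕ, EqOn (fun _ : ℝ => g k) (fun y => g ⌊y⌋₊) (Ioo (k : ℝ) (k + 1 : ℕ)) :=
    fun k y ⟨hky, hyk⟩ => by
      have : ⌊y⌋₊ = k := (Nat.floor_eq_iff (k.cast_nonneg.trans hky.le)).2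
        ⟨hky.le, by exact_mod_cast hyk⟩
      simp only [this]
  have hle : ∀ k : ℕ, (k : ℝ) ≤ (k + 1 : ℕ) := fun k => Nat.cast_le.2 k.le_succ
  have hint : ∀ k < n, IntervalIntegrable (fun y : ℝ => g ⌊y⌋₊) MeasureTheory.volume k
      (k + 1 : ℕ) := fun k _ => by
    rw [intervalIntegrable_iff_integrableOn_Ioo_of_le (hle k)]
    exact (MeasureTheory.integrableOn_const (by simp)).congr_fun (hfloor k) measurableSet_Ioo
  rw [← Nat.cast_zero, ← intervalIntegral.sum_integral_adjacent_intervals hint]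
  refine Finset.sum_congr rfl fun k _ => ?_
  rw [intervalIntegral.integral_of_le (hle k), MeasureTheory.integral_Ioc_eq_integral_Ioo,
    ← MeasureTheory.setIntegral_congr_fun measurableSet_Ioo (hfloor k)]
  simp

theorem integral_comp_natFloor_mul {p : ℕ} (hp : p ≠ 0) (g : ℕ → ℝ) :
    ∫ y in (0 : ℝ)..1, g ⌊p * y⌋₊ = (∑ i ∈ Finset.range p, g i) / p := by
  rw [intervalIntegral.integral_comp_mul_left (fun y => g ⌊y⌋₊) (Nat.cast_ne_zero.2 hp), mul_zero,
    mul_one, integral_comp_natFloor, smul_eq_mul, inv_mul_eq_div]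

end StepFunctions

/-- The number of sites `N` tends to infinity along `L` while the number of particles is
`p = ρ N`. -/
structure ThermodynamicLimit {ι : Type*} (ρ : ℝ) (L : Filter ι) (N p : ι → ℕ) : Prop where
  tendsto_sites : Tendsto N L atTop
  particles_eq : ∀ k, (p k : ℝ) = ρ * N k

section ThermodynamicLimit

variable {ι : Type*} {ρ γ x' : ℝ} {L : Filter ι} {N p e : ι → ℕ} {x s : ι → ℝ} {u : ι → ℕ → ℂ}
  {l : ι → ℂ} {y : ℝ}

namespace ThermodynamicLimit

theorem comp {κ : Type*} {L' : Filter κ} {f : κ → ι} (hT : ThermodynamicLimit ρ L N p)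
    (hf : Tendsto f L' L) : ThermodynamicLimit ρ L' (N ∘ f) (p ∘ f) :=
  ⟨hT.tendsto_sites.comp hf, fun k => hT.particles_eq (f k)⟩

theorem tendsto_cast_sites (hT : ThermodynamicLimit ρ L N p) :
    Tendsto (fun k => (N k : ℝ)) L atTop :=
  tendsto_natCast_atTop_atTop.comp hT.tendsto_sites

theorem tendsto_cast_particles (hT : ThermodynamicLimit ρ L N p) (hρ0 : 0 < ρ) :
    Tendsto (fun k => (p k : ℝ)) L atTop := by
  simp only [hT.particles_eq]
  exact hT.tendsto_cast_sites.const_mul_atTop hρ0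

theorem eventually_sites_pos (hT : ThermodynamicLimit ρ L N p) : ∀ᶠ k in L, 0 < N k :=
  hT.tendsto_sites.eventually_gt_atTop 0

theorem eventually_particles_pos (hT : ThermodynamicLimit ρ L N p) (hρ0 : 0 < ρ) :
    ∀ᶠ k in L, 0 < p k := by
  filter_upwards [(hT.tendsto_cast_particles hρ0).eventually_gt_atTop 0] with k hk
  exact mod_cast hk

theorem eventually_particles_add_two_lt (hT : ThermodynamicLimit ρ L N p) (hρ1 : ρ < 1) :
    ∀ᶠ k in L, p k + 2 < N k := by
  filter_upwards [(hT.tendsto_cast_sites.const_mul_atTop (sub_pos.2 hρ1)).eventually_gt_atTop 2]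
    with k hk
  have : (p k : ℝ) + 2 < N k := by rw [hT.particles_eq]; linarith
  exact mod_cast this

end ThermodynamicLimit

theorem tendsto_betheAngle_floor (hT : ThermodynamicLimit ρ L N p) (hs : ∀ᶠ k in L, s k ∈ Icc 0 1)
    (hρ0 : 0 < ρ) (hy : 0 ≤ y) :
    Tendsto (fun k => betheAngle (N k) (p k) (⌊p k * y⌋₊ + s k)) L (𝓝 (ρ * π * (2 * y - 1))) := by
  have hp := hT.tendsto_cast_particles hρ0
  have hfloor : Tendsto (fun k => (⌊p k * y⌋₊ : ℝ) / p k) L (𝓝 y) := by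
    simpa only [Function.comp_def, mul_comm y] using (tendsto_nat_floor_mul_div_atTop hy).comp hp
  have hphase : Tendsto (fun k => s k / p k) L (𝓝 0) := by
    refine squeeze_zero_norm' ?_ (tendsto_const_nhds.div_atTop hp : Tendsto (fun k => 1 / (p k : ℝ))
      L (𝓝 0))
    filter_upwards [hs] with k ⟨hs0, hs1⟩
    rw [norm_div, Real.norm_of_nonneg hs0, RCLike.norm_natCast]
    gcongr
  have hlim := (((hfloor.add hphase).const_mul 2).sub_const 1).const_mul (ρ * π)
  rw [add_zero] at hlim
  refine hlim.congr' ?_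
  filter_upwards [hT.eventually_sites_pos] with k hk
  have : (N k : ℝ) ≠ 0 := mod_cast hk.ne'
  rw [betheAngle, hT.particles_eq]
  field_simp

theorem BetheSol.root_eq_logCoordInv {N p e i : ℕ} {x s : ℝ} {u : ℕ → ℂ} {l : ℂ} (hρ0 : 0 < ρ)
    (hρ1 : ρ < 1) (h : BetheSol ρ γ N p (lastMoved p e) x s u l) (hi : i + 1 < p)
    (hangle : |betheAngle N p (i + s)| < ρ * π) :
    u i = logCoordInv ρ (x + betheAngle N p (i + s) * I) := by
  have hroot := h.root i (by omega)
  rw [lastMoved_of_lt hi, Int.cast_natCast] at hroot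
  refine hroot.eq_logCoordInv hρ0 hρ1 (Or.inl ?_)
  simpa using hangle

theorem tendsto_root_floor (hρ0 : 0 < ρ) (hρ1 : ρ < 1) (hT : ThermodynamicLimit ρ L N p)
    (h : ∀ᶠ k in L, BetheSol ρ γ (N k) (p k) (lastMoved (p k) (e k)) (x k) (s k) (u k) (l k))
    (hx : Tendsto x L (𝓝 x')) (hy : y ∈ Ioo 0 1) :
    Tendsto (fun k => (logHalf (u k ⌊p k * y⌋₊)).re) L
      (𝓝 (logHalf (logCoordInv ρ (arcPoint ρ x' y))).re) := by
  have hangle := tendsto_betheAngle_floor hT (h.mono fun k hk => hk.phase_mem) hρ0 hy.1.le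
  have hpoint : Tendsto (fun k => (x k : ℂ) + betheAngle (N k) (p k) (⌊p k * y⌋₊ + s k) * I) L
      (𝓝 (arcPoint ρ x' y)) :=
    hx.ofReal.add (hangle.ofReal.mul_const I)
  have hcont := Complex.continuous_re.continuousAt.comp
    (continuousAt_logHalf_logCoordInv hρ0 hρ1 (arcPoint_mem hρ0 hρ1 x' hy))
  refine (hcont.tendsto.comp hpoint).congr' ?_
  have habs : |ρ * π * (2 * y - 1)| < ρ * π := by
    simpa using abs_arcPoint_im_lt hρ0 x' hy
  have hindex : ∀ᶠ k in L, ⌊p k * y⌋₊ + 1 < p k := by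
    filter_upwards [((hT.tendsto_cast_particles hρ0).atTop_mul_const
      (sub_pos.2 hy.2)).eventually_gt_atTop 1] with k hk
    have hfloor := Nat.floor_le (mul_nonneg (p k).cast_nonneg hy.1.le)
    have : (⌊p k * y⌋₊ + 1 : ℝ) < p k := by linarith
    exact mod_cast this
  filter_upwards [h, hindex, hangle.abs.eventually_lt_const habs] with k hk hkp hkψ
  simp only [Function.comp, hk.root_eq_logCoordInv hρ0 hρ1 hkp hkψ]

theorem integral_logHalf_arcPoint_eq_of_tendsto [L.NeBot] [L.IsCountablyGenerated]
    (hρ0 : 0 < ρ) (hρ1 : ρ < 1) (hT : ThermodynamicLimit ρ L N p)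
    (h : ∀ᶠ k in L, BetheSol ρ γ (N k) (p k) (lastMoved (p k) (e k)) (x k) (s k) (u k) (l k))
    (hx : Tendsto x L (𝓝 x')) :
    ∫ y in (0 : ℝ)..1, (logHalf (logCoordInv ρ (arcPoint ρ x' y))).re = γ := by
  have hp0 := hT.eventually_particles_pos hρ0
  have hinterior : ∀ᵐ y ∂MeasureTheory.volume, y ∈ uIoc (0 : ℝ) 1 → y ∈ Ioo (0 : ℝ) 1 := by
    filter_upwards [MeasureTheory.Measure.ae_ne MeasureTheory.volume (1 : ℝ)] with y hy1 hy
    rw [uIoc_of_le zero_le_one] at hy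
    exact ⟨hy.1, hy.2.lt_of_ne hy1⟩
  obtain ⟨M, hM⟩ := exists_abs_logHalf_re_le hρ0 hρ1 (x' - 1) (x' + 1)
  have hlim : Tendsto (fun k => ∫ y in (0 : ℝ)..1, (logHalf (u k ⌊p k * y⌋₊)).re) L
      (𝓝 (∫ y in (0 : ℝ)..1, (logHalf (logCoordInv ρ (arcPoint ρ x' y))).re)) := by
    refine intervalIntegral.tendsto_integral_filter_of_dominated_convergence (fun _ => M) ?_ ?_
      intervalIntegrable_const ?_
    · refine .of_forall fun k => Measurable.aestronglyMeasurable ?_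
      have hmeas : Measurable fun i : ℕ => (logHalf (u k i)).re := measurable_from_top
      exact hmeas.comp (Nat.measurable_floor.comp (by fun_prop))
    · filter_upwards [h, hp0, hx.eventually (Icc_mem_nhds (sub_one_lt x') (lt_add_one x'))]
        with k hk hk0 hkx
      filter_upwards [hinterior] with y hy hy01
      obtain ⟨hy0, hy1⟩ := hy hy01
      have hindex : ⌊p k * y⌋₊ < p k := (Nat.floor_lt (by positivity)).2
        (mul_lt_of_lt_one_right (mod_cast hk0) hy1)
      have hroot := hk.root _ hindex
      exact hM _ ⟨hroot.ne_one, hroot.ne_neg_one, hroot.logMod_eq ▸ hkx⟩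
    · filter_upwards [hinterior] with y hy hy01
      exact tendsto_root_floor hρ0 hρ1 hT h hx (hy hy01)
  refine tendsto_nhds_unique hlim (tendsto_const_nhds.congr' ?_)
  filter_upwards [h, hp0] with k hk hk0
  rw [integral_comp_natFloor_mul hk0.ne' fun i => (logHalf (u k i)).re,
    hk.sum_logHalf_re hρ0 (hT.particles_eq k), mul_div_cancel_left₀ γ (mod_cast hk0.ne')]

theorem BetheSol.logMod_mem_Icc {N p : ℕ} {t : ℕ → ℤ} {x s : ℝ} {u : ℕ → ℂ} {l : ℂ}
    (hρ0 : 0 < ρ) (hρ1 : ρ < 1) (hγ : 0 < γ) (hp0 : 0 < p) (hp : (p : ℝ) = ρ * N)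
    (h : BetheSol ρ γ N p t x s u l) :
    x ∈ Icc (ρ * Real.log (2 * (Real.exp γ - 1))) (Real.log (2 * Real.exp γ + 2)) := by
  have hpos : 0 < 2 * (Real.exp γ - 1) := by linarith [Real.one_lt_exp_iff.2 hγ]
  refine ⟨?_, (Real.le_log_iff_exp_le (by positivity)).2 (h.exp_le hρ0 hρ1 hp0 hp)⟩
  rw [← le_div_iff₀' hρ0, Real.log_le_iff_le_exp hpos]
  linarith [h.exp_ge hρ0 hρ1 hp0 hp]

theorem eq_mul_log_rStar (hρ0 : 0 < ρ) (hρ1 : ρ < 1) (hγ : 0 < γ)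
    (h : ∫ y in (0 : ℝ)..1, (logHalf (logCoordInv ρ (arcPoint ρ x' y))).re = γ) :
    x' = ρ * Real.log (rStar ρ γ) := by
  obtain ⟨hr, hrγ⟩ := rStar_spec hρ0 hρ1 hγ
  have hcrit : critLogMod ρ < x' := by
    by_contra! hle
    rw [integral_logHalf_arcPoint_of_le hρ0 hρ1 hle] at h
    exact hγ.ne h
  rw [integral_logHalf_arcPoint_of_gt hρ0 hρ1 hcrit] at h
  exact (strictMonoOn_consistency hρ0 hρ1).injOn hcrit (critLogMod_lt_mul_log hρ0 hρ1 hr)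
    (h.trans hrγ.symm)

theorem tendsto_logMod_of_betheSol [L.IsCountablyGenerated] (hρ0 : 0 < ρ) (hρ1 : ρ < 1)
    (hγ : 0 < γ) (hT : ThermodynamicLimit ρ L N p)
    (h : ∀ᶠ k in L, BetheSol ρ γ (N k) (p k) (lastMoved (p k) (e k)) (x k) (s k) (u k) (l k)) :
    Tendsto x L (𝓝 (ρ * Real.log (rStar ρ γ))) := by
  refine isCompact_Icc.tendsto_nhds_of_unique_mapClusterPt
    (s := Icc (ρ * Real.log (2 * (Real.exp γ - 1))) (Real.log (2 * Real.exp γ + 2))) ?_ ?_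
  · filter_upwards [h, hT.eventually_particles_pos hρ0] with k hk hk0
    exact hk.logMod_mem_Icc hρ0 hρ1 hγ hk0 (hT.particles_eq k)
  · intro x' _ hx'
    have : (L ⊓ comap x (𝓝 x')).NeBot := by
      rwa [← map_neBot_iff x, Filter.push_pull, inf_comm]
    exact eq_mul_log_rStar hρ0 hρ1 hγ (integral_logHalf_arcPoint_eq_of_tendsto hρ0 hρ1
      (hT.comp (tendsto_id'.2 inf_le_left)) (h.filter_mono inf_le_left)
      (tendsto_comap.mono_left inf_le_right))

end ThermodynamicLimit

/-! ### Riemann sums over equidistant nodes -/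

theorem norm_smul_sub_image_sub_le {𝕜 E : Type*} [RCLike 𝕜] [NormedAddCommGroup E] [NormedSpace 𝕜 E]
    {B : Set 𝕜} {Q q : 𝕜 → E} {K : NNReal} {a v : 𝕜} (hB : Convex ℝ B)
    (hQ : ∀ ζ ∈ B, HasDerivWithinAt Q (q ζ) B ζ) (hq : LipschitzOnWith K q B)
    (hsub : a - v ∈ B) (hadd : a + v ∈ B) :
    ‖(2 * v) • q a - (Q (a + v) - Q (a - v))‖ ≤ 2 * K * ‖v‖ ^ 2 := by
  have hsegment : segment ℝ (a - v) (a + v) ⊆ B := hB.segment_subset hsub hadd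
  have hball : segment ℝ (a - v) (a + v) ⊆ Metric.closedBall a ‖v‖ :=
    (convex_closedBall a ‖v‖).segment_subset (by simp) (by simp)
  have ha : a ∈ segment ℝ (a - v) (a + v) := by
    have := midpoint_mem_segment (𝕜 := ℝ) (a - v) (a + v)
    rwa [midpoint_sub_add] at this
  have hbound := Convex.norm_image_sub_le_of_norm_hasDerivWithin_le
    (f := fun ζ => Q ζ - ζ • q a) (f' := fun ζ => q ζ - q a) (C := K * ‖v‖)
    (fun ζ hζ => ((hQ ζ (hsegment hζ)).mono hsegment).sub
      (by simpa using (hasDerivWithinAt_id ζ _).smul_const (q a)))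
    (fun ζ hζ => (hq.norm_sub_le (hsegment hζ) (hsegment ha)).trans
      (by gcongr; simpa [dist_eq_norm] using hball hζ))
    (convex_segment (a - v) (a + v)) (left_mem_segment ℝ _ _) (right_mem_segment ℝ _ _)
  have hdiff : a + v - (a - v) = 2 * v := by ring
  calc ‖(2 * v) • q a - (Q (a + v) - Q (a - v))‖
      = ‖Q (a + v) - (a + v) • q a - (Q (a - v) - (a - v) • q a)‖ := by
        rw [← hdiff, ← norm_neg, sub_smul]
        congr 1
        abel
    _ ≤ K * ‖v‖ * ‖a + v - (a - v)‖ := hbound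
    _ = 2 * K * ‖v‖ ^ 2 := by
        rw [hdiff, norm_mul, RCLike.norm_ofNat]
        ring

/-- The sum of `f` over the midpoints of the `p` cells of length `2π / N` that partition the
vertical segment `σ + i [-π p / N, π p / N]`. -/
noncomputable def nodeSum (N p : ℕ) (f : ℂ → ℂ) (σ : ℂ) : ℂ :=
  ∑ i ∈ Finset.range p, f (σ + betheAngle N p (i + 1 / 2) * I)

/-- A closed rectangle around the vertical segment `x + i [-ρ π, ρ π]`. -/
def levelRect (ρ x δ : ℝ) : Set ℂ :=
  Icc (x - δ) (x + δ) ×ℂ Icc (-(ρ * π + δ)) (ρ * π + δ)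

/-- The limit of `nodeSum N p q σ / N` for `Q' = q` and `p = ρ N`: the average slope of `Q` between
the ends of the vertical segment `σ + i [-ρ π, ρ π]`, times the density `ρ`. -/
noncomputable def levelSlope (ρ : ℝ) (Q : ℂ → ℂ) (σ : ℂ) : ℂ :=
  (Q (σ + (ρ * π : ℝ) * I) - Q (σ - (ρ * π : ℝ) * I)) / (2 * π * I)

section NodeSum

open Asymptotics

theorem betheAngle_add (N p : ℕ) (t h : ℝ) :
    betheAngle N p (t + h) = betheAngle N p t + 2 * π / N * h := by
  rw [betheAngle, betheAngle]
  ring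

theorem norm_nodeSum_sub_le {B : Set ℂ} {Q q : ℂ → ℂ} {K : NNReal} {N p : ℕ} {σ : ℂ}
    (hB : Convex ℝ B) (hQ : ∀ ζ ∈ B, HasDerivAt Q (q ζ) ζ) (hq : LipschitzOnWith K q B)
    (hmem : ∀ i ≤ p, σ + betheAngle N p i * I ∈ B) :
    ‖(2 * π / N * I) * nodeSum N p q σ
      - (Q (σ + betheAngle N p p * I) - Q (σ + betheAngle N p 0 * I))‖
      ≤ p * (2 * K * (π / N) ^ 2) := by
  have hcell : ∀ i ∈ Finset.range p,
      ‖(2 * π / N * I) * q (σ + betheAngle N p (i + 1 / 2) * I)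
        - (Q (σ + betheAngle N p (i + 1 : ℕ) * I) - Q (σ + betheAngle N p i * I))‖
        ≤ 2 * K * (π / N) ^ 2 := fun i hi => by
    have hsub : σ + betheAngle N p (i + 1 / 2) * I - π / N * I = σ + betheAngle N p i * I := by
      rw [betheAngle_add]
      push_cast
      ring
    have hadd : σ + betheAngle N p (i + 1 / 2) * I + π / N * I
        = σ + betheAngle N p (i + 1 : ℕ) * I := by
      rw [betheAngle_add, Nat.cast_add, Nat.cast_one, betheAngle_add]
      push_cast
      ring
    have hi := Finset.mem_range.1 hi
    have hnorm : ‖(π / N * I : ℂ)‖ = π / N := by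
      rw [norm_mul, Complex.norm_I, mul_one, norm_div, Complex.norm_natCast,
        Complex.norm_of_nonneg Real.pi_pos.le]
    have hbound := norm_smul_sub_image_sub_le hB (fun ζ hζ => (hQ ζ hζ).hasDerivWithinAt) hq
      (hsub ▸ hmem i hi.le) (hadd ▸ hmem (i + 1) hi)
    rw [hsub, hadd, hnorm, smul_eq_mul] at hbound
    rwa [mul_div_assoc, mul_assoc 2 (π / N : ℂ)]
  have hsum := norm_sum_le_of_le _ hcell
  rw [Finset.sum_sub_distrib, ← Finset.mul_sum,
    Finset.sum_range_sub fun i : ℕ => Q (σ + betheAngle N p i * I), Finset.sum_const,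
    Finset.card_range, nsmul_eq_mul, Nat.cast_zero] at hsum
  exact hsum

variable {ρ x δ : ℝ} {σ : ℂ}

theorem betheAngle_zero {N p : ℕ} (hN : 0 < N) (hp : (p : ℝ) = ρ * N) :
    betheAngle N p 0 = -(ρ * π) := by
  have : (N : ℝ) ≠ 0 := mod_cast hN.ne'
  rw [betheAngle, hp]
  field_simp
  ring

theorem betheAngle_self {N p : ℕ} (hN : 0 < N) (hp : (p : ℝ) = ρ * N) :
    betheAngle N p p = ρ * π := by
  have : (N : ℝ) ≠ 0 := mod_cast hN.ne'
  rw [betheAngle, hp]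
  field_simp
  ring

theorem betheAngle_mono (N p : ℕ) : Monotone (betheAngle N p) := fun s t hst => by
  unfold betheAngle
  gcongr

theorem abs_betheAngle_le {N p : ℕ} {t : ℝ} (hN : 0 < N) (hp : (p : ℝ) = ρ * N)
    (ht : t ∈ Icc (0 : ℝ) p) : |betheAngle N p t| ≤ ρ * π :=
  abs_le.2 ⟨betheAngle_zero hN hp ▸ betheAngle_mono N p ht.1,
    betheAngle_self hN hp ▸ betheAngle_mono N p ht.2⟩

theorem conj_levelPoint (ρ x : ℝ) : conj (levelPoint ρ x) = x - (ρ * π : ℝ) * I := by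
  rw [levelPoint]
  simp [sub_eq_add_neg]

theorem convex_levelRect (ρ x δ : ℝ) : Convex ℝ (levelRect ρ x δ) :=
  ((convex_Icc _ _).linear_preimage Complex.reCLM.toLinearMap).inter
    ((convex_Icc _ _).linear_preimage Complex.imCLM.toLinearMap)

theorem isCompact_levelRect (ρ x δ : ℝ) : IsCompact (levelRect ρ x δ) :=
  isCompact_Icc.reProdIm isCompact_Icc

theorem mem_levelRect {ψ : ℝ} (hσ : ‖σ - x‖ ≤ δ) (hψ : |ψ| ≤ ρ * π) :
    σ + ψ * I ∈ levelRect ρ x δ := by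
  have hre := (Complex.abs_re_le_norm _).trans hσ
  have him := (Complex.abs_im_le_norm _).trans hσ
  simp only [Complex.sub_re, Complex.sub_im, Complex.ofReal_re, Complex.ofReal_im, sub_zero,
    abs_le] at hre him hψ
  obtain ⟨hre₁, hre₂⟩ := hre
  obtain ⟨him₁, him₂⟩ := him
  obtain ⟨hψ₁, hψ₂⟩ := hψ
  constructor <;> constructor <;> simp <;> linarith

theorem exists_levelRect_subset (hρ0 : 0 < ρ) (hρ1 : ρ < 1) (hx : critLogMod ρ < x) :
    ∃ δ > 0, levelRect ρ x δ ⊆ logCoordImage ρ := by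
  have hπ := mul_pos (sub_pos.2 hρ1) Real.pi_pos
  refine ⟨min ((x - critLogMod ρ) / 2) ((1 - ρ) * π / 2), lt_min (by linarith) (by linarith),
    fun ζ hζ => ?_⟩
  obtain ⟨⟨hre, -⟩, him⟩ := hζ
  have hδ₁ := min_le_left ((x - critLogMod ρ) / 2) ((1 - ρ) * π / 2)
  have hδ₂ := min_le_right ((x - critLogMod ρ) / 2) ((1 - ρ) * π / 2)
  have habs := abs_le.2 him
  exact notchedStrip_subset_logCoordImage hρ0 hρ1 (Or.inr ⟨by linarith, by linarith⟩)

theorem exists_lipschitzOnWith_of_hasDerivAt {U B : Set ℂ} {Q q : ℂ → ℂ} (hU : IsOpen U)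
    (hBU : B ⊆ U) (hB : Convex ℝ B) (hBc : IsCompact B) (hQ : ∀ ζ ∈ U, HasDerivAt Q (q ζ) ζ) :
    ∃ K, LipschitzOnWith K q B := by
  have hQd : DifferentiableOn ℂ Q U := fun ζ hζ => (hQ ζ hζ).differentiableAt.differentiableWithinAt
  have hq : DifferentiableOn ℂ q U :=
    (hQd.deriv hU).congr fun ζ hζ => (hQ ζ hζ).deriv.symm
  exact ((hq.contDiffOn hU (n := 1)).restrict_scalars ℝ |>.mono hBU).exists_lipschitzOnWith
    one_ne_zero hB hBc

variable {ι : Type*} {L : Filter ι} {N p : ι → ℕ} {σ τ : ι → ℂ} {Q q : ℂ → ℂ}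

theorem nodeSum_sub_isBigO_one (hρ0 : 0 < ρ) (hρ1 : ρ < 1) (hx : critLogMod ρ < x)
    (hQ : ∀ ζ ∈ logCoordImage ρ, HasDerivAt Q (q ζ) ζ) (hT : ThermodynamicLimit ρ L N p)
    (hσ : Tendsto σ L (𝓝 x)) :
    (fun k => nodeSum (N k) (p k) q (σ k) - N k * levelSlope ρ Q (σ k)) =O[L] fun _ => (1 : ℝ) := by
  obtain ⟨δ, hδ0, hδ⟩ := exists_levelRect_subset hρ0 hρ1 hx
  obtain ⟨K, hK⟩ := exists_lipschitzOnWith_of_hasDerivAt (isOpen_logCoordImage hρ0) hδ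
    (convex_levelRect ρ x δ) (isCompact_levelRect ρ x δ) hQ
  refine .of_bound (K * ρ * π) ?_
  filter_upwards [hσ.eventually (Metric.closedBall_mem_nhds _ hδ0), hT.eventually_sites_pos]
    with k hkσ hkN
  have hN : (N k : ℝ) ≠ 0 := mod_cast hkN.ne'
  have hNc : (N k : ℂ) ≠ 0 := mod_cast hkN.ne'
  have hp := hT.particles_eq k
  have hsum := norm_nodeSum_sub_le (N := N k) (p := p k) (σ := σ k) (convex_levelRect ρ x δ)
    (fun ζ hζ => hQ ζ (hδ hζ)) hK fun i hi => mem_levelRect (mem_closedBall_iff_norm.1 hkσ)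
      (abs_betheAngle_le hkN hp ⟨i.cast_nonneg, mod_cast hi⟩)
  rw [betheAngle_zero hkN hp, betheAngle_self hkN hp, Complex.ofReal_neg, neg_mul,
    ← sub_eq_add_neg] at hsum
  set D := Q (σ k + (ρ * π : ℝ) * I) - Q (σ k - (ρ * π : ℝ) * I) with hD
  have hfactor : nodeSum (N k) (p k) q (σ k) - N k * levelSlope ρ Q (σ k)
      = N k / (2 * π * I) * ((2 * π / N k * I) * nodeSum (N k) (p k) q (σ k) - D) := by
    rw [levelSlope, ← hD]
    field_simp
  have hnorm : ‖(N k / (2 * π * I) : ℂ)‖ = N k / (2 * π) := by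
    simp [abs_of_pos Real.pi_pos]
  rw [hfactor, norm_mul, hnorm, norm_one, mul_one]
  calc _ ≤ N k / (2 * π) * (p k * (2 * K * (π / N k) ^ 2)) := by gcongr
    _ = K * ρ * π := by
      rw [hp]
      field_simp

theorem tendsto_levelSlope (hρ0 : 0 < ρ) (hρ1 : ρ < 1) (hx : critLogMod ρ < x)
    (hQ : ContinuousOn Q (logCoordImage ρ)) (hσ : Tendsto σ L (𝓝 x)) :
    Tendsto (fun k => levelSlope ρ Q (σ k)) L (𝓝 (levelSlope ρ Q x)) := by
  have htop := levelPoint_mem hρ0 hρ1 hx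
  have hbot := conj_mem_logCoordImage htop
  rw [levelPoint] at htop
  rw [conj_levelPoint] at hbot
  have hopen := isOpen_logCoordImage hρ0
  exact (((hQ.continuousAt (hopen.mem_nhds htop)).tendsto.comp (hσ.add_const _)).sub
    ((hQ.continuousAt (hopen.mem_nhds hbot)).tendsto.comp (hσ.sub_const _))).div_const _

theorem tendsto_nodeSum_div (hρ0 : 0 < ρ) (hρ1 : ρ < 1) (hx : critLogMod ρ < x)
    (hQ : ∀ ζ ∈ logCoordImage ρ, HasDerivAt Q (q ζ) ζ) (hT : ThermodynamicLimit ρ L N p)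
    (hσ : Tendsto σ L (𝓝 x)) :
    Tendsto (fun k => nodeSum (N k) (p k) q (σ k) / N k) L (𝓝 (levelSlope ρ Q x)) := by
  have hinv : Tendsto (fun k => (N k : ℂ)⁻¹) L (𝓝 0) :=
    (tendsto_inv_atTop_nhds_zero_nat (𝕜 := ℂ)).comp hT.tendsto_sites
  have hremainder := (nodeSum_sub_isBigO_one hρ0 hρ1 hx hQ hT hσ).mul_isLittleO
    ((isLittleO_one_iff ℝ).2 hinv)
  simp only [mul_one, isLittleO_one_iff] at hremainder
  have hlim := hremainder.add (tendsto_levelSlope hρ0 hρ1 hx (HasDerivAt.continuousOn hQ) hσ)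
  rw [zero_add] at hlim
  refine hlim.congr' ?_
  filter_upwards [hT.eventually_sites_pos] with k hk
  have : (N k : ℂ) ≠ 0 := mod_cast hk.ne'
  field_simp
  ring

theorem hasDerivAt_nodeSum {N p : ℕ} {σ : ℂ}
    (hQ : ∀ i < p, DifferentiableAt ℂ Q (σ + betheAngle N p (i + 1 / 2) * I)) :
    HasDerivAt (nodeSum N p Q) (nodeSum N p (deriv Q) σ) σ :=
  HasDerivAt.fun_sum fun i hi => (hQ i (Finset.mem_range.1 hi)).hasDerivAt.comp_add_const σ _

theorem eventually_norm_nodeSum_deriv_sub_le (hρ0 : 0 < ρ) (hρ1 : ρ < 1) (hx : critLogMod ρ < x)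
    (hQ : DifferentiableOn ℂ Q (logCoordImage ρ)) (hT : ThermodynamicLimit ρ L N p) {ε : ℝ}
    (hε : 0 < ε) :
    ∃ δ > 0, ∀ᶠ k in L, ∀ ξ ∈ Metric.ball (x : ℂ) δ,
      ‖nodeSum (N k) (p k) (deriv Q) ξ - N k * levelSlope ρ Q x‖ ≤ ε * N k := by
  have hderiv : ∀ ζ ∈ logCoordImage ρ, HasDerivAt Q (deriv Q ζ) ζ := fun ζ hζ =>
    (hQ.differentiableAt ((isOpen_logCoordImage hρ0).mem_nhds hζ)).hasDerivAt
  have hlim := tendsto_nodeSum_div hρ0 hρ1 hx hderiv (hT.comp tendsto_fst)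
    (tendsto_snd (f := L) (g := 𝓝 (x : ℂ)))
  obtain ⟨good, hgood, near, hnear, hclose⟩ :=
    eventually_prod_iff.1 (hlim.eventually (Metric.closedBall_mem_nhds _ hε))
  obtain ⟨δ, hδ0, hδ⟩ := Metric.eventually_nhds_iff_ball.1 hnear
  refine ⟨δ, hδ0, ?_⟩
  filter_upwards [hgood, hT.eventually_sites_pos] with k hk hkN ξ hξ
  have hN : (N k : ℂ) ≠ 0 := mod_cast hkN.ne'
  have hbound := mem_closedBall_iff_norm.1 (hclose hk (hδ ξ hξ))
  simp only [Function.comp_apply] at hbound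
  rwa [← mul_div_cancel₀ (nodeSum _ _ _ ξ) hN, ← mul_sub, norm_mul,
    Complex.norm_natCast, mul_comm ε, mul_le_mul_iff_right₀ (mod_cast hkN)]

theorem nodeSum_sub_isLittleO (hρ0 : 0 < ρ) (hρ1 : ρ < 1) (hx : critLogMod ρ < x)
    (hQ : DifferentiableOn ℂ Q (logCoordImage ρ)) (hT : ThermodynamicLimit ρ L N p)
    (hσ : Tendsto σ L (𝓝 x)) (hτ : Tendsto τ L (𝓝 x)) :
    (fun k => nodeSum (N k) (p k) Q (σ k) - nodeSum (N k) (p k) Q (τ k)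
      - N k * levelSlope ρ Q x * (σ k - τ k)) =o[L] fun k => N k * (σ k - τ k) := by
  obtain ⟨δ, hδ0, hδ⟩ := exists_levelRect_subset hρ0 hρ1 hx
  refine isLittleO_iff.2 fun ε hε => ?_
  obtain ⟨η, hη0, hη⟩ := eventually_norm_nodeSum_deriv_sub_le hρ0 hρ1 hx hQ hT hε
  set D := levelSlope ρ Q x
  have hball := Metric.ball_mem_nhds (x : ℂ) (lt_min hδ0 hη0)
  filter_upwards [hσ.eventually hball, hτ.eventually hball, hη, hT.eventually_sites_pos]
    with k hkσ hkτ hkη hkN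
  have hderiv : ∀ ξ ∈ Metric.ball (x : ℂ) (min δ η),
      HasDerivAt (fun ξ => nodeSum (N k) (p k) Q ξ - N k * D * ξ)
        (nodeSum (N k) (p k) (deriv Q) ξ - N k * D) ξ := fun ξ hξ => by
    refine (hasDerivAt_nodeSum fun i hi => hQ.differentiableAt
      ((isOpen_logCoordImage hρ0).mem_nhds (hδ (mem_levelRect ?_ ?_)))).sub
      (by simpa using (hasDerivAt_id ξ).const_mul (N k * D))
    · exact (mem_ball_iff_norm.1 hξ).le.trans (min_le_left δ η)
    · have : (i : ℝ) + 1 ≤ p k := mod_cast hi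
      exact abs_betheAngle_le hkN (hT.particles_eq k) ⟨by positivity, by linarith⟩
  have hbound := (convex_ball (x : ℂ) (min δ η)).norm_image_sub_le_of_norm_hasDerivWithin_le
    (fun ξ hξ => (hderiv ξ hξ).hasDerivWithinAt)
    (fun ξ hξ => hkη ξ (Metric.ball_subset_ball (min_le_right δ η) hξ)) hkτ hkσ
  rw [norm_mul, Complex.norm_natCast, ← mul_assoc]
  refine le_of_eq_of_le ?_ hbound
  congr 1
  ring

theorem levelSlope_ofReal (hρ0 : 0 < ρ) (hρ1 : ρ < 1) (hx : critLogMod ρ < x)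
    (hQ : ∀ ζ ∈ logCoordImage ρ, Q (conj ζ) = conj (Q ζ)) :
    levelSlope ρ Q x = ((Q (levelPoint ρ x)).im / π : ℝ) := by
  have hπ : (π : ℂ) ≠ 0 := mod_cast Real.pi_ne_zero
  rw [levelSlope, ← conj_levelPoint, ← levelPoint, hQ _ (levelPoint_mem hρ0 hρ1 hx),
    Complex.sub_conj]
  push_cast
  field_simp

theorem nodeSum_sub_isLittleO_nodeSum_sub {P : ℂ → ℂ} (hρ0 : 0 < ρ) (hρ1 : ρ < 1)
    (hx : critLogMod ρ < x) (hP : DifferentiableOn ℂ P (logCoordImage ρ))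
    (hQ : DifferentiableOn ℂ Q (logCoordImage ρ)) (hslope : levelSlope ρ P x ≠ 0)
    (hT : ThermodynamicLimit ρ L N p) (hσ : Tendsto σ L (𝓝 x)) (hτ : Tendsto τ L (𝓝 x)) :
    (fun k => nodeSum (N k) (p k) Q (σ k) - nodeSum (N k) (p k) Q (τ k)
      - levelSlope ρ Q x / levelSlope ρ P x
        * (nodeSum (N k) (p k) P (σ k) - nodeSum (N k) (p k) P (τ k)))
      =o[L] fun k => nodeSum (N k) (p k) P (σ k) - nodeSum (N k) (p k) P (τ k) := by
  have hPo := nodeSum_sub_isLittleO hρ0 hρ1 hx hP hT hσ hτ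
  have hQo := nodeSum_sub_isLittleO hρ0 hρ1 hx hQ hT hσ hτ
  have hstep : (fun k => N k * (σ k - τ k))
      =O[L] fun k => nodeSum (N k) (p k) P (σ k) - nodeSum (N k) (p k) P (τ k) := by
    have hequiv : (fun k => nodeSum (N k) (p k) P (σ k) - nodeSum (N k) (p k) P (τ k))
        ~[L] fun k => levelSlope ρ P x * (N k * (σ k - τ k)) := by
      refine IsLittleO.isEquivalent (((isLittleO_const_mul_right_iff hslope).2 hPo).congr_left
        fun k => ?_)
      simp only [Pi.sub_apply]
      ring
    exact (isBigO_self_const_mul hslope _ L).trans hequiv.isBigO_symm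
  refine ((hQo.sub (hPo.const_mul_left (levelSlope ρ Q x / levelSlope ρ P x))).trans_isBigO
    hstep).congr_left fun k => ?_
  field_simp
  ring

end NodeSum

/-! ### The logarithmic Bethe equations -/

section NodeEquations

open Asymptotics

variable {ρ γ x s : ℝ} {N p e : ℕ} {σ ζ l : ℂ} {u : ℕ → ℂ} {f : ℂ → ℂ}

theorem abs_betheAngle_lt_pi (hpN : p + 2 < N) {t : ℝ} (ht : t ∈ Icc (0 : ℝ) (p + 1)) :
    |betheAngle N p t| < π := by
  have hN : (0 : ℝ) < N := mod_cast (by omega : 0 < N)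
  have hpN : (p : ℝ) + 2 < N := mod_cast hpN
  obtain ⟨ht0, ht1⟩ := ht
  rw [betheAngle, abs_mul, abs_of_pos (div_pos Real.pi_pos hN), div_mul_eq_mul_div, div_lt_iff₀ hN]
  have := Real.pi_pos
  gcongr
  rw [abs_lt]
  constructor <;> linarith

/-- The centre of the nodes belonging to a solution with modulus `x` and phase `s`. -/
noncomputable def nodeCentre (N : ℕ) (x s : ℝ) : ℂ := x + (2 * π / N * (s - 1 / 2) : ℝ) * I

theorem nodeCentre_add (N p : ℕ) (x s t : ℝ) :
    nodeCentre N x s + betheAngle N p (t + 1 / 2) * I = x + betheAngle N p (t + s) * I := by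
  rw [nodeCentre, betheAngle, betheAngle]
  push_cast
  ring

theorem lastMoved_mem_Icc (he : e ≤ 1) {i : ℕ} (hi : i < p) :
    (lastMoved p e i : ℝ) ∈ Icc (0 : ℝ) p := by
  have h : lastMoved p e i ∈ Icc (0 : ℤ) p := by
    rw [lastMoved]
    split_ifs <;> constructor <;> omega
  exact ⟨mod_cast h.1, mod_cast h.2⟩

theorem BetheSol.node_mem (hpN : p + 2 < N) (he : e ≤ 1) (hx : critLogMod ρ < x)
    (h : BetheSol ρ γ N p (lastMoved p e) x s u l) {i : ℕ} (hi : i < p) :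
    nodeCentre N x s + betheAngle N p (lastMoved p e i + 1 / 2) * I ∈ notchedStrip ρ := by
  obtain ⟨hs0, hs1⟩ := h.phase_mem
  obtain ⟨ht0, ht1⟩ := lastMoved_mem_Icc he hi
  rw [nodeCentre_add]
  refine Or.inr ?_
  simpa using ⟨hx, abs_betheAngle_lt_pi hpN ⟨by linarith, by linarith⟩⟩

theorem BetheSol.eq_logCoordInv_node (hρ0 : 0 < ρ) (hρ1 : ρ < 1) (hpN : p + 2 < N) (he : e ≤ 1)
    (hx : critLogMod ρ < x) (h : BetheSol ρ γ N p (lastMoved p e) x s u l) {i : ℕ} (hi : i < p) :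
    u i = logCoordInv ρ (nodeCentre N x s + betheAngle N p (lastMoved p e i + 1 / 2) * I) := by
  have hmem := h.node_mem hpN he hx hi
  rw [nodeCentre_add] at hmem ⊢
  exact (h.root i hi).eq_logCoordInv hρ0 hρ1 hmem

/-- The change of `nodeSum N p f σ` when the last node is moved up by `e` steps. -/
noncomputable def lastStep (N p e : ℕ) (f : ℂ → ℂ) (σ : ℂ) : ℂ :=
  f (σ + betheAngle N p (p + e - 1 / 2) * I) - f (σ + betheAngle N p (p - 1 / 2) * I)

theorem lastStep_zero (N p : ℕ) (f : ℂ → ℂ) (σ : ℂ) : lastStep N p 0 f σ = 0 := by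
  rw [lastStep, Nat.cast_zero, add_zero, sub_self]

theorem sum_lastMoved (N e : ℕ) (hp0 : 0 < p) (f : ℂ → ℂ) (σ : ℂ) :
    ∑ i ∈ Finset.range p, f (σ + betheAngle N p (lastMoved p e i + 1 / 2) * I)
      = nodeSum N p f σ + lastStep N p e f σ := by
  obtain ⟨q, rfl⟩ : ∃ q, p = q + 1 := ⟨p - 1, by omega⟩
  have hinterior : ∀ i ∈ Finset.range q,
      f (σ + betheAngle N (q + 1) (lastMoved (q + 1) e i + 1 / 2) * I)
        = f (σ + betheAngle N (q + 1) (i + 1 / 2) * I) := fun i hi => by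
    rw [lastMoved_of_lt (by simpa using hi), Int.cast_natCast]
  have hmoved : (lastMoved (q + 1) e q : ℝ) + 1 / 2 = (q + 1 : ℕ) + e - 1 / 2 := by
    rw [lastMoved, if_pos rfl]
    push_cast
    ring
  have hlast : (q : ℝ) + 1 / 2 = (q + 1 : ℕ) - 1 / 2 := by
    push_cast
    ring
  rw [nodeSum, lastStep, Finset.sum_range_succ, Finset.sum_range_succ,
    Finset.sum_congr rfl hinterior, hmoved, hlast]
  ring

theorem betheAngle_reflect {i : ℕ} (hi : i < p) :
    betheAngle N p ((p - 1 - i : ℕ) + 1 / 2) = -betheAngle N p (i + 1 / 2) := by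
  rw [Nat.sub_sub, Nat.cast_sub (by omega), betheAngle, betheAngle]
  push_cast
  ring

theorem nodeSum_id (N p : ℕ) (σ : ℂ) : nodeSum N p id σ = p * σ := by
  have hsum : ∑ i ∈ Finset.range p, betheAngle N p (i + 1 / 2) = 0 := by
    have h := Finset.sum_range_reflect (fun i : ℕ => betheAngle N p (i + 1 / 2)) p
    rw [Finset.sum_congr rfl fun i hi => betheAngle_reflect (Finset.mem_range.1 hi),
      Finset.sum_neg_distrib] at h
    linarith
  simp only [nodeSum, id, Finset.sum_add_distrib, ← Finset.sum_mul, ← Complex.ofReal_sum, hsum,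
    Finset.sum_const, Finset.card_range, nsmul_eq_mul, Complex.ofReal_zero, zero_mul, add_zero]

theorem lastStep_id (N p e : ℕ) (σ : ℂ) : lastStep N p e id σ = e * (2 * π / N) * I := by
  simp only [lastStep, id, betheAngle]
  push_cast
  ring

theorem exp_eq_neg_exp_nodeCentre (hN : N ≠ 0) (x s : ℝ) :
    Complex.exp (N * x + 2 * π * s * I) = -Complex.exp (N * nodeCentre N x s) := by
  have : (N : ℂ) ≠ 0 := mod_cast hN
  rw [← neg_one_mul, ← Complex.exp_pi_mul_I, ← Complex.exp_add, nodeCentre]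
  congr 1
  push_cast
  field_simp
  ring

theorem BetheSol.exp_sum_eq (hρ0 : 0 < ρ) (hN : N ≠ 0) {t : ℕ → ℤ}
    (h : BetheSol ρ γ N p t x s u l) :
    Complex.exp (N * (Real.log 2 : ℝ) + γ * N
      + ∑ i ∈ Finset.range p, (logCoord ρ (u i) - (Real.log 2 : ℝ) - logHalf (u i)) / ρ)
      = Complex.exp (N * nodeCentre N x s) := by
  have hprod := h.prod_eq
  have htwo : (2 : ℂ) ^ N = Complex.exp (N * (Real.log 2 : ℝ)) := by
    rw [Complex.exp_nat_mul, ← Complex.ofReal_exp, Real.exp_log two_pos, Complex.ofReal_ofNat]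
  rw [Finset.prod_congr rfl fun i hi => have hroot := h.root i (Finset.mem_range.1 hi)
      sub_one_div_add_one_eq_exp hρ0 hroot.ne_one hroot.ne_neg_one,
    exp_eq_neg_exp_nodeCentre hN, ← sub_eq_add_neg, sub_eq_zero] at hprod
  rw [Complex.exp_add, Complex.exp_add, Complex.exp_sum, ← htwo, ← hprod]
  push_cast
  rfl

theorem BetheSol.exists_int (hρ0 : 0 < ρ) (hρ1 : ρ < 1) (hpN : p + 2 < N) (hp0 : 0 < p)
    (hp : (p : ℝ) = ρ * N) (he : e ≤ 1) (hx : critLogMod ρ < x)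
    (h : BetheSol ρ γ N p (lastMoved p e) x s u l) :
    ∃ n : ℤ, p * γ + e * (2 * π / N) * I
      - (nodeSum N p (logHalf ∘ logCoordInv ρ) (nodeCentre N x s)
        + lastStep N p e (logHalf ∘ logCoordInv ρ) (nodeCentre N x s))
      = n * (2 * π * ρ) * I := by
  have hρ : (ρ : ℂ) ≠ 0 := mod_cast hρ0.ne'
  have hpc : (p : ℂ) = ρ * N := mod_cast hp
  have hroot : ∀ i ∈ Finset.range p, _ := fun i hi =>
    h.eq_logCoordInv_node hρ0 hρ1 hpN he hx (Finset.mem_range.1 hi)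
  have hlogHalf : ∑ i ∈ Finset.range p, logHalf (u i)
      = nodeSum N p (logHalf ∘ logCoordInv ρ) (nodeCentre N x s)
        + lastStep N p e (logHalf ∘ logCoordInv ρ) (nodeCentre N x s) := by
    rw [← sum_lastMoved N e hp0]
    exact Finset.sum_congr rfl fun i hi => congrArg logHalf (hroot i hi)
  have hlogCoord : ∑ i ∈ Finset.range p, logCoord ρ (u i)
      = p * nodeCentre N x s + e * (2 * π / N) * I := by
    rw [← nodeSum_id N, ← lastStep_id N p, ← sum_lastMoved N e hp0]
    refine Finset.sum_congr rfl fun i hi => ?_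
    rw [hroot i hi, logCoord_logCoordInv (notchedStrip_subset_logCoordImage hρ0 hρ1
      (h.node_mem hpN he hx (Finset.mem_range.1 hi))), id]
  obtain ⟨n, hn⟩ := Complex.exp_eq_exp_iff_exists_int.1 (h.exp_sum_eq hρ0 (by omega))
  rw [← Finset.sum_div, Finset.sum_sub_distrib, Finset.sum_sub_distrib, hlogHalf, hlogCoord,
    Finset.sum_const, Finset.card_range, nsmul_eq_mul, hpc, ← eq_sub_iff_add_eq', div_eq_iff hρ]
    at hn
  refine ⟨n, ?_⟩
  rw [hpc]
  linear_combination hn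

/-- The logarithm, in the principal branch, of the product equation of a solution whose last
position is moved up by `e`, together with its eigenvalue, in terms of the centre `σ` of the
nodes. -/
structure NodeSol (ρ γ : ℝ) (N p e : ℕ) (σ l : ℂ) : Prop where
  consistency_eq : nodeSum N p (logHalf ∘ logCoordInv ρ) σ
    + lastStep N p e (logHalf ∘ logCoordInv ρ) σ = p * γ + e * (2 * π / N) * I
  val_eq : l = 1 / 2 * (nodeSum N p (logCoordInv ρ) σ + lastStep N p e (logCoordInv ρ) σ - p)

theorem BetheSol.val_eq_nodeSum (hρ0 : 0 < ρ) (hρ1 : ρ < 1) (hpN : p + 2 < N) (hp0 : 0 < p)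
    (he : e ≤ 1) (hx : critLogMod ρ < x) (h : BetheSol ρ γ N p (lastMoved p e) x s u l) :
    l = 1 / 2 * (nodeSum N p (logCoordInv ρ) (nodeCentre N x s)
      + lastStep N p e (logCoordInv ρ) (nodeCentre N x s) - p) := by
  rw [h.val_eq, Finset.sum_sub_distrib, ← sum_lastMoved N e hp0, Finset.sum_congr rfl fun i hi =>
    h.eq_logCoordInv_node hρ0 hρ1 hpN he hx (Finset.mem_range.1 hi)]
  simp

theorem BetheSol.nodeSol (hρ0 : 0 < ρ) (hρ1 : ρ < 1) (hpN : p + 2 < N) (hp0 : 0 < p)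
    (hp : (p : ℝ) = ρ * N) (he : e ≤ 1) (hx : critLogMod ρ < x)
    (h : BetheSol ρ γ N p (lastMoved p e) x s u l)
    (hsum : |(nodeSum N p (logHalf ∘ logCoordInv ρ) (nodeCentre N x s)).im| < ρ * π)
    (hstep : |e * (2 * π / N)
      - (lastStep N p e (logHalf ∘ logCoordInv ρ) (nodeCentre N x s)).im| < ρ * π) :
    NodeSol ρ γ N p e (nodeCentre N x s) l := by
  refine ⟨?_, h.val_eq_nodeSum hρ0 hρ1 hpN hp0 he hx⟩
  obtain ⟨n, hn⟩ := h.exists_int hρ0 hρ1 hpN hp0 hp he hx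
  -- The imaginary parts leave no room for a nonzero multiple of `2πρ`.
  have hn0 : n = 0 := by
    have hbound : |n * (2 * π * ρ)| < 1 * (2 * π * ρ) := by
      have him : (n * (2 * π * ρ) : ℝ) = e * (2 * π / N)
          - ((nodeSum N p (logHalf ∘ logCoordInv ρ) (nodeCentre N x s)).im
            + (lastStep N p e (logHalf ∘ logCoordInv ρ) (nodeCentre N x s)).im) := by
        simpa using (congrArg Complex.im hn).symm
      rw [abs_lt] at *
      obtain ⟨hsum₁, hsum₂⟩ := hsum
      obtain ⟨hstep₁, hstep₂⟩ := hstep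
      constructor <;> linarith
    have hpos : 0 < 2 * π * ρ := by positivity
    rw [abs_mul, abs_of_pos hpos, mul_lt_mul_iff_left₀ hpos] at hbound
    exact Int.abs_lt_one_iff.1 (mod_cast hbound)
  rw [hn0, Int.cast_zero, zero_mul, zero_mul] at hn
  linear_combination -hn

theorem hasDerivAt_logHalf_logCoordInv (hρ0 : 0 < ρ) (hρ1 : ρ < 1) (hζ : ζ ∈ logCoordImage ρ) :
    HasDerivAt (logHalf ∘ logCoordInv ρ)
      (1 / (logCoordInv ρ ζ + 1) * (logCoordDeriv ρ (logCoordInv ρ ζ))⁻¹) ζ :=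
  (hasDerivAt_logHalf (logCoordInv_mem hζ)).comp ζ (hasDerivAt_logCoordInv hρ0 hρ1 hζ)

theorem differentiableOn_logCoordInv (hρ0 : 0 < ρ) (hρ1 : ρ < 1) :
    DifferentiableOn ℂ (logCoordInv ρ) (logCoordImage ρ) := fun _ hζ =>
  (hasDerivAt_logCoordInv hρ0 hρ1 hζ).differentiableAt.differentiableWithinAt

theorem differentiableOn_logHalf_logCoordInv (hρ0 : 0 < ρ) (hρ1 : ρ < 1) :
    DifferentiableOn ℂ (logHalf ∘ logCoordInv ρ) (logCoordImage ρ) := fun _ hζ =>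
  (hasDerivAt_logHalf_logCoordInv hρ0 hρ1 hζ).differentiableAt.differentiableWithinAt

theorem logHalf_conj {w : ℂ} (hw : w + 1 ∈ slitPlane) : logHalf (conj w) = conj (logHalf w) := by
  have h := Complex.log_conj _ (Complex.slitPlane_arg_ne_pi hw)
  simp only [map_add, map_one] at h
  rw [logHalf, logHalf, h, map_sub, Complex.conj_ofReal]

theorem logHalf_logCoordInv_conj (hρ0 : 0 < ρ) (hρ1 : ρ < 1) (hζ : ζ ∈ logCoordImage ρ) :
    (logHalf ∘ logCoordInv ρ) (conj ζ) = conj ((logHalf ∘ logCoordInv ρ) ζ) := by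
  simp only [Function.comp_apply, logCoordInv_conj hρ0 hρ1 hζ,
    logHalf_conj (add_one_mem_slitPlane (logCoordInv_mem hζ))]

theorem arg_levelPoint_lt (hρ0 : 0 < ρ) (hρ1 : ρ < 1) (hx : critLogMod ρ < x) :
    (logCoordInv ρ (levelPoint ρ x) + 1).arg < ρ * π := by
  have him := logCoord_im ρ (logCoordInv ρ (levelPoint ρ x))
  rw [logCoord_logCoordInv (levelPoint_mem hρ0 hρ1 hx), levelPoint_im] at him
  nlinarith [arg_add_one_lt_arg_sub_one (logCoordInv_levelPoint_im_pos hρ0 hρ1 hx)]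

theorem arg_levelPoint_pos (hρ0 : 0 < ρ) (hρ1 : ρ < 1) (hx : critLogMod ρ < x) :
    0 < (logCoordInv ρ (levelPoint ρ x) + 1).arg :=
  arg_pos_of_im_pos (by simpa using logCoordInv_levelPoint_im_pos hρ0 hρ1 hx)

theorem im_nodeSum_ofReal (hρ0 : 0 < ρ) (hρ1 : ρ < 1) (hN : 0 < N) (hp : (p : ℝ) = ρ * N)
    (hx : critLogMod ρ < x) (hf : ∀ ζ ∈ logCoordImage ρ, f (conj ζ) = conj (f ζ)) :
    (nodeSum N p f x).im = 0 := by
  rw [← Complex.conj_eq_iff_im, nodeSum, map_sum, ← Finset.sum_range_reflect]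
  refine Finset.sum_congr rfl fun i hi => ?_
  have hi := Finset.mem_range.1 hi
  have hip : (i : ℝ) + 1 ≤ p := mod_cast hi
  have hangle := abs_betheAngle_le hN hp (t := i + 1 / 2) ⟨by positivity, by linarith⟩
  have hmem : (x + betheAngle N p (i + 1 / 2) * I : ℂ) ∈ logCoordImage ρ := by
    refine notchedStrip_subset_logCoordImage hρ0 hρ1 (Or.inr ⟨by simpa using hx, ?_⟩)
    have hlt := hangle.trans_lt (mul_lt_of_lt_one_left Real.pi_pos hρ1)
    simpa using hlt
  have hreflect : (x + betheAngle N p ((p - 1 - i : ℕ) + 1 / 2) * I : ℂ)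
      = conj (x + betheAngle N p (i + 1 / 2) * I) := by
    rw [betheAngle_reflect hi]
    simp
  rw [hreflect, hf _ hmem, Complex.conj_conj]

end NodeEquations

/-! ### The thermodynamic limit of the eigenvalues -/

section Asymptotics

open Asymptotics

variable {ι : Type*} {ρ γ x : ℝ} {L : Filter ι} {N p : ι → ℕ} {e : ℕ} {σ l : ι → ℂ}
  {y s : ι → ℝ} {u : ι → ℕ → ℂ} {f : ℂ → ℂ}

theorem tendsto_add_betheAngle_mul_I (hT : ThermodynamicLimit ρ L N p) (hσ : Tendsto σ L (𝓝 x))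
    (c : ℝ) :
    Tendsto (fun k => σ k + betheAngle (N k) (p k) (p k + c) * I) L (𝓝 (levelPoint ρ x)) := by
  have hstep : Tendsto (fun k => 2 * π / N k * c) L (𝓝 0) := by
    simpa using (tendsto_const_nhds.div_atTop hT.tendsto_cast_sites).mul_const c
  have hangle : Tendsto (fun k => betheAngle (N k) (p k) (p k + c)) L (𝓝 (ρ * π)) := by
    refine ((tendsto_const_nhds (x := ρ * π)).add hstep |>.congr' ?_).trans (by rw [add_zero])
    filter_upwards [hT.eventually_sites_pos] with k hk
    rw [betheAngle_add, betheAngle_self hk (hT.particles_eq k)]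
  exact hσ.add (((Complex.continuous_ofReal.tendsto _).comp hangle).mul_const I)

theorem tendsto_lastStep (hρ0 : 0 < ρ) (hρ1 : ρ < 1) (hx : critLogMod ρ < x)
    (hf : ContinuousOn f (logCoordImage ρ)) (hT : ThermodynamicLimit ρ L N p)
    (hσ : Tendsto σ L (𝓝 x)) (e : ℕ) :
    Tendsto (fun k => lastStep (N k) (p k) e f (σ k)) L (𝓝 0) := by
  have hcont := hf.continuousAt ((isOpen_logCoordImage hρ0).mem_nhds (levelPoint_mem hρ0 hρ1 hx))
  have hlim := (hcont.tendsto.comp (tendsto_add_betheAngle_mul_I hT hσ (e - 1 / 2))).sub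
    (hcont.tendsto.comp (tendsto_add_betheAngle_mul_I hT hσ (-(1 / 2))))
  simpa only [Function.comp_def, lastStep, sub_self, ← sub_eq_add_neg, ← add_sub_assoc] using hlim

theorem tendsto_mul_lastStep (hρ0 : 0 < ρ) (hρ1 : ρ < 1) (hx : critLogMod ρ < x)
    (hf : DifferentiableOn ℂ f (logCoordImage ρ)) (hT : ThermodynamicLimit ρ L N p)
    (hσ : Tendsto σ L (𝓝 x)) (e : ℕ) :
    Tendsto (fun k => N k * lastStep (N k) (p k) e f (σ k)) L
      (𝓝 (e * (2 * π) * I * deriv f (levelPoint ρ x))) := by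
  have hderiv := ((hf.analyticOnNhd (isOpen_logCoordImage hρ0)) _
    (levelPoint_mem hρ0 hρ1 hx)).hasStrictDerivAt
  have hdiff := hderiv.hasStrictFDerivAt.isLittleO.comp_tendsto
    ((tendsto_add_betheAngle_mul_I hT hσ (e - 1 / 2)).prodMk_nhds
      (tendsto_add_betheAngle_mul_I hT hσ (-(1 / 2))))
  have hmul := (isBigO_refl (fun k => (N k : ℂ)) L).mul_isLittleO hdiff
  have hscaled : (fun k => N k * lastStep (N k) (p k) e f (σ k)
      - e * (2 * π) * I * deriv f (levelPoint ρ x)) =o[L] fun _ => (e * (2 * π) * I : ℂ) := by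
    refine hmul.congr' ?_ ?_ <;> filter_upwards [hT.eventually_sites_pos] with k hk <;>
      have hN : (N k : ℂ) ≠ 0 := mod_cast hk.ne' <;>
      have hnodes := lastStep_id (N k) (p k) e (σ k) <;>
      simp only [lastStep, id, Function.comp_apply, ContinuousLinearMap.toSpanSingleton_apply,
        ← sub_eq_add_neg, ← add_sub_assoc] at hnodes ⊢ <;>
      rw [hnodes]
    · simp only [smul_eq_mul]
      field_simp
    · field_simp
  have hzero := (isLittleO_one_iff ℝ).1 (hscaled.trans_isBigO
    (isBigO_const_const _ one_ne_zero _))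
  simpa using hzero.add_const (e * (2 * π) * I * deriv f (levelPoint ρ x))

theorem tendsto_nodeCentre (hT : ThermodynamicLimit ρ L N p) (hy : Tendsto y L (𝓝 x))
    (hs : ∀ᶠ k in L, s k ∈ Icc (0 : ℝ) 1) :
    Tendsto (fun k => nodeCentre (N k) (y k) (s k)) L (𝓝 x) := by
  have hshift : Tendsto (fun k => 2 * π / N k * (s k - 1 / 2)) L (𝓝 0) := by
    have hstep : Tendsto (fun k => 2 * π / (N k : ℝ)) L (𝓝 0) :=
      tendsto_const_nhds.div_atTop hT.tendsto_cast_sites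
    refine hstep.zero_mul_isBoundedUnder_le ⟨1, eventually_map.2 ?_⟩
    filter_upwards [hs] with k ⟨hs0, hs1⟩
    rw [Function.comp_apply, Real.norm_eq_abs, abs_le]
    constructor <;> linarith
  have hlim := ((Complex.continuous_ofReal.tendsto _).comp hy).add
    (((Complex.continuous_ofReal.tendsto _).comp hshift).mul_const I)
  simpa [nodeCentre, Function.comp_def] using hlim

theorem norm_mul_nodeCentre_sub_le {N : ℕ} (hN : N ≠ 0) (x : ℝ) {s : ℝ} (hs : s ∈ Icc (0 : ℝ) 1) :
    ‖N * (nodeCentre N x s - x)‖ ≤ π := by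
  have hNc : (N : ℂ) ≠ 0 := mod_cast hN
  have heq : (N : ℂ) * (nodeCentre N x s - x) = (2 * π * (s - 1 / 2) : ℝ) * I := by
    rw [nodeCentre]
    push_cast
    field_simp
    ring
  obtain ⟨hs0, hs1⟩ := hs
  rw [heq, norm_mul, Complex.norm_I, mul_one, Complex.norm_real, Real.norm_eq_abs, abs_le]
  constructor <;> nlinarith [Real.pi_pos]

theorem eventually_abs_im_nodeSum_nodeCentre_lt (hρ0 : 0 < ρ) (hρ1 : ρ < 1) (hx : critLogMod ρ < x)
    (hf : DifferentiableOn ℂ f (logCoordImage ρ))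
    (hfc : ∀ ζ ∈ logCoordImage ρ, f (conj ζ) = conj (f ζ)) (hT : ThermodynamicLimit ρ L N p)
    (hy : Tendsto y L (𝓝 x)) (hs : ∀ᶠ k in L, s k ∈ Icc (0 : ℝ) 1) {c : ℝ}
    (hc : |(f (levelPoint ρ x)).im| < c) :
    ∀ᶠ k in L, |(nodeSum (N k) (p k) f (nodeCentre (N k) (y k) (s k))).im| < c := by
  have hπ := Real.pi_pos
  obtain ⟨ε, hε0, hε⟩ : ∃ ε > 0, |(f (levelPoint ρ x)).im| + ε * π < c :=
    ⟨(c - |(f (levelPoint ρ x)).im|) / (2 * π), by bound, by field_simp; linarith⟩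
  have hsmall := nodeSum_sub_isLittleO hρ0 hρ1 hx hf hT (tendsto_nodeCentre hT hy hs)
    ((Complex.continuous_ofReal.tendsto _).comp hy)
  rw [levelSlope_ofReal hρ0 hρ1 hx hfc] at hsmall
  filter_upwards [isLittleO_iff.1 hsmall hε0, hs, hT.eventually_sites_pos,
    hy.eventually (lt_mem_nhds hx)] with k hk hks hkN hky
  have hnorm := norm_mul_nodeCentre_sub_le hkN.ne' (y k) hks
  simp only [Function.comp_apply] at hk
  set σ := nodeCentre (N k) (y k) (s k)
  set D : ℂ := (((f (levelPoint ρ x)).im / π : ℝ) : ℂ)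
  have hsplit : nodeSum (N k) (p k) f σ = nodeSum (N k) (p k) f (y k)
      + ((nodeSum (N k) (p k) f σ - nodeSum (N k) (p k) f (y k) - N k * D * (σ - y k))
        + D * (N k * (σ - y k))) := by
    ring
  have hD : ‖D‖ = |(f (levelPoint ρ x)).im| / π := by
    rw [Complex.norm_real, norm_div, Real.norm_eq_abs, Real.norm_of_nonneg hπ.le]
  rw [hsplit, Complex.add_im, im_nodeSum_ofReal hρ0 hρ1 hkN (hT.particles_eq k) hky hfc, zero_add]
  calc _ ≤ _ := (Complex.abs_im_le_norm _).trans (norm_add_le _ _)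
    _ ≤ ε * π + |(f (levelPoint ρ x)).im| / π * π := by
      rw [norm_mul, hD]
      gcongr
      exact hk.trans (by gcongr)
    _ = |(f (levelPoint ρ x)).im| + ε * π := by
      field_simp
      ring
    _ < c := hε

theorem eventually_nodeSol (hρ0 : 0 < ρ) (hρ1 : ρ < 1) (hx : critLogMod ρ < x) (he : e ≤ 1)
    (hT : ThermodynamicLimit ρ L N p) (hy : Tendsto y L (𝓝 x))
    (h : ∀ᶠ k in L, BetheSol ρ γ (N k) (p k) (lastMoved (p k) e) (y k) (s k) (u k) (l k)) :
    ∀ᶠ k in L, NodeSol ρ γ (N k) (p k) e (nodeCentre (N k) (y k) (s k)) (l k) := by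
  have hρπ : 0 < ρ * π := mul_pos hρ0 Real.pi_pos
  have hs := h.mono fun k hk => hk.phase_mem
  have hdiff := differentiableOn_logHalf_logCoordInv hρ0 hρ1
  have him : |((logHalf ∘ logCoordInv ρ) (levelPoint ρ x)).im| < ρ * π := by
    rw [Function.comp_apply, logHalf_im, abs_of_pos (arg_levelPoint_pos hρ0 hρ1 hx)]
    exact arg_levelPoint_lt hρ0 hρ1 hx
  have hstep : Tendsto (fun k => e * (2 * π / (N k : ℝ))) L (𝓝 0) := by
    simpa using (tendsto_const_nhds.div_atTop hT.tendsto_cast_sites).const_mul (e : ℝ)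
  have hlast := (Complex.continuous_im.tendsto _).comp (tendsto_lastStep hρ0 hρ1 hx
    hdiff.continuousOn hT (tendsto_nodeCentre hT hy hs) e)
  have herror := (hstep.sub hlast).abs
  simp only [Complex.zero_im, sub_zero, abs_zero] at herror
  filter_upwards [h, hT.eventually_particles_add_two_lt hρ1, hT.eventually_particles_pos hρ0,
    hy.eventually (lt_mem_nhds hx), herror.eventually (gt_mem_nhds hρπ),
    eventually_abs_im_nodeSum_nodeCentre_lt hρ0 hρ1 hx hdiff
      (fun ζ hζ => logHalf_logCoordInv_conj hρ0 hρ1 hζ) hT hy hs him]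
    with k hk hpN hp0 hky herr hmain
  exact hk.nodeSol hρ0 hρ1 hpN hp0 (hT.particles_eq k) he hky hmain herr

theorem exists_tendsto_nodeSol [L.IsCountablyGenerated] (hρ0 : 0 < ρ) (hρ1 : ρ < 1) (hγ : 0 < γ)
    (he : e ≤ 1) (hT : ThermodynamicLimit ρ L N p)
    (h : ∀ᶠ k in L, ∃ y s u, BetheSol ρ γ (N k) (p k) (lastMoved (p k) e) y s u (l k)) :
    ∃ σ : ι → ℂ, Tendsto σ L (𝓝 (ρ * Real.log (rStar ρ γ) : ℝ)) ∧
      ∀ᶠ k in L, NodeSol ρ γ (N k) (p k) e (σ k) (l k) := by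
  simp only [skolem] at h
  obtain ⟨y, s, u, h⟩ := h
  have hy := tendsto_logMod_of_betheSol hρ0 hρ1 hγ hT h
  have hx := critLogMod_lt_mul_log hρ0 hρ1 (rStar_spec hρ0 hρ1 hγ).1
  exact ⟨_, tendsto_nodeCentre hT hy (h.mono fun k hk => hk.phase_mem),
    eventually_nodeSol hρ0 hρ1 hx he hT hy h⟩

theorem tendsto_norm_rpow [L.IsCountablyGenerated] (hρ0 : 0 < ρ) (hρ1 : ρ < 1) (hγ : 0 < γ)
    (hT : ThermodynamicLimit ρ L N p) {C : ι → ℂ} (hC : ∀ᶠ k in L, C k ≠ 0)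
    (h : ∀ᶠ k in L, ∃ e s u l, BetheSol ρ γ (N k) (p k) (lastMoved (p k) e)
      (Real.log ‖C k‖ / N k) s u l) :
    Tendsto (fun k => ‖C k‖ ^ (1 / (p k : ℝ))) L (𝓝 (rStar ρ γ)) := by
  simp only [skolem] at h
  obtain ⟨e, s, u, l, h⟩ := h
  have hr := (rCrit_pos hρ0 hρ1).trans (rStar_spec hρ0 hρ1 hγ).1
  have hexp := (Real.continuous_exp.tendsto _).comp
    ((tendsto_logMod_of_betheSol hρ0 hρ1 hγ hT h).div_const ρ)
  rw [mul_div_cancel_left₀ _ hρ0.ne', Real.exp_log hr] at hexp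
  refine hexp.congr' ?_
  filter_upwards [hC] with k hk
  rw [Real.rpow_def_of_pos (norm_pos_iff.2 hk), Function.comp_apply, hT.particles_eq k, div_div,
    mul_one_div, mul_comm ρ]

end Asymptotics

/-! ### The spectral gap and the largest eigenvalue -/

section Spectrum

open Asymptotics

variable {ι : Type*} {ρ γ x : ℝ} {L : Filter ι} {N p : ι → ℕ} {σ τ l l₁ l₂ : ι → ℂ}
  {P Q : ℂ → ℂ} {w : ℂ}

theorem tendsto_mul_nodeSum_sub (hρ0 : 0 < ρ) (hρ1 : ρ < 1) (hx : critLogMod ρ < x)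
    (hP : DifferentiableOn ℂ P (logCoordImage ρ)) (hQ : DifferentiableOn ℂ Q (logCoordImage ρ))
    (hslope : levelSlope ρ P x ≠ 0) (hT : ThermodynamicLimit ρ L N p) (hσ : Tendsto σ L (𝓝 x))
    (hτ : Tendsto τ L (𝓝 x)) {b : ℂ}
    (h : Tendsto (fun k => N k * (nodeSum (N k) (p k) P (σ k) - nodeSum (N k) (p k) P (τ k))) L
      (𝓝 b)) :
    Tendsto (fun k => N k * (nodeSum (N k) (p k) Q (σ k) - nodeSum (N k) (p k) Q (τ k))) L
      (𝓝 (levelSlope ρ Q x / levelSlope ρ P x * b)) := by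
  have hratio := nodeSum_sub_isLittleO_nodeSum_sub hρ0 hρ1 hx hP hQ hslope hT hσ hτ
  have hzero := (isLittleO_one_iff ℂ).1 (((isBigO_refl (fun k => (N k : ℂ)) L).mul_isLittleO
    hratio).trans_isBigO (h.isBigO_one ℂ))
  refine (hzero.add (h.const_mul (levelSlope ρ Q x / levelSlope ρ P x))).congr (fun k => ?_)
    |>.trans_eq ?_
  · ring
  · rw [zero_add]

theorem levelSlope_logHalf (hρ0 : 0 < ρ) (hρ1 : ρ < 1) (hx : critLogMod ρ < x) :
    levelSlope ρ (logHalf ∘ logCoordInv ρ) x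
      = ((logCoordInv ρ (levelPoint ρ x) + 1).arg / π : ℝ) := by
  rw [levelSlope_ofReal hρ0 hρ1 hx fun ζ hζ => logHalf_logCoordInv_conj hρ0 hρ1 hζ,
    Function.comp_apply, logHalf_im]

theorem levelSlope_logHalf_ne_zero (hρ0 : 0 < ρ) (hρ1 : ρ < 1) (hx : critLogMod ρ < x) :
    levelSlope ρ (logHalf ∘ logCoordInv ρ) x ≠ 0 := by
  rw [levelSlope_logHalf hρ0 hρ1 hx]
  exact mod_cast (div_pos (arg_levelPoint_pos hρ0 hρ1 hx) Real.pi_pos).ne'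

theorem gInf_eq (hρ0 : 0 < ρ) (hw : w - 1 ∈ slitPlane) (harg : (w + 1).arg ≠ 0) :
    gInf ρ w = -(1 / 2) * ((w.im / π : ℝ) / ((w + 1).arg / π : ℝ)
        * (2 * π * I * (1 - 1 / (w + 1) * (logCoordDeriv ρ w)⁻¹))
      + 2 * π * I * (logCoordDeriv ρ w)⁻¹) := by
  have hderiv := logCoordDeriv_ne_zero hρ0 hw
  have hsub := Complex.slitPlane_ne_zero hw
  have hadd := Complex.slitPlane_ne_zero (add_one_mem_slitPlane hw)
  have hargc : ((w + 1).arg : ℂ) ≠ 0 := mod_cast harg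
  have hπ : (π : ℂ) ≠ 0 := mod_cast Real.pi_ne_zero
  rw [logCoordDeriv, div_ne_zero_iff] at hderiv
  obtain ⟨hnum, -⟩ := hderiv
  rw [gInf, logCoordDeriv, add_comm 1 w]
  push_cast
  field_simp
  ring

theorem tendsto_mul_nodeSum_sub_of_nodeSol (hρ0 : 0 < ρ) (hρ1 : ρ < 1) (hx : critLogMod ρ < x)
    (hT : ThermodynamicLimit ρ L N p) (hτ : Tendsto τ L (𝓝 x))
    (h₁ : ∀ᶠ k in L, NodeSol ρ γ (N k) (p k) 0 (σ k) (l₁ k))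
    (h₂ : ∀ᶠ k in L, NodeSol ρ γ (N k) (p k) 1 (τ k) (l₂ k)) :
    Tendsto (fun k => N k * (nodeSum (N k) (p k) (logHalf ∘ logCoordInv ρ) (τ k)
        - nodeSum (N k) (p k) (logHalf ∘ logCoordInv ρ) (σ k))) L
      (𝓝 (2 * π * I * (1 - deriv (logHalf ∘ logCoordInv ρ) (levelPoint ρ x)))) := by
  have hlast := tendsto_mul_lastStep hρ0 hρ1 hx (differentiableOn_logHalf_logCoordInv hρ0 hρ1)
    hT hτ 1
  refine ((hlast.const_sub (2 * π * I)).congr' ?_).trans_eq (by congr 1; push_cast; ring)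
  filter_upwards [h₁, h₂, hT.eventually_sites_pos] with k hk₁ hk₂ hkN
  have hN : (N k : ℂ) ≠ 0 := mod_cast hkN.ne'
  have heq₁ := hk₁.consistency_eq
  have heq₂ := hk₂.consistency_eq
  rw [lastStep_zero, add_zero] at heq₁
  rw [heq₁, eq_sub_of_add_eq heq₂]
  push_cast
  field_simp
  ring

theorem tendsto_gap (hρ0 : 0 < ρ) (hρ1 : ρ < 1) (hx : critLogMod ρ < x)
    (hT : ThermodynamicLimit ρ L N p) (hσ : Tendsto σ L (𝓝 x)) (hτ : Tendsto τ L (𝓝 x))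
    (h₁ : ∀ᶠ k in L, NodeSol ρ γ (N k) (p k) 0 (σ k) (l₁ k))
    (h₂ : ∀ᶠ k in L, NodeSol ρ γ (N k) (p k) 1 (τ k) (l₂ k)) :
    Tendsto (fun k => N k * (l₁ k - l₂ k)) L (𝓝 (gInf ρ (logCoordInv ρ (levelPoint ρ x)))) := by
  have hm := levelPoint_mem hρ0 hρ1 hx
  have hinv := differentiableOn_logCoordInv hρ0 hρ1
  have hsum := tendsto_mul_nodeSum_sub hρ0 hρ1 hx (differentiableOn_logHalf_logCoordInv hρ0 hρ1)
    hinv (levelSlope_logHalf_ne_zero hρ0 hρ1 hx) hT hτ hσ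
    (tendsto_mul_nodeSum_sub_of_nodeSol hρ0 hρ1 hx hT hτ h₁ h₂)
  have hlast := tendsto_mul_lastStep hρ0 hρ1 hx hinv hT hτ 1
  rw [levelSlope_logHalf hρ0 hρ1 hx,
    levelSlope_ofReal hρ0 hρ1 hx fun ζ hζ => logCoordInv_conj hρ0 hρ1 hζ,
    (hasDerivAt_logHalf_logCoordInv hρ0 hρ1 hm).deriv] at hsum
  rw [(hasDerivAt_logCoordInv hρ0 hρ1 hm).deriv, Nat.cast_one, one_mul] at hlast
  rw [gInf_eq hρ0 (logCoordInv_mem hm) (arg_levelPoint_pos hρ0 hρ1 hx).ne']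
  refine ((hsum.add hlast).const_mul (-(1 / 2))).congr' ?_
  filter_upwards [h₁, h₂] with k hk₁ hk₂
  rw [hk₁.val_eq, hk₂.val_eq, lastStep_zero]
  ring

/-- A primitive of `(w - 1) / 2` with respect to the logarithmic coordinate; its imaginary part is
`π` times the limiting eigenvalue density `LambdaInf`. -/
noncomputable def energyPrim (ρ : ℝ) (w : ℂ) : ℂ := 1 / 2 * (w - 2 * (1 - ρ) * logHalf w)

theorem energyPrim_im (ρ : ℝ) (w : ℂ) : (energyPrim ρ w).im / π = LambdaInf ρ w := by
  have heq : energyPrim ρ w = (1 / 2 : ℝ) * (w - (2 * (1 - ρ) : ℝ) * logHalf w) := by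
    rw [energyPrim]
    push_cast
    ring
  rw [heq, Complex.im_ofReal_mul, Complex.sub_im, Complex.im_ofReal_mul, logHalf_im, LambdaInf,
    add_comm 1 w]
  ring

theorem energyPrim_conj (ρ : ℝ) (hw : w + 1 ∈ slitPlane) :
    energyPrim ρ (conj w) = conj (energyPrim ρ w) := by
  simp only [energyPrim, logHalf_conj hw, map_mul, map_sub, map_div₀, map_one, map_ofNat,
    Complex.conj_ofReal]

theorem hasDerivAt_energyPrim_logCoordInv (hρ0 : 0 < ρ) (hρ1 : ρ < 1) {ζ : ℂ}
    (hζ : ζ ∈ logCoordImage ρ) :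
    HasDerivAt (fun ζ => energyPrim ρ (logCoordInv ρ ζ)) (1 / 2 * (logCoordInv ρ ζ - 1)) ζ := by
  have hw := logCoordInv_mem hζ
  have hsub := Complex.slitPlane_ne_zero hw
  have hadd := Complex.slitPlane_ne_zero (add_one_mem_slitPlane hw)
  have hderiv := logCoordDeriv_ne_zero hρ0 hw
  rw [logCoordDeriv, div_ne_zero_iff] at hderiv
  obtain ⟨hnum, -⟩ := hderiv
  refine (((hasDerivAt_logCoordInv hρ0 hρ1 hζ).sub ((hasDerivAt_logHalf_logCoordInv hρ0 hρ1
    hζ).const_mul (2 * (1 - ρ : ℂ)))).const_mul (1 / 2 : ℂ)).congr_deriv ?_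
  rw [logCoordDeriv]
  field_simp
  ring

theorem nodeSum_half_sub_one (N p : ℕ) (f : ℂ → ℂ) (σ : ℂ) :
    nodeSum N p (fun ζ => 1 / 2 * (f ζ - 1)) σ = 1 / 2 * (nodeSum N p f σ - p) := by
  simp only [nodeSum, ← Finset.mul_sum, Finset.sum_sub_distrib, Finset.sum_const, Finset.card_range,
    nsmul_eq_mul, mul_one]

theorem nodeSum_logHalf_sub_isBigO_one (hρ0 : 0 < ρ) (hρ1 : ρ < 1) (hx : critLogMod ρ < x)
    (hT : ThermodynamicLimit ρ L N p) :
    (fun k => nodeSum (N k) (p k) (logHalf ∘ logCoordInv ρ) x - p k * consistency ρ x)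
      =O[L] fun _ => (1 : ℝ) := by
  have hsum := nodeSum_sub_isBigO_one hρ0 hρ1 hx
    (fun ζ hζ => hasDerivAt_logHalfPrim_logCoordInv hρ0 hρ1 hζ) hT tendsto_const_nhds
  rw [levelSlope_ofReal hρ0 hρ1 hx fun ζ hζ => by rw [logCoordInv_conj hρ0 hρ1 hζ,
    logHalfPrim_conj ρ (add_one_mem_slitPlane (logCoordInv_mem hζ))]] at hsum
  refine hsum.congr_left fun k => ?_
  have hpc : (p k : ℂ) = ρ * N k := mod_cast hT.particles_eq k
  have hρ : (ρ : ℂ) ≠ 0 := mod_cast hρ0.ne'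
  rw [consistency, hpc, Function.comp_def]
  push_cast
  field_simp

theorem nodeSum_energy_sub_isBigO_one (hρ0 : 0 < ρ) (hρ1 : ρ < 1) (hx : critLogMod ρ < x)
    (hT : ThermodynamicLimit ρ L N p) :
    (fun k => 1 / 2 * (nodeSum (N k) (p k) (logCoordInv ρ) x - p k)
      - (N k * LambdaInf ρ (logCoordInv ρ (levelPoint ρ x)) : ℝ)) =O[L] fun _ => (1 : ℝ) := by
  have hsum := nodeSum_sub_isBigO_one hρ0 hρ1 hx
    (fun ζ hζ => hasDerivAt_energyPrim_logCoordInv hρ0 hρ1 hζ) hT tendsto_const_nhds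
  rw [levelSlope_ofReal hρ0 hρ1 hx fun ζ hζ => by rw [logCoordInv_conj hρ0 hρ1 hζ,
    energyPrim_conj ρ (add_one_mem_slitPlane (logCoordInv_mem hζ))], energyPrim_im] at hsum
  refine hsum.congr_left fun k => ?_
  rw [nodeSum_half_sub_one, Complex.ofReal_mul, Complex.ofReal_natCast]

theorem eigenvalue_sub_isBigO_one (hρ0 : 0 < ρ) (hρ1 : ρ < 1) (hx : critLogMod ρ < x)
    (hγ : consistency ρ x = γ) (hT : ThermodynamicLimit ρ L N p) (hσ : Tendsto σ L (𝓝 x))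
    (h : ∀ᶠ k in L, NodeSol ρ γ (N k) (p k) 0 (σ k) (l k)) :
    (fun k => l k - (N k * LambdaInf ρ (logCoordInv ρ (levelPoint ρ x)) : ℝ))
      =O[L] fun _ => (1 : ℝ) := by
  have hlogHalf : (fun k => nodeSum (N k) (p k) (logHalf ∘ logCoordInv ρ) (σ k)
      - nodeSum (N k) (p k) (logHalf ∘ logCoordInv ρ) x) =O[L] fun _ => (1 : ℝ) := by
    refine (nodeSum_logHalf_sub_isBigO_one hρ0 hρ1 hx hT).neg_left.congr' ?_ .rfl
    filter_upwards [h] with k hk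
    have heq := hk.consistency_eq
    rw [lastStep_zero, add_zero, Nat.cast_zero, zero_mul, zero_mul, add_zero, ← hγ] at heq
    rw [heq, neg_sub]
  have hratio := nodeSum_sub_isLittleO_nodeSum_sub hρ0 hρ1 hx
    (differentiableOn_logHalf_logCoordInv hρ0 hρ1) (differentiableOn_logCoordInv hρ0 hρ1)
    (levelSlope_logHalf_ne_zero hρ0 hρ1 hx) hT hσ tendsto_const_nhds
  have henergy := (hratio.isBigO.trans hlogHalf).add (hlogHalf.const_mul_left
    (levelSlope ρ (logCoordInv ρ) x / levelSlope ρ (logHalf ∘ logCoordInv ρ) x))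
  refine ((henergy.const_mul_left (1 / 2)).add
    (nodeSum_energy_sub_isBigO_one hρ0 hρ1 hx hT)).congr' ?_ .rfl
  filter_upwards [h] with k hk
  rw [hk.val_eq, lastStep_zero]
  ring

theorem tendsto_gap_of_betheSol [L.IsCountablyGenerated] (hρ0 : 0 < ρ) (hρ1 : ρ < 1) (hγ : 0 < γ)
    (hT : ThermodynamicLimit ρ L N p)
    (h₁ : ∀ᶠ k in L, ∃ y s u, BetheSol ρ γ (N k) (p k) (lastMoved (p k) 0) y s u (l₁ k))
    (h₂ : ∀ᶠ k in L, ∃ y s u, BetheSol ρ γ (N k) (p k) (lastMoved (p k) 1) y s u (l₂ k)) :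
    Tendsto (fun k => N k * (l₁ k - l₂ k)) L (𝓝 (gapConst γ ρ)) := by
  have hr := (rStar_spec hρ0 hρ1 hγ).1
  obtain ⟨σ, hσ, hsol₁⟩ := exists_tendsto_nodeSol hρ0 hρ1 hγ zero_le_one hT h₁
  obtain ⟨τ, hτ, hsol₂⟩ := exists_tendsto_nodeSol hρ0 hρ1 hγ le_rfl hT h₂
  rw [gapConst, uStar_eq hρ0 hρ1 hr]
  exact tendsto_gap hρ0 hρ1 (critLogMod_lt_mul_log hρ0 hρ1 hr) hT hσ hτ hsol₁ hsol₂

theorem tendsto_gap_of_choiceTwo [L.IsCountablyGenerated] (hρ0 : 0 < ρ) (hρ1 : ρ < 1) (hγ : 0 < γ)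
    (hT : ThermodynamicLimit ρ L N p)
    (h₁ : ∀ᶠ k in L, ∃ C, Realizes (N k) (p k) γ (choiceOne (p k)) C (l₁ k))
    (h₂ : ∀ᶠ k in L, ∃ C, Realizes (N k) (p k) γ (choiceTwo (p k)) C (l₂ k)) :
    Tendsto (fun k => N k * (l₁ k - l₂ k)) L (𝓝 (gapConst γ ρ)) := by
  refine tendsto_gap_of_betheSol hρ0 hρ1 hγ hT ?_ ?_
  · filter_upwards [h₁, hT.eventually_particles_add_two_lt hρ1] with k ⟨C, hC⟩ hpN
    exact ⟨_, hC.exists_betheSol_choiceOne hρ0 hρ1 hpN (hT.particles_eq k)⟩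
  · filter_upwards [h₂, hT.eventually_particles_add_two_lt hρ1, hT.eventually_particles_pos hρ0]
      with k ⟨C, hC⟩ hpN hp0
    exact ⟨_, hC.exists_betheSol_choiceTwo hρ0 hρ1 hpN hp0 (hT.particles_eq k)⟩

-- Conjugating the Bethe roots exchanges the two choices for the second eigenvalue and preserves
-- the choice for the first.
theorem tendsto_gap_of_choiceTwo' [L.IsCountablyGenerated] (hρ0 : 0 < ρ) (hρ1 : ρ < 1)
    (hγ : 0 < γ) (hT : ThermodynamicLimit ρ L N p)
    (h₁ : ∀ᶠ k in L, ∃ C, Realizes (N k) (p k) γ (choiceOne (p k)) C (l₁ k))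
    (h₂ : ∀ᶠ k in L, ∃ C, Realizes (N k) (p k) γ (choiceTwo' (N k) (p k)) C (l₂ k)) :
    Tendsto (fun k => N k * (l₁ k - l₂ k)) L (𝓝 (conj (gapConst γ ρ))) := by
  have hgap : Tendsto (fun k => N k * (conj (l₁ k) - conj (l₂ k))) L (𝓝 (gapConst γ ρ)) := by
    refine tendsto_gap_of_betheSol hρ0 hρ1 hγ hT ?_ ?_
    · filter_upwards [h₁, hT.eventually_particles_add_two_lt hρ1] with k ⟨C, hC⟩ hpN
      exact ⟨_, hC.exists_betheSol_conj_choiceOne hρ0 hρ1 hpN (hT.particles_eq k)⟩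
    · filter_upwards [h₂, hT.eventually_particles_add_two_lt hρ1, hT.eventually_particles_pos hρ0]
        with k ⟨C, hC⟩ hpN hp0
      exact ⟨_, hC.exists_betheSol_conj_choiceTwo' hρ0 hρ1 hpN hp0 (hT.particles_eq k)⟩
  simpa [Function.comp_def] using (Complex.continuous_conj.tendsto _).comp hgap

theorem exists_eventually_norm_eigenvalue_sub_le [L.IsCountablyGenerated] (hρ0 : 0 < ρ)
    (hρ1 : ρ < 1) (hγ : 0 < γ) (hT : ThermodynamicLimit ρ L N p)
    (h : ∀ᶠ k in L, ∃ C, Realizes (N k) (p k) γ (choiceOne (p k)) C (l k)) :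
    ∃ K : ℝ, ∀ᶠ k in L, ‖l k - (N k * Lam γ ρ : ℝ)‖ ≤ K := by
  obtain ⟨hr, hrγ⟩ := rStar_spec hρ0 hρ1 hγ
  have hsol : ∀ᶠ k in L, ∃ y s u,
      BetheSol ρ γ (N k) (p k) (lastMoved (p k) 0) y s u (l k) := by
    filter_upwards [h, hT.eventually_particles_add_two_lt hρ1] with k ⟨C, hC⟩ hpN
    exact ⟨_, hC.exists_betheSol_choiceOne hρ0 hρ1 hpN (hT.particles_eq k)⟩
  obtain ⟨σ, hσ, hnode⟩ := exists_tendsto_nodeSol hρ0 hρ1 hγ zero_le_one hT hsol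
  obtain ⟨K, hK⟩ := (eigenvalue_sub_isBigO_one hρ0 hρ1 (critLogMod_lt_mul_log hρ0 hρ1 hr) hrγ hT
    hσ hnode).bound
  rw [Lam, uStar_eq hρ0 hρ1 hr]
  exact ⟨K, by simpa only [norm_one, mul_one] using hK⟩

theorem tendsto_norm_rpow_of_realizes [L.IsCountablyGenerated] (hρ0 : 0 < ρ) (hρ1 : ρ < 1)
    (hγ : 0 < γ) (hT : ThermodynamicLimit ρ L N p) {C : ι → ℂ}
    (h : ∀ᶠ k in L, Realizes (N k) (p k) γ (choiceOne (p k)) (C k) (l k) ∨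
      Realizes (N k) (p k) γ (choiceTwo (p k)) (C k) (l k) ∨
      Realizes (N k) (p k) γ (choiceTwo' (N k) (p k)) (C k) (l k)) :
    Tendsto (fun k => ‖C k‖ ^ (1 / (p k : ℝ))) L (𝓝 (rStar ρ γ)) := by
  refine tendsto_norm_rpow hρ0 hρ1 hγ hT (h.mono fun k hk => ?_) ?_
  · rcases hk with hk | hk | hk <;> exact hk.1
  · filter_upwards [h, hT.eventually_particles_add_two_lt hρ1, hT.eventually_particles_pos hρ0]
      with k hk hpN hp0
    have hp := hT.particles_eq k
    rcases hk with hk | hk | hk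
    · obtain ⟨s, u, hsol⟩ := hk.exists_betheSol_choiceOne hρ0 hρ1 hpN hp
      exact ⟨_, s, u, _, hsol⟩
    · obtain ⟨s, u, hsol⟩ := hk.exists_betheSol_choiceTwo hρ0 hρ1 hpN hp0 hp
      exact ⟨_, s, u, _, hsol⟩
    · obtain ⟨s, u, hsol⟩ := hk.exists_betheSol_conj_choiceTwo' hρ0 hρ1 hpN hp0 hp
      exact ⟨_, s, u, _, hsol⟩

end Spectrum

end TASEP

open TASEP in
theorem theorem4p2_general {ρ : ℝ} (hρ0 : 0 < ρ) (hρ1 : ρ < 1) :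
    (∀ r, rCrit ρ < r → ∃! u, IsUStar ρ r u) ∧
    (∀ γ, 0 < γ → ∃! r, IsRStar ρ γ r) ∧
    StrictMonoOn (rStar ρ) (Set.Ioi 0) ∧
    Tendsto (rStar ρ) (𝓝[>] 0) (𝓝 (rCrit ρ)) ∧
    ∀ γ, 0 < γ → ∀ {ι : Type*} {L : Filter ι} [L.IsCountablyGenerated] {N p : ι → ℕ},
      ThermodynamicLimit ρ L N p → ∀ {l₁ l₂ : ι → ℂ},
      (∀ᶠ k in L, ∃ C, Realizes (N k) (p k) γ (choiceOne (p k)) C (l₁ k)) →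
      (∀ C : ι → ℂ,
        (∀ᶠ k in L, Realizes (N k) (p k) γ (choiceOne (p k)) (C k) (l₁ k)) →
        Tendsto (fun k => ‖C k‖ ^ (1 / (p k : ℝ))) L (𝓝 (rStar ρ γ))) ∧
      (∀ C : ι → ℂ,
        (∀ᶠ k in L, Realizes (N k) (p k) γ (choiceTwo (p k)) (C k) (l₂ k) ∨
          Realizes (N k) (p k) γ (choiceTwo' (N k) (p k)) (C k) (l₂ k)) →
        Tendsto (fun k => ‖C k‖ ^ (1 / (p k : ℝ))) L (𝓝 (rStar ρ γ))) ∧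
      (∃ K : ℝ, ∀ᶠ k in L, ‖l₁ k - ((N k * Lam γ ρ : ℝ) : ℂ)‖ ≤ K) ∧
      Tendsto (fun k => (N k : ℂ) * (l₁ k - l₂ k))
        (L ⊓ 𝓟 {k | ∃ C, Realizes (N k) (p k) γ (choiceTwo (p k)) C (l₂ k)})
        (𝓝 (gapConst γ ρ)) ∧
      Tendsto (fun k => (N k : ℂ) * (l₁ k - l₂ k))
        (L ⊓ 𝓟 {k | ∃ C, Realizes (N k) (p k) γ (choiceTwo' (N k) (p k)) C (l₂ k)})
        (𝓝 (starRingEnd ℂ (gapConst γ ρ))) := by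
  refine ⟨fun r => existsUnique_isUStar hρ0 hρ1, fun γ => existsUnique_isRStar hρ0 hρ1,
    strictMonoOn_rStar hρ0 hρ1, tendsto_rStar hρ0 hρ1, ?_⟩
  intro γ hγ ι L _ N p hT l₁ l₂ h₁
  have hres (S : Set ι) : ThermodynamicLimit ρ (L ⊓ 𝓟 S) N p := hT.comp (tendsto_id'.2 inf_le_left)
  refine ⟨fun C hC => ?_, fun C hC => ?_, ?_, ?_, ?_⟩
  · exact tendsto_norm_rpow_of_realizes hρ0 hρ1 hγ hT (hC.mono fun _ => Or.inl)
  · exact tendsto_norm_rpow_of_realizes hρ0 hρ1 hγ hT (hC.mono fun _ => Or.inr)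
  · exact exists_eventually_norm_eigenvalue_sub_le hρ0 hρ1 hγ hT h₁
  · exact tendsto_gap_of_choiceTwo hρ0 hρ1 hγ (hres _) (h₁.filter_mono inf_le_left)
      (mem_inf_of_right (mem_principal_self _))
  · exact tendsto_gap_of_choiceTwo' hρ0 hρ1 hγ (hres _) (h₁.filter_mono inf_le_left)
      (mem_inf_of_right (mem_principal_self _))

open TASEP in
theorem theorem4p2 (ρ : ℝ) (hρ0 : 0 < ρ) (hρ1 : ρ < 1) :
    -- `u_*` is well defined
    (∀ r, rCrit ρ < r → ∃! u, IsUStar ρ r u) ∧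
    -- the limiting consistency equation has a unique solution
    (∀ γ, 0 < γ → ∃! r, IsRStar ρ γ r) ∧
    StrictMonoOn (rStar ρ) (Set.Ioi 0) ∧
    Tendsto (rStar ρ) (𝓝[>] 0) (𝓝 (rCrit ρ)) ∧
    -- the thermodynamic limit, under the root-selection assumption
    ∀ γ : ℝ, 0 < γ →
    ∀ N p : ℕ → ℕ, Tendsto N atTop atTop → (∀ k, (p k : ℝ) = ρ * N k) →
    ∀ l₁ l₂ : ℕ → ℂ,
      (∀ᶠ k in atTop, IsLargestEigenvalue (N k) (p k) γ (l₁ k)) →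
      (∀ᶠ k in atTop, IsSecondEigenvalue (N k) (p k) γ (l₁ k) (l₂ k)) →
      (∀ᶠ k in atTop, RootSelection (N k) (p k) γ (l₁ k) (l₂ k)) →
      -- the consistency equations of both eigenvalues become the limiting one
      (∀ C : ℕ → ℂ,
        (∀ᶠ k in atTop, Realizes (N k) (p k) γ (choiceOne (p k)) (C k) (l₁ k)) →
        Tendsto (fun k => ‖C k‖ ^ (1 / (p k : ℝ))) atTop (𝓝 (rStar ρ γ))) ∧
      (∀ C : ℕ → ℂ,
        (∀ᶠ k in atTop, Realizes (N k) (p k) γ (choiceTwo (p k)) (C k) (l₂ k) ∨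
          Realizes (N k) (p k) γ (choiceTwo' (N k) (p k)) (C k) (l₂ k)) →
        Tendsto (fun k => ‖C k‖ ^ (1 / (p k : ℝ))) atTop (𝓝 (rStar ρ γ))) ∧
      -- the largest eigenvalue
      (∃ K : ℝ, ∀ᶠ k in atTop, ‖l₁ k - ((N k * Lam γ ρ : ℝ) : ℂ)‖ ≤ K) ∧
      -- the spectral gap, for each of the two complex conjugate choices of `l₂`
      Tendsto (fun k => (N k : ℂ) * (l₁ k - l₂ k))
        (atTop ⊓ 𝓟 {k | ∃ C, Realizes (N k) (p k) γ (choiceTwo (p k)) C (l₂ k)})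
        (𝓝 (gapConst γ ρ)) ∧
      Tendsto (fun k => (N k : ℂ) * (l₁ k - l₂ k))
        (atTop ⊓ 𝓟 {k | ∃ C, Realizes (N k) (p k) γ (choiceTwo' (N k) (p k)) C (l₂ k)})
        (𝓝 (starRingEnd ℂ (gapConst γ ρ))) := by
  obtain ⟨hu, hr, hmono, hlim, hasymp⟩ := theorem4p2_general hρ0 hρ1
  exact ⟨hu, hr, hmono, hlim, fun γ hγ N p hN hp l₁ l₂ _ _ hsel =>
    hasymp γ hγ ⟨hN, hp⟩ (hsel.mono fun _ h => h.1)⟩
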